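/- **Setting.** Let $P_1,\dots,P_m\subset\mathbb R^2$ (prototiles, distinguished by their index) be compact sets, each the closure of its interior. A tile of type $i$ is a placement $T=R_\alpha P_i+t$, with $R_\alpha$ the rotation through $\alpha\in[0,2\pi)$ and $t\in\mathbb R^2$; its orientation is $\varphi(T)=\alpha$. A collection of tiles is non-overlapping if no point is interior to two distinct tiles of it, and a tiling is a non-overlapping collection of tiles that covers $\mathbb R^2$. Two collections of tiles are congruent (copies of each other) if a map $z\mapsto Rz+s$, $R$ a rotation, carries one to the other. Let $\lambda>1$ and let $\sigma$ be a selfsimilar substitution: it assigns to each $P_i$ a finite non-overlapping collection $\sigma(P_i)$ of tiles with $\lambda P_i=\bigcup_{T\in\sigma(P_i)}T$, and is extended to tiles by $\sigma(RP_i+t)=R\sigma(P_i)+\lambda t$ and to collections of tiles by taking unions. The sets $\sigma^k(P_i)$ are the supertiles. The substitution is primitive if some power $M^k$, $k\ge1$, of the matrix $M_{ij}=\#\{T\in\sigma(P_j): T\text{ has type }i\}$ is strictly positive. A substitution tiling is a tiling in which every finite set of tiles has a copy contained in some supertile $\sigma^k(P_i)$. A substitution tiling $\mathcal T$ has statistical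 circular symmetry if its tiles can be numbered without repetition $\mathcal T=\{T_1,T_2,\dots\}$ such that for every $n\ge1$ there is $\ell\ge n$ for which $\{T_1,\dots,T_\ell\}$ is congruent to a supertile $\sigma^k(P_i)$ with $k\ge1$, and such that $$\lim_{n\to\infty}\frac1n\sum_{j=1}^n 1_{[x,y]}(\varphi(T_j))=\frac{y-x}{2\pi}\qquad\text{for all }0\le x<y<2\pi .$$ For $\Lambda\subset\mathbb R^2$ an autocorrelation of $\Lambda$ is a locally finite measure $\gamma$ that is the vague limit of $\frac{1}{\mathrm{vol}(B_r)}\sum_{x,y\in\Lambda\cap B_r}\delta_{x-y}$ ($B_r$ the closed ball of radius $r$ around $0$) along some sequence of radii $r=r_n\to\infty$; if the limit for $r\to\infty$ exists, it is the only autocorrelation. The diffraction measure is the Fourier transform $\widehat\gamma$ of $\gamma$ as a tempered distribution. **Theorem.** Let $\mathcal T$ be a primitive substitution tiling of $\mathbb R^2$ with statistical circular symmetry and prototiles $P_1,\dots,P_m$. Choose control points $x_i\in P_i$, and let $\Lambda=\{Rx_i+t : RP_i+t\in\mathcal T\}$. Then $\Lambda$ has an autocorrelation, and for every autocorrelation $\gamma$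 of $\Lambda$ the Fourier transform $\widehat\gamma$ is a measure that is circular symmetric, i.e. $\widehat\gamma(R^{-1}A)=\widehat\gamma(A)$ for all rotations $R$ about the origin and all Borel sets $A$. Consequently, the pure point part of $\widehat\gamma$ is $c\,\delta_0$ for some $c\ge0$, i.e. at most a single peak at the origin. -/

import Mathlib

open MeasureTheory Filter Topology Set
open scoped NNReal ENNReal SchwartzMap FourierTransform CompactlySupported

noncomputable section

namespace CircularTiling

/-! The plane `ℝ²` is `ℂ` with its Euclidean norm, inner product and Lebesgue measure; the rotation
through the angle `α` is multiplication by the unit complex number `exp (i α)`. -/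

/-- A placement `R P_i + t` of one of `m` (decorated) prototiles: its type `i`, its rotation `R`
and its translation vector `t`. -/
@[ext]
structure Tile (m : ℕ) where
  type : Fin m
  rot : Circle
  trans : ℂ

namespace Tile

variable {m : ℕ}

/-- The point `R x + t` of the tile `R P_i + t` that corresponds to the point `x` of `P_i`. -/
def place (T : Tile m) (x : ℂ) : ℂ := (T.rot : ℂ) * x + T.trans

/-- The subset of the plane that the tile `R P_i + t` occupies. -/
def carrier (P : Fin m → Set ℂ) (T : Tile m) : Set ℂ := T.place '' P T.type

/-- The image of a tile under the direct motion `z ↦ ρ z + s`. -/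
def move (ρ : Circle) (s : ℂ) (T : Tile m) : Tile m :=
  ⟨T.type, ρ * T.rot, (ρ : ℂ) * T.trans + s⟩

/-- The orientation `φ(T) ∈ [0, 2π)` of a tile. -/
def orientation (T : Tile m) : ℝ :=
  toIcoMod Real.two_pi_pos 0 (Complex.arg (T.rot : ℂ))

end Tile

/-- Two collections of tiles are congruent if a direct motion carries the first onto the second. -/
def Congruent {m : ℕ} (A B : Set (Tile m)) : Prop :=
  ∃ (ρ : Circle) (s : ℂ), Tile.move ρ s '' A = B

/-- No point lies in the interior of two distinct tiles of the collection. -/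
def NonOverlapping {m : ℕ} (P : Fin m → Set ℂ) (A : Set (Tile m)) : Prop :=
  A.Pairwise fun S T => Disjoint (interior (S.carrier P)) (interior (T.carrier P))

/-- A selfsimilar tile-substitution with prototiles `P_0, …, P_{m-1}` and inflation factor `λ`. -/
structure Substitution (m : ℕ) where
  proto : Fin m → Set ℂ
  isCompact_proto : ∀ i, IsCompact (proto i)
  closure_interior_proto : ∀ i, closure (interior (proto i)) = proto i
  scale : ℝ
  one_lt_scale : 1 < scale
  /-- The finite collection `σ(P_i)`. -/
  rule : Fin m → Finset (Tile m)
  nonOverlapping_rule : ∀ i, NonOverlapping proto (rule i : Set (Tile m))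
  selfsimilar : ∀ i, (fun z : ℂ => (scale : ℂ) * z) '' proto i = ⋃ T ∈ rule i, T.carrier proto

namespace Substitution

variable {m : ℕ} (σ : Substitution m)

/-- `σ(R P_i + t) = R σ(P_i) + λ t`. -/
def substTile (T : Tile m) : Set (Tile m) :=
  Tile.move T.rot ((σ.scale : ℂ) * T.trans) '' (σ.rule T.type : Set (Tile m))

/-- The substitution on collections of tiles. -/
def subst (A : Set (Tile m)) : Set (Tile m) := ⋃ T ∈ A, σ.substTile T

/-- The supertile `σ^k(P_i)`. -/
def supertile (k : ℕ) (i : Fin m) : Set (Tile m) := σ.subst^[k] {⟨i, 1, 0⟩}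

/-- The substitution matrix: entry `(i, j)` counts the tiles of type `i` in `σ(P_j)`. -/
def matrix : Matrix (Fin m) (Fin m) ℕ :=
  Matrix.of fun i j => ((σ.rule j).filter fun T => T.type = i).card

/-- Some power `M^k`, `k ≥ 1`, of the substitution matrix is strictly positive. -/
def IsPrimitive : Prop := ∃ k : ℕ, 1 ≤ k ∧ ∀ i j, 0 < (σ.matrix ^ k) i j

/-- A tiling of the plane: the tiles cover it, and no point is interior to two of them. -/
def IsTiling (𝒯 : Set (Tile m)) : Prop :=
  (⋃ T ∈ 𝒯, T.carrier σ.proto) = univ ∧ NonOverlapping σ.proto 𝒯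

/-- A substitution tiling: a tiling in which every finite set of tiles has a copy in some
supertile. -/
def IsSubstitutionTiling (𝒯 : Set (Tile m)) : Prop :=
  σ.IsTiling 𝒯 ∧ ∀ F : Set (Tile m), F.Finite → F ⊆ 𝒯 →
    ∃ (i : Fin m) (k : ℕ) (F' : Set (Tile m)), Congruent F F' ∧ F' ⊆ σ.supertile k i

/-- `T_0, T_1, …` enumerates the tiles of `𝒯` without repetition, and arbitrarily long initial
segments `{T_0, …, T_{ℓ-1}}` are congruent to supertiles of order at least `1`. -/
def IsSupertileNumbering (𝒯 : Set (Tile m)) (T : ℕ → Tile m) : Prop :=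
  Function.Injective T ∧ range T = 𝒯 ∧
    ∀ n : ℕ, ∃ ℓ : ℕ, n ≤ ℓ ∧ ∃ (i : Fin m) (k : ℕ), 1 ≤ k ∧
      Congruent (T '' Iio ℓ) (σ.supertile k i)

end Substitution

/-- A sequence is equidistributed in `[0, 2π)`. -/
def Equidistributed (a : ℕ → ℝ) : Prop :=
  ∀ x y : ℝ, 0 ≤ x → x < y → y < 2 * Real.pi →
    Tendsto (fun n : ℕ => (1 / (n : ℝ)) * ∑ j ∈ Finset.range n, (Icc x y).indicator 1 (a j))
      atTop (𝓝 ((y - x) / (2 * Real.pi)))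

/-- Statistical circular symmetry of a tiling: for a numbering of the tiles by growing supertiles,
the tile orientations are equidistributed. -/
def Substitution.HasStatisticalCircularSymmetry {m : ℕ} (σ : Substitution m)
    (𝒯 : Set (Tile m)) : Prop :=
  ∃ T : ℕ → Tile m, σ.IsSupertileNumbering 𝒯 T ∧ Equidistributed fun j => (T j).orientation

/-- The set `Λ` of the control points `R x_i + t` of the tiles `R P_i + t` of `𝒯`. -/
def controlPoints {m : ℕ} (x : Fin m → ℂ) (𝒯 : Set (Tile m)) : Set ℂ :=
  (fun T : Tile m => T.place (x T.type)) '' 𝒯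

/-- The measure `vol(B_r)⁻¹ ∑_{x, y ∈ Λ ∩ B_r} δ_{x - y}`, with `B_r` the closed ball of radius `r`
around the origin. -/
def finiteAutocorrelation (Λ : Set ℂ) (r : ℝ) : Measure ℂ :=
  (volume (Metric.closedBall (0 : ℂ) r))⁻¹ •
    Measure.sum fun p : ↥((Λ ∩ Metric.closedBall 0 r) ×ˢ (Λ ∩ Metric.closedBall 0 r)) =>
      Measure.dirac (p.1.1 - p.1.2)

/-- `γ` is an autocorrelation of `Λ`: a locally finite measure that is the vague limit of
the measures `finiteAutocorrelation Λ r` along some sequence of radii `r` tending to infinity.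
If the limit as `r → ∞` exists, it is the only autocorrelation of `Λ`. -/
def IsAutocorrelation (Λ : Set ℂ) (γ : Measure ℂ) : Prop :=
  IsLocallyFiniteMeasure γ ∧ ∃ r : ℕ → ℝ, Tendsto r atTop atTop ∧
    ∀ f : C_c(ℂ, ℝ), Tendsto (fun n => ∫ z, f z ∂(finiteAutocorrelation Λ (r n))) atTop
      (𝓝 (∫ z, f z ∂γ))

/-- The measure `μ` is the Fourier transform of the measure `γ` as a tempered distribution. -/
def IsFourierTransform (γ μ : Measure ℂ) : Prop :=
  ∃ (_ : γ.HasTemperateGrowth) (_ : μ.HasTemperateGrowth),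
    (𝓕 γ.toTemperedDistribution : 𝓢'(ℂ, ℂ)) = μ.toTemperedDistribution

/-- `R.μ = μ` for all rotations `R`, where `R.μ(A) = μ(R⁻¹ A)`. -/
def IsCircularSymmetric (μ : Measure ℂ) : Prop :=
  ∀ ρ : Circle, μ.map (fun z : ℂ => (ρ : ℂ) * z) = μ

/-- The pure point part of a measure. -/
def purePointPart (μ : Measure ℂ) : Measure ℂ :=
  Measure.sum fun ξ : ℂ => μ {ξ} • Measure.dirac ξ

end CircularTiling

end

noncomputable section

namespace CircularTiling

/-! Everything reduces to one asymptotic statement, `tendsto_integral_rotate_sub`: the finite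
autocorrelations give a test function and its rotated copy nearly the same integral. Hence every
autocorrelation is rotation invariant. The Fourier transform commutes with rotations, so the
diffraction is invariant too, and an atom off the origin would recur with equal mass all along a
circle, which local finiteness forbids.

To prove that statement, cut the ball into supertiles of a fixed large order. Prototile boundaries
are null sets (`volume_frontier_proto`), so pairs at bounded distance in different supertiles are
negligible, and the pair sum is almost a sum over supertiles (`exists_pairSum_ball`). Differences
ignore translations, so only type and orientation of a supertile count, and it suffices that the
pair sum of one large supertile hardly depends on its rotation. Cut it again into supertiles of
smaller order `k`: its pair sum is almost a sum over the tiles of some `σ^p(P_j)` of continuous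
functions of the orientation, one function per type. Trigonometric approximation reduces the claim
to the decay of sums of `u (type T) * T.rot ^ q` with `q ≠ 0`, relative to area
(`tendsto_twistedAverage`).

The hypothesis equidistributes all orientations together, not type by type. The area-weighted
twisted averages form a semigroup of sup-norm contractions. If an orbit does not tend to zero, a
limit point `v` of it keeps a constant positive norm. Strict convexity of the disc and primitivity
then make `T.rot ^ q * v T.type` constant on each supertile, with all entries of `v` of equal
modulus: up to a common factor, `T.rot ^ q` is determined by the type. Some power `n` brings these
finitely many phases into the half plane `re ≥ 1/2`, so the sums of `T.rot ^ (q * n)` are at least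
half the number of tiles, against Weyl's criterion (`false_of_norm_twistedAverage_eq`).

Existence is compactness. Disjoint interiors of area bounded below make the finite autocorrelations
uniformly translation bounded. Their Fourier transforms are the positive densities proportional to
`‖expSum L ξ‖ ^ 2`, again uniformly translation bounded, so vague limits exist on both sides and
remain Fourier dual. -/

/-! ### Vague convergence of measures on the plane -/

/-- A continuous cutoff function, equal to `1` on the ball of radius `R` and to `0` off the ball of
radius `R + 1`. -/
def cutoff (R : ℝ) (z : ℂ) : ℝ := max 0 (min 1 (R + 1 - ‖z‖))

lemma continuous_cutoff (R : ℝ) : Continuous (cutoff R) := by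
  unfold cutoff; fun_prop

lemma cutoff_nonneg (R : ℝ) (z : ℂ) : 0 ≤ cutoff R z := le_max_left _ _

lemma cutoff_le_one (R : ℝ) (z : ℂ) : cutoff R z ≤ 1 :=
  max_le zero_le_one (min_le_left _ _)

lemma cutoff_eq_one {R : ℝ} {z : ℂ} (h : ‖z‖ ≤ R) : cutoff R z = 1 := by
  unfold cutoff
  rw [min_eq_left (by linarith), max_eq_right zero_le_one]

lemma cutoff_eq_zero {R : ℝ} {z : ℂ} (h : R + 1 ≤ ‖z‖) : cutoff R z = 0 := by
  unfold cutoff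
  exact max_eq_left ((min_le_right _ _).trans (by linarith))

lemma cutoff_eq_zero_of_notMem {R : ℝ} {z : ℂ} (h : z ∉ Metric.closedBall (0 : ℂ) (R + 1)) :
    cutoff R z = 0 :=
  cutoff_eq_zero (by simp only [mem_closedBall_zero_iff, not_le] at h; exact h.le)

lemma hasCompactSupport_cutoff (R : ℝ) : HasCompactSupport (cutoff R) :=
  HasCompactSupport.intro (isCompact_closedBall 0 (R + 1)) fun _ h => cutoff_eq_zero_of_notMem h

/-- The measures `μ n` are uniformly bounded on every ball around the origin. -/
def UniformlyLocallyFinite (μ : ℕ → Measure ℂ) : Prop :=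
  ∀ R : ℝ, ∃ C : ℝ≥0, ∀ n, μ n (Metric.closedBall 0 R) ≤ C

/-- The measures `μ n` converge vaguely to `ν`. -/
def VagueLimit (μ : ℕ → Measure ℂ) (ν : Measure ℂ) : Prop :=
  ∀ f : C_c(ℂ, ℝ), Tendsto (fun n => ∫ z, f z ∂(μ n)) atTop (𝓝 (∫ z, f z ∂ν))

lemma isLocallyFinite_of_closedBall_lt_top {μ : Measure ℂ}
    (h : ∀ R : ℝ, μ (Metric.closedBall 0 R) < ∞) : IsLocallyFiniteMeasure μ := by
  refine ⟨fun z => ⟨Metric.closedBall 0 (‖z‖ + 1), ?_, h _⟩⟩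
  refine mem_of_superset (Metric.ball_mem_nhds z one_pos) fun w hw => ?_
  rw [mem_closedBall_zero_iff]
  rw [Metric.mem_ball, dist_eq_norm] at hw
  have := norm_sub_norm_le w z
  linarith

lemma UniformlyLocallyFinite.isLocallyFinite {μ : ℕ → Measure ℂ} (h : UniformlyLocallyFinite μ)
    (n : ℕ) : IsLocallyFiniteMeasure (μ n) :=
  isLocallyFinite_of_closedBall_lt_top fun R => by
    obtain ⟨C, hC⟩ := h R
    exact (hC n).trans_lt ENNReal.coe_lt_top

lemma norm_integral_le_of_closedBall {E : Type*} [NormedAddCommGroup E] [NormedSpace ℝ E]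
    {μ : Measure ℂ} {R δ : ℝ} {C : ℝ≥0} (hδ : 0 ≤ δ)
    (hμ : μ (Metric.closedBall 0 R) ≤ C) {h : ℂ → E} (h0 : ∀ z ∉ Metric.closedBall (0 : ℂ) R, h z = 0)
    (hb : ∀ z ∈ Metric.closedBall (0 : ℂ) R, ‖h z‖ ≤ δ) : ‖∫ z, h z ∂μ‖ ≤ δ * C := by
  rw [← setIntegral_eq_integral_of_forall_compl_eq_zero h0]
  refine (norm_setIntegral_le_of_norm_le_const (hμ.trans_lt ENNReal.coe_lt_top) hb).trans ?_
  gcongr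
  exact ENNReal.toReal_le_of_le_ofReal C.2 (by simpa using hμ)

lemma exists_closedBall_support (f : C_c(ℂ, ℝ)) :
    ∃ R : ℕ, ∀ z ∉ Metric.closedBall (0 : ℂ) R, f z = 0 := by
  obtain ⟨r, hr⟩ := f.hasCompactSupport.isBounded.subset_closedBall (0 : ℂ)
  obtain ⟨R, hR⟩ := exists_nat_ge r
  refine ⟨R, fun z hz => image_eq_zero_of_notMem_tsupport fun hz' => hz ?_⟩
  exact Metric.closedBall_subset_closedBall hR (hr hz')

lemma exists_denseSeq_approx (f : C(ℂ, ℝ)) {K : Set ℂ} (hK : IsCompact K) {ε : ℝ} (hε : 0 < ε) :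
    ∃ i : ℕ, ∀ z ∈ K, |f z - TopologicalSpace.denseSeq C(ℂ, ℝ) i z| < ε := by
  have h := (ContinuousMap.tendsto_iff_forall_isCompact_tendstoUniformlyOn
    (F := fun g : C(ℂ, ℝ) => g) (p := 𝓝 f) (f := f)).1 tendsto_id K hK
  rw [Metric.tendstoUniformlyOn_iff] at h
  obtain ⟨i, hi⟩ := (TopologicalSpace.denseRange_denseSeq C(ℂ, ℝ)).exists_mem_open
    isOpen_interior ⟨f, mem_interior_iff_mem_nhds.2 (h ε hε)⟩
  exact ⟨i, fun z hz => by simpa [Real.dist_eq] using interior_subset hi z hz⟩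

lemma integrable_compactlySupported (μ : Measure ℂ) [IsLocallyFiniteMeasure μ] (f : C_c(ℂ, ℝ)) :
    Integrable f μ :=
  f.continuous.integrable_of_hasCompactSupport f.hasCompactSupport

/-- A sequence of measures on the plane that is uniformly bounded on balls has a vaguely convergent
subsequence. -/
theorem UniformlyLocallyFinite.exists_vagueLimit {μ : ℕ → Measure ℂ}
    (hμ : UniformlyLocallyFinite μ) :
    ∃ (φ : ℕ → ℕ) (ν : Measure ℂ), StrictMono φ ∧ IsLocallyFiniteMeasure ν ∧
      VagueLimit (fun n => μ (φ n)) ν := by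
  have hfin := hμ.isLocallyFinite
  let g : ℕ → C(ℂ, ℝ) := TopologicalSpace.denseSeq C(ℂ, ℝ)
  -- A countable family that suffices for all test functions: compactness of a product of intervals
  -- gives one subsequence along which all its integrals converge, and the uniform mass bounds
  -- extend the convergence to every `f`.
  let ψ : ℕ × ℕ → ℂ → ℝ := fun p z => cutoff p.1 z * g p.2 z
  have hψc : ∀ p, Continuous (ψ p) := fun p => (continuous_cutoff _).mul (g p.2).continuous
  have hψs : ∀ p, HasCompactSupport (ψ p) := fun p => (hasCompactSupport_cutoff _).mul_right
  have hbound : ∀ p : ℕ × ℕ, ∃ B : ℝ, ∀ n, ∫ z, ψ p z ∂(μ n) ∈ Metric.closedBall (0 : ℝ) B := by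
    intro p
    obtain ⟨C, hC⟩ := hμ (p.1 + 1)
    obtain ⟨δ, hδ⟩ := (hψs p).exists_bound_of_continuous (hψc p)
    refine ⟨δ * C, fun n => ?_⟩
    rw [mem_closedBall_zero_iff]
    refine norm_integral_le_of_closedBall ((norm_nonneg _).trans (hδ 0)) (hC n) (fun z hz => ?_)
      fun z _ => hδ z
    simp [ψ, cutoff_eq_zero_of_notMem hz]
  choose B hB using hbound
  obtain ⟨a, -, φ, hφ, ha⟩ := (isCompact_univ_pi fun p => isCompact_closedBall (0 : ℝ) (B p)).tendsto_subseq
    (x := fun n p => ∫ z, ψ p z ∂(μ n)) fun n p _ => hB p n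
  rw [tendsto_pi_nhds] at ha
  have hconv : ∀ f : C_c(ℂ, ℝ), ∃ l, Tendsto (fun n => ∫ z, f z ∂(μ (φ n))) atTop (𝓝 l) := by
    intro f
    apply cauchySeq_tendsto_of_complete
    obtain ⟨R, hR⟩ := exists_closedBall_support f
    obtain ⟨C, hC⟩ := hμ (R + 1)
    rw [Metric.cauchySeq_iff']
    intro ε hε
    have hC1 : (0 : ℝ) < C + 1 := by positivity
    -- The approximation is needed on the whole ball of radius `R + 1` where the cutoff may be
    -- nonzero; `C + 1` avoids division by zero.
    obtain ⟨i, hi⟩ := exists_denseSeq_approx f.toContinuousMap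
      (isCompact_closedBall (0 : ℂ) (R + 1)) (ε := ε / (4 * (C + 1))) (by positivity)
    have happrox : ∀ n, |∫ z, f z ∂(μ n) - ∫ z, ψ (R, i) z ∂(μ n)| ≤ ε / 4 := by
      intro n
      have := hfin n
      rw [← integral_sub (integrable_compactlySupported _ f)
        ((hψc _).integrable_of_hasCompactSupport (hψs _))]
      refine (norm_integral_le_of_closedBall (E := ℝ) (δ := ε / (4 * (C + 1))) (by positivity) (hC n)
        (fun z hz => ?_) fun z hz => ?_).trans ?_
      · have hz' : z ∉ Metric.closedBall (0 : ℂ) R := fun h =>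
          hz (Metric.closedBall_subset_closedBall (by linarith) h)
        simp [ψ, cutoff_eq_zero_of_notMem hz, hR z hz']
      · have hf : f z = cutoff R z * f z := by
          by_cases hzR : z ∈ Metric.closedBall (0 : ℂ) R
          · rw [cutoff_eq_one (by simpa using hzR), one_mul]
          · rw [hR z hzR, mul_zero]
        have h1 : f z - ψ (R, i) z = cutoff R z * (f z - g i z) := by
          rw [mul_sub, ← hf]
        rw [h1, norm_mul, Real.norm_eq_abs, Real.norm_eq_abs, abs_of_nonneg (cutoff_nonneg _ _)]
        have h2 : |f z - g i z| ≤ ε / (4 * (C + 1)) := (hi z hz).le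
        calc cutoff R z * |f z - g i z| ≤ 1 * (ε / (4 * (C + 1))) := by
              gcongr
              exact cutoff_le_one _ _
          _ = _ := one_mul _
      · rw [div_mul_eq_mul_div, div_le_div_iff₀ (by positivity) (by norm_num)]
        nlinarith [C.2]
    have hca := (ha (R, i)).cauchySeq
    rw [Metric.cauchySeq_iff'] at hca
    obtain ⟨N, hN⟩ := hca (ε / 4) (by positivity)
    refine ⟨N, fun n hn => ?_⟩
    have h1 := happrox (φ n)
    have h2 := happrox (φ N)
    have h3 := hN n hn
    simp only [Real.dist_eq, Function.comp_apply] at h3 ⊢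
    rw [abs_le] at h1 h2
    rw [abs_lt] at h3 ⊢
    constructor <;> linarith
  choose l hl using hconv
  have hfin' : ∀ n, IsLocallyFiniteMeasure (μ (φ n)) := fun n => hfin (φ n)
  let Λ₀ : C_c(ℂ, ℝ) →ₗ[ℝ] ℝ :=
    { toFun := l
      map_add' := fun f g => by
        refine tendsto_nhds_unique (hl (f + g)) (((hl f).add (hl g)).congr fun n => ?_)
        exact (integral_add (integrable_compactlySupported _ f)
          (integrable_compactlySupported _ g)).symm
      map_smul' := fun c f => by
        refine tendsto_nhds_unique (hl (c • f)) (((hl f).const_mul c).congr fun n => ?_)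
        exact (integral_const_mul c _).symm }
  let Λ : C_c(ℂ, ℝ) →ₚ[ℝ] ℝ := PositiveLinearMap.mk₀ Λ₀ fun f hf =>
    ge_of_tendsto' (hl f) fun n => integral_nonneg hf
  refine ⟨φ, RealRMK.rieszMeasure Λ, hφ, inferInstance, fun f => ?_⟩
  rw [RealRMK.integral_rieszMeasure]
  exact hl f

/-! ### Translation bounded measures and Schwartz functions -/

/-- All closed unit balls have measure at most `C`. -/
def TranslationBounded (ν : Measure ℂ) (C : ℝ≥0) : Prop :=
  ∀ z : ℂ, ν (Metric.closedBall z 1) ≤ C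

/-- For each `R`, the `μ n`-measures of balls of radius `R` are uniformly bounded. -/
def UniformlyTranslationBounded (μ : ℕ → Measure ℂ) : Prop :=
  ∀ R : ℝ, ∃ C : ℝ≥0, ∀ n z, μ n (Metric.closedBall z R) ≤ C

lemma UniformlyTranslationBounded.uniformlyLocallyFinite {μ : ℕ → Measure ℂ}
    (h : UniformlyTranslationBounded μ) : UniformlyLocallyFinite μ := fun R => by
  obtain ⟨C, hC⟩ := h R
  exact ⟨C, fun n => hC n 0⟩

lemma TranslationBounded.isLocallyFinite {ν : Measure ℂ} {C : ℝ≥0} (h : TranslationBounded ν C) :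
    IsLocallyFiniteMeasure ν :=
  ⟨fun z => ⟨_, Metric.closedBall_mem_nhds z one_pos, (h z).trans_lt ENNReal.coe_lt_top⟩⟩

/-- The weight `(1 + ‖z‖)⁻³`. -/
def weight (z : ℂ) : ℝ := (1 + ‖z‖) ^ (-((3 : ℕ) : ℝ))

lemma weight_nonneg (z : ℂ) : 0 ≤ weight z := by unfold weight; positivity

lemma continuous_weight : Continuous weight := by
  unfold weight
  exact Continuous.rpow_const (by fun_prop) fun z => Or.inl (by positivity)

lemma weight_eq (z : ℂ) : weight z = ((1 + ‖z‖) ^ 3)⁻¹ := by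
  unfold weight
  rw [Real.rpow_neg (by positivity), Real.rpow_natCast]

lemma weight_le_of_dist_le {u z : ℂ} (h : dist u z ≤ 1) : weight z ≤ 8 * weight u := by
  rw [weight_eq, weight_eq]
  have h1 : ‖u‖ ≤ ‖z‖ + 1 := by
    have := norm_sub_norm_le u z
    rw [dist_eq_norm] at h
    linarith
  have h2 : (1 + ‖u‖) ^ 3 ≤ 8 * (1 + ‖z‖) ^ 3 := by
    calc (1 + ‖u‖) ^ 3 ≤ (2 * (1 + ‖z‖)) ^ 3 := by
          gcongr
          linarith [norm_nonneg z]
      _ = _ := by ring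
  rw [← div_eq_mul_inv, inv_eq_one_div, div_le_div_iff₀ (by positivity) (by positivity)]
  linarith

lemma lintegral_weight_volume_lt_top : ∫⁻ z : ℂ, ENNReal.ofReal (weight z) < ∞ :=
  finite_integral_one_add_norm (by norm_num [Complex.finrank_real_complex])

/-- Up to the factor `8`, the weight at `z` is at most its Lebesgue mean over the unit ball around
`z`. Tonelli then replaces `ν` by its masses of unit balls, each at most `C`. Since `K` depends on
no measure, the bound is uniform along sequences. -/
lemma exists_lintegral_weight_le :
    ∃ K : ℝ≥0, ∀ (ν : Measure ℂ) (C : ℝ≥0), TranslationBounded ν C →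
      ∫⁻ z, ENNReal.ofReal (weight z) ∂ν ≤ K * C := by
  let w : ℂ → ℝ≥0∞ := fun z => ENNReal.ofReal (weight z)
  have hw : Measurable w := (continuous_weight.measurable).ennreal_ofReal
  let V := volume (Metric.closedBall (0 : ℂ) 1)
  have hV0 : V ≠ 0 := (Metric.measure_closedBall_pos volume _ one_pos).ne'
  have hVt : V ≠ ∞ := measure_closedBall_lt_top.ne
  have hKt : V⁻¹ * (8 * ∫⁻ z, w z) ≠ ∞ :=
    ENNReal.mul_ne_top (ENNReal.inv_ne_top.2 hV0)
      (ENNReal.mul_ne_top (by norm_num) lintegral_weight_volume_lt_top.ne)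
  refine ⟨(V⁻¹ * (8 * ∫⁻ z, w z)).toNNReal, fun ν C hν => ?_⟩
  have := hν.isLocallyFinite
  rw [ENNReal.coe_toNNReal hKt]
  let F : ℂ → ℂ → ℝ≥0∞ := fun z u => {p : ℂ × ℂ | dist p.1 p.2 ≤ 1}.indicator (fun p => 8 * w p.2) (z, u)
  have hF : Measurable (Function.uncurry F) :=
    (Measurable.const_mul (hw.comp measurable_snd) 8).indicator
      (isClosed_le (by fun_prop) continuous_const).measurableSet
  have h1 : ∀ z, w z * V ≤ ∫⁻ u, F z u := by
    intro z
    have hVz : V = volume (Metric.closedBall z 1) := by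
      simp only [V, Complex.volume_closedBall]
    rw [hVz, ← setLIntegral_const, ← lintegral_indicator Metric.isClosed_closedBall.measurableSet]
    refine lintegral_mono fun u => ?_
    by_cases hu : u ∈ Metric.closedBall z 1
    · rw [Metric.mem_closedBall] at hu
      have h2 : F z u = 8 * w u := indicator_of_mem (s := {p : ℂ × ℂ | dist p.1 p.2 ≤ 1})
        (by simpa [dist_comm] using hu) _
      rw [indicator_of_mem (by simpa using hu), h2]
      calc w z ≤ ENNReal.ofReal (8 * weight u) := ENNReal.ofReal_le_ofReal (weight_le_of_dist_le hu)
        _ = 8 * w u := by rw [ENNReal.ofReal_mul (by norm_num)]; simp [w]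
    · rw [indicator_of_notMem hu]
      exact zero_le
  have h3 : ∀ u, ∫⁻ z, F z u ∂ν ≤ 8 * w u * C := by
    intro u
    have : (fun z => F z u) = (Metric.closedBall u 1).indicator fun _ => 8 * w u := by
      ext z
      by_cases hz : dist z u ≤ 1 <;> simp [F, indicator, hz]
    rw [this, lintegral_indicator Metric.isClosed_closedBall.measurableSet, setLIntegral_const]
    gcongr
    exact hν u
  have h4 : (∫⁻ z, w z ∂ν) * V ≤ 8 * (∫⁻ z, w z) * C := by
    calc (∫⁻ z, w z ∂ν) * V = ∫⁻ z, w z * V ∂ν := (lintegral_mul_const _ hw).symm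
      _ ≤ ∫⁻ z, (∫⁻ u, F z u) ∂ν := lintegral_mono h1
      _ = ∫⁻ u, ∫⁻ z, F z u ∂ν := lintegral_lintegral_swap hF.aemeasurable
      _ ≤ ∫⁻ u, 8 * w u * C := lintegral_mono h3
      _ = 8 * (∫⁻ z, w z) * C := by
        rw [lintegral_mul_const _ (hw.const_mul 8), lintegral_const_mul _ hw]
  calc ∫⁻ z, w z ∂ν = V⁻¹ * ((∫⁻ z, w z ∂ν) * V) := by
        rw [mul_comm, mul_assoc, ENNReal.mul_inv_cancel hV0 hVt, mul_one]
    _ ≤ V⁻¹ * (8 * (∫⁻ z, w z) * C) := by gcongr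
    _ = _ := by ring

lemma TranslationBounded.hasTemperateGrowth {ν : Measure ℂ} {C : ℝ≥0}
    (h : TranslationBounded ν C) : ν.HasTemperateGrowth := by
  obtain ⟨K, hK⟩ := exists_lintegral_weight_le
  -- The integrand of temperate growth with exponent `3` is literally `weight`; the exponent only
  -- has to exceed the dimension `2`.
  refine ⟨⟨3, continuous_weight.aestronglyMeasurable, ?_⟩⟩
  change HasFiniteIntegral weight ν
  rw [hasFiniteIntegral_iff_ofReal (ae_of_all _ weight_nonneg)]
  exact (hK ν C h).trans_lt (by rw [← ENNReal.coe_mul]; exact ENNReal.coe_lt_top)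

/-- Vague limits see only continuous functions, so a cutoff is squeezed between the indicators of
the balls of radius `1` and `2`; this is why the hypothesis concerns the larger radius. -/
lemma VagueLimit.translationBounded {μ : ℕ → Measure ℂ} {ν : Measure ℂ}
    [IsLocallyFiniteMeasure ν] (hv : VagueLimit μ ν) {C : ℝ≥0}
    (hC : ∀ n z, μ n (Metric.closedBall z 2) ≤ C) : TranslationBounded ν C := by
  intro z
  let f : C_c(ℂ, ℝ) := ⟨⟨fun w => cutoff 1 (w - z), (continuous_cutoff 1).comp (by fun_prop)⟩,
    (hasCompactSupport_cutoff 1).comp_homeomorph (Homeomorph.subRight z)⟩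
  have hf : ∀ w, f w = cutoff 1 (w - z) := fun _ => rfl
  have h1 : ∀ n, ∫ w, f w ∂(μ n) ≤ C := by
    intro n
    have h0 : ∀ w ∉ Metric.closedBall z 2, f w = 0 := fun w hw => cutoff_eq_zero (by
      rw [Metric.mem_closedBall, dist_eq_norm] at hw
      linarith)
    rw [← setIntegral_eq_integral_of_forall_compl_eq_zero h0]
    refine (Real.le_norm_self _).trans ((norm_setIntegral_le_of_norm_le_const (C := 1)
      ((hC n z).trans_lt ENNReal.coe_lt_top) fun w _ => ?_).trans ?_)
    · rw [hf, Real.norm_eq_abs, abs_of_nonneg (cutoff_nonneg _ _)]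
      exact cutoff_le_one _ _
    · rw [one_mul]
      exact ENNReal.toReal_le_of_le_ofReal C.2 (by simpa using hC n z)
  have h2 : ∫ w, f w ∂ν ≤ C := le_of_tendsto' (hv f) h1
  have h3 : ν (Metric.closedBall z 1) ≤ ENNReal.ofReal (∫ w, f w ∂ν) := by
    rw [ofReal_integral_eq_lintegral_ofReal (integrable_compactlySupported ν f)
      (ae_of_all _ fun w => cutoff_nonneg _ _), ← lintegral_indicator_one
      Metric.isClosed_closedBall.measurableSet]
    refine lintegral_mono fun w => ?_
    by_cases hw : w ∈ Metric.closedBall z 1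
    · rw [hf, cutoff_eq_one (by simpa [dist_eq_norm] using hw)]
      simp [indicator_of_mem hw]
    · simp [indicator_of_notMem hw]
  refine h3.trans ?_
  simpa using ENNReal.ofReal_le_ofReal h2

/-- Decay of order `4`, one more than the weight needs: the spare factor makes tails outside large
balls uniformly small. -/
lemma exists_norm_schwartz_le (φ : 𝓢(ℂ, ℂ)) :
    ∃ M : ℝ, 0 ≤ M ∧ ∀ z, ‖φ z‖ ≤ M * (1 + ‖z‖)⁻¹ * weight z := by
  refine ⟨2 ^ 4 * ((Finset.Iic (4, 0)).sup fun m => SchwartzMap.seminorm ℝ m.1 m.2) φ,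
    by positivity, fun z => ?_⟩
  have h := SchwartzMap.one_add_le_sup_seminorm_apply (𝕜 := ℝ) (m := (4, 0)) le_rfl le_rfl φ z
  rw [norm_iteratedFDeriv_zero] at h
  rw [weight_eq, mul_assoc, ← mul_inv, ← div_eq_mul_inv, le_div_iff₀ (by positivity)]
  calc _ = (1 + ‖z‖) ^ 4 * ‖φ z‖ := by ring
    _ ≤ _ := h

lemma schwartz_norm_le_weight {φ : 𝓢(ℂ, ℂ)} {M : ℝ} (hM : 0 ≤ M)
    (hφ : ∀ z, ‖φ z‖ ≤ M * (1 + ‖z‖)⁻¹ * weight z) (z : ℂ) : ‖φ z‖ ≤ M * weight z := by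
  refine (hφ z).trans ?_
  have h1 : (1 + ‖z‖)⁻¹ ≤ 1 := inv_le_one_of_one_le₀ (by linarith [norm_nonneg z])
  have := weight_nonneg z
  gcongr
  exact mul_le_of_le_one_right hM h1

lemma norm_integral_le_of_le_weight {ν : Measure ℂ} {C K : ℝ≥0}
    (hK : ∫⁻ z, ENNReal.ofReal (weight z) ∂ν ≤ K * C) {M : ℝ} (hM : 0 ≤ M) {h : ℂ → ℂ}
    (hh : ∀ z, ‖h z‖ ≤ M * weight z) : ‖∫ z, h z ∂ν‖ ≤ M * (K * C) := by
  refine (norm_integral_le_lintegral_norm h).trans ?_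
  refine ENNReal.toReal_le_of_le_ofReal (by positivity) ?_
  calc ∫⁻ z, ENNReal.ofReal ‖h z‖ ∂ν ≤ ∫⁻ z, ENNReal.ofReal M * ENNReal.ofReal (weight z) ∂ν :=
        lintegral_mono fun z => by
          rw [← ENNReal.ofReal_mul hM]
          exact ENNReal.ofReal_le_ofReal (hh z)
    _ = ENNReal.ofReal M * ∫⁻ z, ENNReal.ofReal (weight z) ∂ν :=
        lintegral_const_mul _ continuous_weight.measurable.ennreal_ofReal
    _ ≤ ENNReal.ofReal M * (K * C) := by gcongr
    _ = _ := by
      rw [ENNReal.ofReal_mul hM, ENNReal.ofReal_mul (by positivity)]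
      simp

lemma VagueLimit.tendsto_integral_complex {μ : ℕ → Measure ℂ} {ν : Measure ℂ}
    (hv : VagueLimit μ ν) (hμ : ∀ n, IsLocallyFiniteMeasure (μ n)) [IsLocallyFiniteMeasure ν]
    {h : ℂ → ℂ} (hc : Continuous h)
    (hs : HasCompactSupport h) :
    Tendsto (fun n => ∫ z, h z ∂(μ n)) atTop (𝓝 (∫ z, h z ∂ν)) := by
  let fre : C_c(ℂ, ℝ) := ⟨⟨fun z => (h z).re, by fun_prop⟩, hs.comp_left (g := Complex.re) rfl⟩
  let fim : C_c(ℂ, ℝ) := ⟨⟨fun z => (h z).im, by fun_prop⟩, hs.comp_left (g := Complex.im) rfl⟩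
  have key : ∀ (κ : Measure ℂ) [IsLocallyFiniteMeasure κ],
      ∫ z, h z ∂κ = ((∫ z, fre z ∂κ : ℝ) : ℂ) + ((∫ z, fim z ∂κ : ℝ) : ℂ) * Complex.I := by
    intro κ _
    exact (integral_re_add_im (hc.integrable_of_hasCompactSupport hs)).symm
  rw [key ν]
  simp_rw [fun n => key (μ n)]
  exact ((Complex.continuous_ofReal.tendsto _).comp (hv fre)).add
    (((Complex.continuous_ofReal.tendsto _).comp (hv fim)).mul_const _)

/-- Vague convergence of uniformly translation bounded measures implies convergence as tempered
distributions. -/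
theorem VagueLimit.tendsto_integral_schwartz {μ : ℕ → Measure ℂ} {ν : Measure ℂ}
    [IsLocallyFiniteMeasure ν] (hv : VagueLimit μ ν) (hμ : UniformlyTranslationBounded μ)
    (φ : 𝓢(ℂ, ℂ)) : Tendsto (fun n => ∫ z, φ z ∂(μ n)) atTop (𝓝 (∫ z, φ z ∂ν)) := by
  obtain ⟨C₁, hC₁⟩ := hμ 1
  obtain ⟨C₂, hC₂⟩ := hμ 2
  obtain ⟨K, hK⟩ := exists_lintegral_weight_le
  obtain ⟨M, hM, hφ⟩ := exists_norm_schwartz_le φ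
  let C := max C₁ C₂
  have hfin := hμ.uniformlyLocallyFinite.isLocallyFinite
  have hν : ∫⁻ z, ENNReal.ofReal (weight z) ∂ν ≤ K * C :=
    hK _ _ fun z => (hv.translationBounded hC₂ z).trans (by simp [C])
  have hμn : ∀ n, ∫⁻ z, ENNReal.ofReal (weight z) ∂(μ n) ≤ K * C := fun n =>
    hK _ _ fun z => (hC₁ n z).trans (by simp [C])
  have hint : ∀ (κ : Measure ℂ), ∫⁻ z, ENNReal.ofReal (weight z) ∂κ ≤ K * C →
      Integrable φ κ := by
    intro κ hκ
    have : Integrable weight κ := by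
      refine ⟨continuous_weight.aestronglyMeasurable, ?_⟩
      rw [hasFiniteIntegral_iff_ofReal (ae_of_all _ weight_nonneg)]
      exact hκ.trans_lt (by rw [← ENNReal.coe_mul]; exact ENNReal.coe_lt_top)
    exact (this.const_mul M).mono' φ.continuous.aestronglyMeasurable
      (ae_of_all _ (schwartz_norm_le_weight hM hφ))
  let ψ : ℝ → ℂ → ℂ := fun R z => (cutoff R z : ℂ) * φ z
  have hψc : ∀ R, Continuous (ψ R) := fun R =>
    (Complex.continuous_ofReal.comp (continuous_cutoff R)).mul φ.continuous
  have hψs : ∀ R, HasCompactSupport (ψ R) := fun R =>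
    ((hasCompactSupport_cutoff R).comp_left (g := Complex.ofReal) rfl).mul_right
  -- Outside the ball of radius `R` the spare decay factor is at most `(1 + R)⁻¹`. The bound is the
  -- same for all `μ n` and for `ν`, so truncation and limit can be interchanged.
  have htail : ∀ R : ℝ, 0 ≤ R → ∀ (κ : Measure ℂ) [IsLocallyFiniteMeasure κ],
      ∫⁻ z, ENNReal.ofReal (weight z) ∂κ ≤ K * C →
      dist (∫ z, φ z ∂κ) (∫ z, ψ R z ∂κ) ≤ (1 + R)⁻¹ * (M * (K * C)) := by
    intro R hR κ _ hκ
    rw [dist_eq_norm, ← integral_sub (hint κ hκ)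
      ((hψc R).integrable_of_hasCompactSupport (hψs R)), ← mul_assoc]
    refine norm_integral_le_of_le_weight hκ (by positivity) fun z => ?_
    have h1 : φ z - ψ R z = ((1 - cutoff R z : ℝ) : ℂ) * φ z := by
      simp only [ψ]; push_cast; ring
    rw [h1, norm_mul, Complex.norm_real, Real.norm_eq_abs,
      abs_of_nonneg (sub_nonneg.2 (cutoff_le_one R z))]
    have hw := weight_nonneg z
    by_cases hz : ‖z‖ ≤ R
    · rw [cutoff_eq_one hz, sub_self, zero_mul]
      positivity
    · push Not at hz
      calc (1 - cutoff R z) * ‖φ z‖ ≤ 1 * (M * (1 + ‖z‖)⁻¹ * weight z) := by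
            gcongr
            · linarith [cutoff_nonneg R z]
            · exact hφ z
        _ ≤ (1 + R)⁻¹ * M * weight z := by
            rw [one_mul, mul_comm M]
            gcongr
  rw [Metric.tendsto_atTop]
  intro ε hε
  obtain ⟨R, hR0, hR⟩ : ∃ R : ℝ, 0 ≤ R ∧ (1 + R)⁻¹ * (M * (K * C)) < ε / 3 := by
    have : Tendsto (fun R : ℝ => (1 + R)⁻¹ * (M * (K * C))) atTop (𝓝 (0 * (M * (K * C)))) :=
      (tendsto_inv_atTop_zero.comp (tendsto_atTop_add_const_left _ _ tendsto_id)).mul_const _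
    rw [zero_mul] at this
    exact ((eventually_ge_atTop 0).and (this.eventually_lt_const (by positivity))).exists
  obtain ⟨N, hN⟩ := Metric.tendsto_atTop.1
    (hv.tendsto_integral_complex hfin (hψc R) (hψs R)) (ε / 3) (by positivity)
  refine ⟨N, fun n hn => ?_⟩
  have := hfin n
  have h1 := htail R hR0 (μ n) (hμn n)
  have h2 := htail R hR0 ν hν
  have h3 := hN n hn
  rw [dist_comm] at h2
  have h4 := dist_triangle4 (∫ z, φ z ∂(μ n)) (∫ z, ψ R z ∂(μ n)) (∫ z, ψ R z ∂ν) (∫ z, φ z ∂ν)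
  linarith

/-! ### Measures of temperate growth as tempered distributions -/

lemma isLocallyFinite_of_hasTemperateGrowth {μ : Measure ℂ} (h : μ.HasTemperateGrowth) :
    IsLocallyFiniteMeasure μ := by
  obtain ⟨n, hn⟩ := h.exists_integrable
  refine isLocallyFinite_of_closedBall_lt_top fun R => ?_
  have hpos : 0 < (1 + |R|) ^ (-(n : ℝ)) := by positivity
  refine (measure_mono fun z hz => ?_).trans_lt (hn.measure_ge_lt_top hpos)
  rw [mem_closedBall_zero_iff] at hz
  exact Real.rpow_le_rpow_of_nonpos (by positivity) (by linarith [le_abs_self R]) (by simp)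

/-- The level set `f = 1` is exactly `K`, so the powers of `f` decrease to the indicator of `K`
while staying smooth and compactly supported. -/
lemma exists_contDiff_eq_one_iff {K : Set ℂ} (hK : IsCompact K) :
    ∃ f : ℂ → ℝ, ContDiff ℝ (⊤ : ℕ∞) f ∧ HasCompactSupport f ∧ (∀ z, f z ∈ Icc (0 : ℝ) 1) ∧
      ∀ z, z ∈ K ↔ f z = 1 := by
  obtain ⟨R, hR⟩ := hK.isBounded.subset_ball (0 : ℂ)
  obtain ⟨f, hf, hr, h0, h1⟩ := exists_contMDiff_zero_iff_one_iff_of_isClosed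
    (modelWithCornersSelf ℝ ℂ) (n := ⊤) (Metric.isOpen_ball (x := (0 : ℂ)) (ε := R)).isClosed_compl
    hK.isClosed (disjoint_compl_left_iff_subset.2 hR)
  refine ⟨f, hf.contDiff, ?_, fun z => hr (mem_range_self z), h1⟩
  refine HasCompactSupport.intro (isCompact_closedBall (0 : ℂ) R) fun z hz => (h0 z).1 fun hz' => ?_
  exact hz (Metric.ball_subset_closedBall hz')

lemma tendsto_integral_pow {μ : Measure ℂ} [IsLocallyFiniteMeasure μ] {K : Set ℂ}
    (hK : IsCompact K) {f : ℂ → ℝ} (hf : Continuous f) (hs : HasCompactSupport f)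
    (h01 : ∀ z, f z ∈ Icc (0 : ℝ) 1) (h1 : ∀ z, z ∈ K ↔ f z = 1) :
    Tendsto (fun n : ℕ => ∫ z, ((f z ^ (n + 1) : ℝ) : ℂ) ∂μ) atTop (𝓝 (μ.real K : ℂ)) := by
  have h2 : ∫ z, K.indicator (fun _ => (1 : ℂ)) z ∂μ = (μ.real K : ℂ) := by
    rw [integral_indicator hK.measurableSet, setIntegral_const]
    simp
  rw [← h2]
  refine tendsto_integral_of_dominated_convergence f (fun n => ?_)
    (hf.integrable_of_hasCompactSupport hs) (fun n => ae_of_all _ fun z => ?_)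
    (ae_of_all _ fun z => ?_)
  · exact (Complex.continuous_ofReal.comp (hf.pow (n + 1))).aestronglyMeasurable
  · rw [Complex.norm_real, Real.norm_eq_abs, abs_of_nonneg (pow_nonneg (h01 z).1 _)]
    exact pow_le_of_le_one (h01 z).1 (h01 z).2 n.succ_ne_zero
  · by_cases hz : z ∈ K
    · simp [indicator_of_mem hz, (h1 z).1 hz]
    · rw [indicator_of_notMem hz]
      have h3 : f z < 1 := lt_of_le_of_ne (h01 z).2 fun h => hz ((h1 z).2 h)
      have h4 := (tendsto_pow_atTop_nhds_zero_of_lt_one (h01 z).1 h3).comp (tendsto_add_atTop_nat 1)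
      exact (Complex.continuous_ofReal.tendsto 0).comp h4

/-- A measure of temperate growth is determined by its integrals against Schwartz functions. -/
theorem ext_of_integral_schwartz_eq {μ ν : Measure ℂ} (hμ : μ.HasTemperateGrowth)
    (hν : ν.HasTemperateGrowth) (h : ∀ φ : 𝓢(ℂ, ℂ), ∫ z, φ z ∂μ = ∫ z, φ z ∂ν) : μ = ν := by
  have := isLocallyFinite_of_hasTemperateGrowth hμ
  have := isLocallyFinite_of_hasTemperateGrowth hν
  -- Regularity reduces equality of the measures to compact sets, whose masses are limits of
  -- integrals of powers of one smooth function.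
  apply Measure.OuterRegular.ext_isOpen
  apply Measure.InnerRegularWRT.eq_of_innerRegularWRT_of_forall_eq Measure.Regular.innerRegular
    Measure.Regular.innerRegular
  intro K hK
  obtain ⟨f, hf, hs, h01, h1⟩ := exists_contDiff_eq_one_iff hK
  have hsn : ∀ n : ℕ, HasCompactSupport fun z => ((f z ^ (n + 1) : ℝ) : ℂ) := fun n =>
    hs.comp_left (g := fun t : ℝ => ((t ^ (n + 1) : ℝ) : ℂ)) (by simp)
  have hfn : ∀ n : ℕ, ContDiff ℝ (⊤ : ℕ∞) fun z => ((f z ^ (n + 1) : ℝ) : ℂ) := fun n =>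
    Complex.ofRealCLM.contDiff.comp (hf.pow (n + 1))
  have h2 : ∀ n : ℕ, ∫ z, ((f z ^ (n + 1) : ℝ) : ℂ) ∂μ = ∫ z, ((f z ^ (n + 1) : ℝ) : ℂ) ∂ν :=
    fun n => h ((hsn n).toSchwartzMap (hfn n))
  have h3 := tendsto_integral_pow (μ := μ) hK hf.continuous hs h01 h1
  simp_rw [h2] at h3
  have h4 := tendsto_nhds_unique h3 (tendsto_integral_pow (μ := ν) hK hf.continuous hs h01 h1)
  have h5 : μ.real K = ν.real K := by exact_mod_cast h4
  exact (ENNReal.toReal_eq_toReal_iff' hK.measure_lt_top.ne hK.measure_lt_top.ne).1 h5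

lemma measurableEmbedding_mul_circle (ρ : Circle) : MeasurableEmbedding fun z : ℂ => (ρ : ℂ) * z :=
  (rotation ρ).toHomeomorph.measurableEmbedding

lemma hasTemperateGrowth_map_circle {μ : Measure ℂ} (h : μ.HasTemperateGrowth) (ρ : Circle) :
    (μ.map fun z : ℂ => (ρ : ℂ) * z).HasTemperateGrowth := by
  obtain ⟨n, hn⟩ := h.exists_integrable
  refine ⟨n, (measurableEmbedding_mul_circle ρ).integrable_map_iff.2 ?_⟩
  simpa [Function.comp_def, Circle.norm_coe ρ] using hn

/-- The Fourier transform of a circular symmetric measure is circular symmetric. -/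
theorem IsFourierTransform.isCircularSymmetric {γ μ : Measure ℂ} (h : IsFourierTransform γ μ)
    (hγ : IsCircularSymmetric γ) : IsCircularSymmetric μ := by
  obtain ⟨h1, h2, h3⟩ := h
  have key : ∀ φ : 𝓢(ℂ, ℂ), ∫ z, φ z ∂μ = ∫ z, (𝓕 φ) z ∂γ := by
    intro φ
    have := congrArg (fun D : 𝓢'(ℂ, ℂ) => D φ) h3
    simp only [TemperedDistribution.fourier_apply, Measure.toTemperedDistribution_apply] at this
    exact this.symm
  intro ρ
  refine ext_of_integral_schwartz_eq (hasTemperateGrowth_map_circle h2 ρ) h2 fun φ => ?_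
  rw [(measurableEmbedding_mul_circle ρ).integral_map]
  let φρ : 𝓢(ℂ, ℂ) := SchwartzMap.compCLMOfContinuousLinearEquiv ℂ
    (rotation ρ).toContinuousLinearEquiv φ
  have h4 : ∀ z, φρ z = φ (ρ * z) := fun z => rfl
  have h5 : ∀ z, (𝓕 φρ) z = (𝓕 φ) (ρ * z) := fun z => by
    rw [SchwartzMap.fourier_coe, SchwartzMap.fourier_coe]
    exact Real.fourier_comp_linearIsometry (rotation ρ) φ z
  simp_rw [← h4]
  rw [key φρ, key φ]
  simp_rw [h5]
  exact ((measurableEmbedding_mul_circle ρ).integral_map (fun z => (𝓕 φ) z)).symm.trans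
    (by rw [hγ ρ])

/-- The pure point part of a circular symmetric measure of temperate growth is concentrated at the
origin. -/
theorem IsCircularSymmetric.purePointPart_eq {μ : Measure ℂ} (h : IsCircularSymmetric μ)
    (hμ : μ.HasTemperateGrowth) : ∃ c : ℝ≥0, purePointPart μ = c • Measure.dirac 0 := by
  have := isLocallyFinite_of_hasTemperateGrowth hμ
  have hzero : ∀ ξ : ℂ, ξ ≠ 0 → μ {ξ} = 0 := by
    intro ξ hξ
    by_contra hne
    have hmass : ∀ ρ : Circle, μ {(ρ : ℂ) * ξ} = μ {ξ} := by
      intro ρ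
      conv_lhs => rw [← h ρ]
      rw [(measurableEmbedding_mul_circle ρ).map_apply]
      congr 1
      ext z
      simp
    have hinj : Function.Injective fun ρ : Circle => (ρ : ℂ) * ξ := fun a b hab =>
      Circle.ext (mul_right_cancel₀ hξ hab)
    have hinf : Infinite Circle := by
      have := (Ioc_infinite (neg_lt_self Real.pi_pos)).to_subtype
      exact Infinite.of_injective _ Circle.argEquiv.symm.injective
    -- Infinitely many atoms of equal positive mass on one circle, which lies in a compact ball of
    -- finite mass.
    have htop : μ (range fun ρ : Circle => (ρ : ℂ) * ξ) = ∞ := by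
      refine (infinite_range_of_injective hinj).meas_eq_top ⟨μ {ξ}, hne, ?_⟩
      rintro _ ⟨ρ, rfl⟩
      exact (hmass ρ).ge
    have hle : μ (range fun ρ : Circle => (ρ : ℂ) * ξ) ≤ μ (Metric.closedBall 0 ‖ξ‖) := by
      refine measure_mono ?_
      rintro _ ⟨ρ, rfl⟩
      simp [Circle.norm_coe ρ]
    rw [htop] at hle
    exact absurd ((isCompact_closedBall (0 : ℂ) ‖ξ‖).measure_lt_top (μ := μ)) (by simpa using hle)
  refine ⟨(μ {0}).toNNReal, ?_⟩
  have h0 : μ {0} ≠ ∞ := (isCompact_singleton.measure_lt_top).ne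
  ext s hs
  rw [purePointPart, Measure.sum_apply _ hs, tsum_eq_single 0 fun ξ hξ => by simp [hzero ξ hξ]]
  rw [Measure.smul_apply, Measure.smul_apply, ENNReal.smul_def, ENNReal.coe_toNNReal h0]

/-! ### Autocorrelations and their Fourier transforms -/

/-- The sum of `f (x - y)` over all pairs of points of `L`. -/
def pairSum {E : Type*} [AddCommMonoid E] (L : Finset ℂ) (f : ℂ → E) : E :=
  ∑ x ∈ L, ∑ y ∈ L, f (x - y)

/-- Every ball of radius `R` contains at most `N R` points of `Λ`. -/
def LocallySparse (Λ : Set ℂ) (N : ℝ → ℕ) : Prop :=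
  ∀ (R : ℝ) (z : ℂ), (Λ ∩ Metric.closedBall z R).Finite ∧
    (Λ ∩ Metric.closedBall z R).ncard ≤ N R

lemma LocallySparse.finite {Λ : Set ℂ} {N : ℝ → ℕ} (h : LocallySparse Λ N) (r : ℝ) :
    (Λ ∩ Metric.closedBall 0 r).Finite := (h r 0).1

lemma LocallySparse.mono {Λ Λ' : Set ℂ} {N : ℝ → ℕ} (h : LocallySparse Λ N) (h' : Λ' ⊆ Λ) :
    LocallySparse Λ' N := fun R z =>
  ⟨(h R z).1.subset (inter_subset_inter_left _ h'),
    (ncard_le_ncard (inter_subset_inter_left _ h') (h R z).1).trans (h R z).2⟩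

open Classical in
lemma LocallySparse.card_filter_le {L : Finset ℂ} {N : ℝ → ℕ} (h : LocallySparse (L : Set ℂ) N)
    (R : ℝ) (z : ℂ) : (L.filter fun y => y ∈ Metric.closedBall z R).card ≤ N R := by
  rw [← ncard_coe_finset]
  convert (h R z).2 using 2
  ext y
  simp

lemma finiteAutocorrelation_eq {Λ : Set ℂ} {r : ℝ} (h : (Λ ∩ Metric.closedBall 0 r).Finite) :
    finiteAutocorrelation Λ r = (volume (Metric.closedBall (0 : ℂ) r))⁻¹ •
      ∑ p ∈ h.toFinset ×ˢ h.toFinset, Measure.dirac (p.1 - p.2) := by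
  unfold finiteAutocorrelation
  congr 1
  have := (h.prod h).fintype
  rw [Measure.sum_fintype]
  refine (Finset.sum_subtype _ (fun p => ?_) fun p : ℂ × ℂ => Measure.dirac (p.1 - p.2)).symm
  simp [mem_prod]

lemma integral_finiteAutocorrelation {E : Type*} [NormedAddCommGroup E] [NormedSpace ℝ E]
    [CompleteSpace E] {Λ : Set ℂ} {r : ℝ}
    (h : (Λ ∩ Metric.closedBall 0 r).Finite) (f : ℂ → E) :
    ∫ z, f z ∂(finiteAutocorrelation Λ r) =
      (volume.real (Metric.closedBall (0 : ℂ) r))⁻¹ • pairSum h.toFinset f := by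
  rw [finiteAutocorrelation_eq h, integral_smul_measure, integral_finsetSum_measure]
  · rw [Finset.sum_product, ENNReal.toReal_inv]
    simp only [integral_dirac]
    rfl
  · exact fun p _ => integrable_dirac (by simp)

open Classical in
-- For each `x`, the partners `y` with `x - y` in the ball lie in the ball of radius `R` around `x -
-- z`, so there are at most `N R` of them, whatever `z` is.
lemma finiteAutocorrelation_closedBall_le {Λ : Set ℂ} {N : ℝ → ℕ} (h : LocallySparse Λ N)
    (r R : ℝ) (z : ℂ) : finiteAutocorrelation Λ r (Metric.closedBall z R) ≤
      (volume (Metric.closedBall (0 : ℂ) r))⁻¹ * ((h.finite r).toFinset.card * N R : ℕ) := by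
  rw [finiteAutocorrelation_eq (h.finite r), Measure.smul_apply, smul_eq_mul]
  gcongr
  rw [Measure.finsetSum_apply, Finset.sum_product]
  simp only [Measure.dirac_apply' _ (Metric.isClosed_closedBall (x := z)).measurableSet]
  have hle : ∀ x ∈ (h.finite r).toFinset, ∑ y ∈ (h.finite r).toFinset,
      (Metric.closedBall z R).indicator (1 : ℂ → ℝ≥0∞) (x - y) ≤ N R := by
    intro x _
    have h1 : ∀ y, (Metric.closedBall z R).indicator (1 : ℂ → ℝ≥0∞) (x - y) =
        if y ∈ Metric.closedBall (x - z) R then 1 else 0 := by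
      intro y
      have : x - y ∈ Metric.closedBall z R ↔ y ∈ Metric.closedBall (x - z) R := by
        rw [Metric.mem_closedBall, Metric.mem_closedBall, dist_eq_norm, dist_eq_norm,
          ← norm_neg (y - (x - z))]
        congr! 2
        ring
      rw [indicator_apply, if_congr this rfl rfl]
      rfl
    simp only [h1, Finset.sum_boole]
    exact_mod_cast (h.mono (Λ' := ((h.finite r).toFinset : Set ℂ)) (by simp)).card_filter_le R (x - z)
  refine (Finset.sum_le_sum hle).trans ?_
  rw [Finset.sum_const, nsmul_eq_mul]
  push_cast
  exact le_rfl

/-- The number of points of `Λ` in the ball of radius `r` is at most `c` times its area, if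
`r ≥ r₀`. -/
def QuadraticGrowth (Λ : Set ℂ) (r₀ : ℝ) (c : ℝ≥0) : Prop :=
  ∀ r ≥ r₀, ((Λ ∩ Metric.closedBall 0 r).ncard : ℝ≥0∞) ≤
    c * volume (Metric.closedBall (0 : ℂ) r)

lemma uniformlyTranslationBounded_finiteAutocorrelation {Λ : Set ℂ} {N : ℝ → ℕ}
    (h : LocallySparse Λ N) {r₀ : ℝ} {c : ℝ≥0} (hc : QuadraticGrowth Λ r₀ c)
    {r : ℕ → ℝ} (hr : ∀ n, r₀ ≤ r n) (hr0 : ∀ n, 0 < r n) :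
    UniformlyTranslationBounded fun n => finiteAutocorrelation Λ (r n) := by
  intro R
  refine ⟨c * N R, fun n z => (finiteAutocorrelation_closedBall_le h _ _ _).trans ?_⟩
  have h1 := hc (r n) (hr n)
  rw [ncard_eq_toFinset_card _ (h.finite (r n))] at h1
  have hV0 : volume (Metric.closedBall (0 : ℂ) (r n)) ≠ 0 :=
    (Metric.measure_closedBall_pos volume _ (hr0 n)).ne'
  have hVt : volume (Metric.closedBall (0 : ℂ) (r n)) ≠ ∞ := measure_closedBall_lt_top.ne
  push_cast
  calc _ ≤ (volume (Metric.closedBall (0 : ℂ) (r n)))⁻¹ *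
        (c * volume (Metric.closedBall (0 : ℂ) (r n)) * N R) := by gcongr
    _ = (volume (Metric.closedBall (0 : ℂ) (r n)) * (volume (Metric.closedBall (0 : ℂ) (r n)))⁻¹)
        * (c * N R) := by ring
    _ = _ := by rw [ENNReal.mul_inv_cancel hV0 hVt, one_mul]

theorem exists_isAutocorrelation {Λ : Set ℂ} {N : ℝ → ℕ} (h : LocallySparse Λ N) {r₀ : ℝ} {c : ℝ≥0}
    (hc : QuadraticGrowth Λ r₀ c) : ∃ γ, IsAutocorrelation Λ γ := by
  have hpos : 0 < max r₀ 1 := by positivity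
  have h1 := uniformlyTranslationBounded_finiteAutocorrelation h hc (r := fun n => max r₀ 1 + n)
    (fun n => by have := le_max_left r₀ 1; have : (0 : ℝ) ≤ n := n.cast_nonneg; linarith)
    (fun n => by positivity)
  obtain ⟨φ, γ, hφ, hγ, hv⟩ := h1.uniformlyLocallyFinite.exists_vagueLimit
  refine ⟨γ, hγ, fun n => max r₀ 1 + φ n, ?_, hv⟩
  exact tendsto_atTop_add_const_left _ _ (tendsto_natCast_atTop_atTop.comp hφ.tendsto_atTop)

/-- The radii of an autocorrelation may start out small or negative, where the counting bounds say
nothing; finitely many of them are dropped. -/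
lemma IsAutocorrelation.exists_vagueLimit {Λ : Set ℂ} {γ : Measure ℂ} (h : IsAutocorrelation Λ γ)
    (r₀ : ℝ) : ∃ r : ℕ → ℝ, (∀ n, r₀ ≤ r n) ∧ (∀ n, 0 < r n) ∧ Tendsto r atTop atTop ∧
      VagueLimit (fun n => finiteAutocorrelation Λ (r n)) γ := by
  obtain ⟨-, r, hr, hv⟩ := h
  obtain ⟨n₀, hn₀⟩ := eventually_atTop.1 (hr.eventually_ge_atTop (max r₀ 1))
  refine ⟨fun n => r (n + n₀), fun n => (le_max_left _ _).trans (hn₀ _ (by omega)),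
    fun n => zero_lt_one.trans_le ((le_max_right _ _).trans (hn₀ _ (by omega))),
    hr.comp (tendsto_add_atTop_nat n₀), fun f => (hv f).comp (tendsto_add_atTop_nat n₀)⟩

/-- The exponential sum over the points of `L`. -/
def expSum (L : Finset ℂ) (ξ : ℂ) : ℂ := ∑ x ∈ L, (Real.fourierChar (-inner ℝ ξ x) : ℂ)

lemma continuous_expSum (L : Finset ℂ) : Continuous (expSum L) := by
  unfold expSum
  refine continuous_finsetSum _ fun x _ => ?_
  exact continuous_subtype_val.comp (Real.continuous_fourierChar.comp (by fun_prop))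

lemma sum_fourierChar_sub (L : Finset ℂ) (ξ : ℂ) :
    ∑ x ∈ L, ∑ y ∈ L, (Real.fourierChar (-inner ℝ ξ (x - y)) : ℂ) = ((‖expSum L ξ‖ ^ 2 : ℝ) : ℂ) := by
  have h1 : ((‖expSum L ξ‖ ^ 2 : ℝ) : ℂ) = expSum L ξ * (starRingEnd ℂ) (expSum L ξ) := by
    rw [Complex.mul_conj, Complex.normSq_eq_norm_sq]
  rw [h1, expSum, map_sum, Finset.sum_mul_sum]
  refine Finset.sum_congr rfl fun x _ => Finset.sum_congr rfl fun y _ => ?_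
  rw [← Circle.coe_inv_eq_conj, ← Circle.coe_mul, ← AddChar.map_neg_eq_inv, ← AddChar.map_add_eq_mul]
  congr 2
  rw [inner_sub_right]
  ring

lemma pairSum_fourier (L : Finset ℂ) (φ : 𝓢(ℂ, ℂ)) :
    pairSum L (⇑(𝓕 φ : 𝓢(ℂ, ℂ))) = ∫ ξ, ((‖expSum L ξ‖ ^ 2 : ℝ) : ℂ) * φ ξ := by
  unfold pairSum
  simp_rw [SchwartzMap.fourier_coe, Real.fourier_eq]
  have hint : ∀ w : ℂ, Integrable fun v : ℂ => Real.fourierChar (-inner ℝ v w) • φ v := fun w =>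
    (Real.fourierIntegral_convergent_iff w).2 φ.integrable
  simp_rw [← integral_finsetSum L fun y _ => hint (_ - y)]
  rw [← integral_finsetSum L fun x _ => integrable_finsetSum L fun y _ => hint (x - y)]
  congr 1
  ext ξ
  rw [← sum_fourierChar_sub, Finset.sum_mul]
  refine Finset.sum_congr rfl fun x _ => ?_
  rw [Finset.sum_mul]
  rfl

/-- Positive definiteness in explicit form: the character sum over all differences is the squared
modulus of an exponential sum, hence a nonnegative density. -/
lemma exists_dual_measure (L : Finset ℂ) {c : ℝ} (hc : 0 ≤ c) :
    ∃ μ : Measure ℂ, IsLocallyFiniteMeasure μ ∧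
      ∀ φ : 𝓢(ℂ, ℂ), ∫ ξ, φ ξ ∂μ = c • pairSum L (⇑(𝓕 φ : 𝓢(ℂ, ℂ))) := by
  have hcont : Continuous fun ξ => c * ‖expSum L ξ‖ ^ 2 :=
    continuous_const.mul ((continuous_expSum L).norm.pow 2)
  refine ⟨volume.withDensity fun ξ => ENNReal.ofReal (c * ‖expSum L ξ‖ ^ 2),
    IsLocallyFiniteMeasure.withDensity_ofReal hcont, fun φ => ?_⟩
  rw [integral_withDensity_eq_integral_toReal_smul hcont.measurable.ennreal_ofReal
    (ae_of_all _ fun _ => ENNReal.ofReal_lt_top), pairSum_fourier, ← integral_smul]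
  congr 1
  ext ξ
  rw [ENNReal.toReal_ofReal (by positivity), Complex.real_smul, Complex.real_smul]
  push_cast
  ring

/-- A translation only multiplies the Fourier transform by a phase. So a single bump function bounds
the dual measures on all balls of one radius. -/
lemma norm_fourier_compSubConst (φ : 𝓢(ℂ, ℂ)) (a w : ℂ) :
    ‖(𝓕 (SchwartzMap.compSubConstCLM ℂ a φ)) w‖ = ‖(𝓕 φ) w‖ := by
  rw [SchwartzMap.fourier_coe, SchwartzMap.fourier_coe]
  have h1 : ⇑(SchwartzMap.compSubConstCLM ℂ a φ) = φ ∘ fun v => v + -a := by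
    ext v
    simp [sub_eq_add_neg]
  rw [h1]
  have h2 := congrFun (VectorFourier.fourierIntegral_comp_add_right Real.fourierChar volume
    (innerₗ ℂ) φ (-a)) w
  have h3 : ∀ g : ℂ → ℂ, 𝓕 g w = VectorFourier.fourierIntegral Real.fourierChar volume
    (innerₗ ℂ) g w := fun g => rfl
  rw [h3, h3, h2, Circle.norm_smul]

/-- A limit of translation bounded measures whose Fourier transforms are measures has a measure as
its Fourier transform. -/
theorem exists_isFourierTransform_of_vagueLimit {γ : Measure ℂ} {κ μ : ℕ → Measure ℂ}
    [IsLocallyFiniteMeasure γ] (hκ : UniformlyTranslationBounded κ) (hv : VagueLimit κ γ)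
    (hμ : ∀ n, IsLocallyFiniteMeasure (μ n))
    (hdual : ∀ n (φ : 𝓢(ℂ, ℂ)), ∫ ξ, φ ξ ∂(μ n) = ∫ z, (𝓕 φ) z ∂(κ n)) :
    ∃ γhat, IsFourierTransform γ γhat := by
  obtain ⟨C₁, hC₁⟩ := hκ 1
  obtain ⟨C₂, hC₂⟩ := hκ 2
  obtain ⟨K, hK⟩ := exists_lintegral_weight_le
  have hμb : UniformlyTranslationBounded μ := by
    intro R
    -- The mass of a ball under `μ n` is at most the integral of a translated bump, which by duality
    -- is an integral against `κ n` with a bound independent of `n` and of the centre. The maximum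
    -- keeps the inner radius positive when `R ≤ 0`.
    let b : ContDiffBump (0 : ℂ) := ⟨max R 1, max R 1 + 1, by positivity, by linarith⟩
    have hbs : HasCompactSupport fun z => ((b z : ℝ) : ℂ) :=
      b.hasCompactSupport.comp_left (g := Complex.ofReal) rfl
    let φ : 𝓢(ℂ, ℂ) := hbs.toSchwartzMap (Complex.ofRealCLM.contDiff.comp b.contDiff)
    obtain ⟨M, hM, hφ⟩ := exists_norm_schwartz_le (𝓕 φ)
    refine ⟨(M * (K * C₁)).toNNReal, fun n ξ => ?_⟩
    have := hμ n
    have h1 := hdual n (SchwartzMap.compSubConstCLM ℂ ξ φ)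
    have h2 : ‖∫ z, (𝓕 (SchwartzMap.compSubConstCLM ℂ ξ φ)) z ∂(κ n)‖ ≤ M * (K * C₁) :=
      norm_integral_le_of_le_weight (hK _ _ (hC₁ n)) hM fun z => by
        rw [norm_fourier_compSubConst]
        exact schwartz_norm_le_weight hM hφ z
    have h3 : ∫ z, (SchwartzMap.compSubConstCLM ℂ ξ φ) z ∂(μ n) =
        ((∫ z, b (z - ξ) ∂(μ n) : ℝ) : ℂ) := integral_ofReal (𝕜 := ℂ) (f := fun z => b (z - ξ))
    rw [← h1, h3, Complex.norm_real, Real.norm_eq_abs] at h2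
    have h4 : Integrable (fun z => b (z - ξ)) (μ n) :=
      (b.continuous.comp (by fun_prop)).integrable_of_hasCompactSupport
        (b.hasCompactSupport.comp_homeomorph (Homeomorph.subRight ξ))
    calc μ n (Metric.closedBall ξ R) = ∫⁻ z, (Metric.closedBall ξ R).indicator 1 z ∂(μ n) :=
          (lintegral_indicator_one Metric.isClosed_closedBall.measurableSet).symm
      _ ≤ ∫⁻ z, ENNReal.ofReal (b (z - ξ)) ∂(μ n) := lintegral_mono fun z => by
          by_cases hz : z ∈ Metric.closedBall ξ R
          · have : b (z - ξ) = 1 := b.one_of_mem_closedBall (by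
              rw [Metric.mem_closedBall, dist_eq_norm] at hz
              rw [mem_closedBall_zero_iff]
              exact hz.trans (le_max_left _ _))
            simp [indicator_of_mem hz, this]
          · simp [indicator_of_notMem hz]
      _ = ENNReal.ofReal (∫ z, b (z - ξ) ∂(μ n)) :=
          (ofReal_integral_eq_lintegral_ofReal h4 (ae_of_all _ fun z => b.nonneg)).symm
      _ ≤ _ := ENNReal.ofReal_le_ofReal ((le_abs_self _).trans h2)
  obtain ⟨D, hD⟩ := hμb 2
  -- Only a subsequence of the dual measures is known to converge, which suffices: along it, both
  -- sides of `hdual` converge on Schwartz functions.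
  obtain ⟨θ, ν, hθ, hν, hνv⟩ := hμb.uniformlyLocallyFinite.exists_vagueLimit
  have hμθ : UniformlyTranslationBounded fun n => μ (θ n) := fun R => by
    obtain ⟨C, hC⟩ := hμb R
    exact ⟨C, fun n => hC (θ n)⟩
  refine ⟨ν, (hv.translationBounded hC₂).hasTemperateGrowth,
    (hνv.translationBounded fun n => hD (θ n)).hasTemperateGrowth, ?_⟩
  ext φ
  simp only [TemperedDistribution.fourier_apply, Measure.toTemperedDistribution_apply]
  have h1 := (hv.tendsto_integral_schwartz hκ (𝓕 φ)).comp hθ.tendsto_atTop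
  have h2 := hνv.tendsto_integral_schwartz hμθ φ
  refine tendsto_nhds_unique h1 (h2.congr fun n => hdual (θ n) φ)

theorem IsAutocorrelation.exists_isFourierTransform {Λ : Set ℂ} {N : ℝ → ℕ} (h : LocallySparse Λ N)
    {r₀ : ℝ} {c : ℝ≥0} (hc : QuadraticGrowth Λ r₀ c) {γ : Measure ℂ} (hγ : IsAutocorrelation Λ γ) :
    ∃ γhat, IsFourierTransform γ γhat := by
  have := hγ.1
  obtain ⟨r, hr, hr0, -, hv⟩ := hγ.exists_vagueLimit r₀
  have hdual := fun n => exists_dual_measure (h.finite (r n)).toFinset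
    (c := (volume.real (Metric.closedBall (0 : ℂ) (r n)))⁻¹) (by positivity)
  choose μ hμ hφ using hdual
  refine exists_isFourierTransform_of_vagueLimit
    (uniformlyTranslationBounded_finiteAutocorrelation h hc hr hr0) hv hμ fun n φ => ?_
  rw [hφ, integral_finiteAutocorrelation (h.finite (r n))]

/-- If rotating the test function does not matter asymptotically, every autocorrelation is circular
symmetric. -/
theorem IsAutocorrelation.isCircularSymmetric {Λ : Set ℂ} {γ : Measure ℂ}
    (hγ : IsAutocorrelation Λ γ)
    (h : ∀ (f : C_c(ℂ, ℝ)) (ρ : Circle), Tendsto (fun r : ℝ =>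
      ∫ z, f (ρ * z) ∂(finiteAutocorrelation Λ r) - ∫ z, f z ∂(finiteAutocorrelation Λ r))
      atTop (𝓝 0)) : IsCircularSymmetric γ := by
  have := hγ.1
  obtain ⟨r, -, -, hr, hv⟩ := hγ.exists_vagueLimit 0
  intro ρ
  have hlf : IsLocallyFiniteMeasure (γ.map fun z : ℂ => (ρ : ℂ) * z) := by
    refine isLocallyFinite_of_closedBall_lt_top fun R => ?_
    rw [(measurableEmbedding_mul_circle ρ).map_apply]
    have : (fun z : ℂ => (ρ : ℂ) * z) ⁻¹' Metric.closedBall 0 R = Metric.closedBall 0 R := by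
      ext z
      simp [Circle.norm_coe ρ]
    rw [this]
    exact (isCompact_closedBall (0 : ℂ) R).measure_lt_top
  refine Measure.ext_of_integral_eq_on_compactlySupported fun f => ?_
  rw [(measurableEmbedding_mul_circle ρ).integral_map]
  let g : C_c(ℂ, ℝ) := ⟨⟨fun z => f (ρ * z), f.continuous.comp (by fun_prop)⟩,
    f.hasCompactSupport.comp_homeomorph (rotation ρ).toHomeomorph⟩
  have h1 := (hv g).sub (hv f)
  have h2 := tendsto_nhds_unique h1 ((h f ρ).comp hr)
  exact sub_eq_zero.1 h2

/-! ### Direct motions of tiles -/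

/-- The direct motion `z ↦ ρ z + s`. -/
def motion (ρ : Circle) (s : ℂ) : ℂ ≃ᵢ ℂ :=
  (rotation ρ).toIsometryEquiv.trans (IsometryEquiv.addRight s)

@[simp]
lemma motion_apply (ρ : Circle) (s z : ℂ) : motion ρ s z = (ρ : ℂ) * z + s := rfl

lemma measurePreserving_motion (ρ : Circle) (s : ℂ) :
    MeasurePreserving (motion ρ s) volume volume :=
  (measurePreserving_add_right volume s).comp (rotation ρ).measurePreserving

lemma volume_motion_image (ρ : Circle) (s : ℂ) (A : Set ℂ) :
    volume (motion ρ s '' A) = volume A := by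
  have h := (measurePreserving_motion ρ s).measure_preimage_equiv
    (f := (motion ρ s).toHomeomorph.toMeasurableEquiv) (motion ρ s '' A)
  rw [← h]
  congr 1
  exact preimage_image_eq A (motion ρ s).injective

lemma interior_motion_image (ρ : Circle) (s : ℂ) (A : Set ℂ) :
    interior (motion ρ s '' A) = motion ρ s '' interior A :=
  ((motion ρ s).toHomeomorph.image_interior A).symm

namespace Tile

variable {m : ℕ}

lemma place_move (ρ : Circle) (s : ℂ) (T : Tile m) (x : ℂ) :
    (T.move ρ s).place x = motion ρ s (T.place x) := by
  simp only [place, move, motion_apply, Circle.coe_mul]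
  ring

lemma carrier_eq (P : Fin m → Set ℂ) (T : Tile m) :
    T.carrier P = motion T.rot T.trans '' P T.type := rfl

lemma carrier_move (P : Fin m → Set ℂ) (ρ : Circle) (s : ℂ) (T : Tile m) :
    (T.move ρ s).carrier P = motion ρ s '' T.carrier P := by
  unfold carrier
  rw [image_image]
  exact image_congr fun x _ => place_move ρ s T x

lemma move_injective (ρ : Circle) (s : ℂ) : Function.Injective (move (m := m) ρ s) := by
  intro S T h
  rw [Tile.ext_iff] at h
  obtain ⟨h1, h2, h3⟩ := h
  refine Tile.ext h1 (mul_left_cancel h2) ?_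
  exact mul_left_cancel₀ (Circle.coe_ne_zero ρ) (add_right_cancel h3)

lemma move_move (ρ ρ' : Circle) (s s' : ℂ) (T : Tile m) :
    (T.move ρ s).move ρ' s' = T.move (ρ' * ρ) ((ρ' : ℂ) * s + s') := by
  refine Tile.ext rfl (mul_assoc _ _ _).symm ?_
  simp only [move, Circle.coe_mul]
  ring

lemma eq_move (T : Tile m) : T = move T.rot T.trans ⟨T.type, 1, 0⟩ := by
  refine Tile.ext rfl (mul_one _).symm ?_
  simp [move]

end Tile

section

variable {m : ℕ} {P : Fin m → Set ℂ}

lemma NonOverlapping.move {A : Set (Tile m)} (h : NonOverlapping P A) (ρ : Circle) (s : ℂ) :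
    NonOverlapping P (Tile.move ρ s '' A) := by
  rintro _ ⟨S, hS, rfl⟩ _ ⟨T, hT, rfl⟩ hne
  rw [Tile.carrier_move, Tile.carrier_move, interior_motion_image, interior_motion_image]
  exact (disjoint_image_iff (motion ρ s).injective).2 (h hS hT fun h' => hne (by rw [h']))

lemma NonOverlapping.mono {A B : Set (Tile m)} (h : NonOverlapping P B) (hAB : A ⊆ B) :
    NonOverlapping P A := Set.Pairwise.mono hAB h

end

/-! ### Supertiles -/

namespace Substitution

variable {m : ℕ} (σ : Substitution m)

lemma scale_pos : 0 < σ.scale := zero_lt_one.trans σ.one_lt_scale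

/-- The `k`-th order supertile of the tile `T`. -/
def inflate (k : ℕ) (T : Tile m) : Set (Tile m) := σ.subst^[k] {T}

/-- The homothety with ratio `λ ^ k`. -/
def homothety (k : ℕ) : ℂ ≃ₜ ℂ :=
  Homeomorph.mulLeft₀ ((σ.scale : ℂ) ^ k)
    (pow_ne_zero _ (Complex.ofReal_ne_zero.2 σ.scale_pos.ne'))

@[simp]
lemma homothety_apply (k : ℕ) (z : ℂ) : σ.homothety k z = (σ.scale : ℂ) ^ k * z := rfl

lemma homothety_motion (k : ℕ) (ρ : Circle) (s z : ℂ) :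
    σ.homothety k (motion ρ s z) = motion ρ ((σ.scale : ℂ) ^ k * s) (σ.homothety k z) := by
  simp only [homothety_apply, motion_apply]
  ring

lemma substTile_move (ρ : Circle) (s : ℂ) (T : Tile m) :
    σ.substTile (T.move ρ s) = Tile.move ρ ((σ.scale : ℂ) * s) '' σ.substTile T := by
  unfold substTile
  rw [image_image]
  refine image_congr fun S _ => ?_
  rw [Tile.move_move]
  simp only [Tile.move]
  congr 1
  ring_nf

lemma subst_move (ρ : Circle) (s : ℂ) (A : Set (Tile m)) :
    σ.subst (Tile.move ρ s '' A) = Tile.move ρ ((σ.scale : ℂ) * s) '' σ.subst A := by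
  unfold subst
  rw [biUnion_image, image_iUnion₂]
  exact iUnion₂_congr fun T _ => σ.substTile_move ρ s T

lemma iterate_subst_move (k : ℕ) (ρ : Circle) (s : ℂ) (A : Set (Tile m)) :
    σ.subst^[k] (Tile.move ρ s '' A) =
      Tile.move ρ ((σ.scale : ℂ) ^ k * s) '' σ.subst^[k] A := by
  induction k with
  | zero => simp
  | succ k ih =>
    rw [Function.iterate_succ_apply', Function.iterate_succ_apply', ih, subst_move, pow_succ',
      mul_assoc]

lemma inflate_eq (k : ℕ) (T : Tile m) :
    σ.inflate k T = Tile.move T.rot ((σ.scale : ℂ) ^ k * T.trans) '' σ.supertile k T.type := by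
  unfold inflate supertile
  rw [← iterate_subst_move, image_singleton, ← T.eq_move]

lemma iterate_subst_eq (k : ℕ) (A : Set (Tile m)) :
    σ.subst^[k] A = ⋃ T ∈ A, σ.inflate k T := by
  induction k generalizing A with
  | zero => simp [inflate]
  | succ k ih =>
    have h : ∀ B, σ.subst^[k + 1] B = ⋃ S ∈ σ.subst B, σ.inflate k S := fun B => by
      rw [Function.iterate_succ_apply, ih]
    rw [h]
    simp only [inflate, h]
    simp [subst]

lemma supertile_add (k p : ℕ) (i : Fin m) :
    σ.supertile (k + p) i = ⋃ S ∈ σ.supertile p i, σ.inflate k S := by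
  unfold supertile
  rw [Function.iterate_add_apply, iterate_subst_eq]

lemma finite_substTile (T : Tile m) : (σ.substTile T).Finite :=
  (Finset.finite_toSet _).image _

lemma Finite.iterate_subst {A : Set (Tile m)} (h : A.Finite) (k : ℕ) :
    (σ.subst^[k] A).Finite := by
  induction k with
  | zero => exact h
  | succ k ih =>
    rw [Function.iterate_succ_apply']
    exact ih.biUnion fun T _ => σ.finite_substTile T

lemma finite_supertile (k : ℕ) (i : Fin m) : (σ.supertile k i).Finite :=
  Finite.iterate_subst σ (finite_singleton _) k

lemma isCompact_carrier (T : Tile m) : IsCompact (T.carrier σ.proto) := by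
  rw [Tile.carrier_eq]
  exact (σ.isCompact_proto _).image (motion _ _).continuous

lemma closure_interior_carrier (T : Tile m) :
    closure (interior (T.carrier σ.proto)) = T.carrier σ.proto := by
  rw [Tile.carrier_eq, interior_motion_image]
  conv_rhs => rw [← σ.closure_interior_proto]
  exact ((motion T.rot T.trans).toHomeomorph.image_closure _).symm

lemma interior_carrier_nonempty (hne : ∀ i, (σ.proto i).Nonempty) (T : Tile m) :
    (interior (T.carrier σ.proto)).Nonempty := by
  rw [← closure_nonempty_iff, closure_interior_carrier]
  exact (hne _).image _

lemma iUnion_carrier_substTile (S : Tile m) :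
    ⋃ T ∈ σ.substTile S, T.carrier σ.proto = σ.homothety 1 '' S.carrier σ.proto := by
  unfold substTile
  rw [biUnion_image]
  simp only [Tile.carrier_move]
  rw [← image_iUnion₂]
  have h : ⋃ T ∈ (σ.rule S.type : Set (Tile m)), T.carrier σ.proto = σ.homothety 1 '' σ.proto S.type := by
    rw [show (⋃ T ∈ (σ.rule S.type : Set (Tile m)), T.carrier σ.proto) =
      ⋃ T ∈ σ.rule S.type, T.carrier σ.proto from rfl, ← σ.selfsimilar]
    exact image_congr fun z _ => by simp
  rw [h, Tile.carrier_eq, image_image, image_image]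
  refine image_congr fun z _ => ?_
  rw [homothety_motion, pow_one]

lemma iUnion_carrier_subst (A : Set (Tile m)) :
    ⋃ T ∈ σ.subst A, T.carrier σ.proto = σ.homothety 1 '' ⋃ S ∈ A, S.carrier σ.proto := by
  rw [image_iUnion₂, subst, biUnion_iUnion]
  simp only [biUnion_iUnion, iUnion_carrier_substTile]

lemma iUnion_carrier_iterate (k : ℕ) (A : Set (Tile m)) :
    ⋃ T ∈ σ.subst^[k] A, T.carrier σ.proto = σ.homothety k '' ⋃ S ∈ A, S.carrier σ.proto := by
  induction k with
  | zero =>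
    have : ⇑(σ.homothety 0) = id := by ext z; simp
    rw [this, image_id, Function.iterate_zero, id]
  | succ k ih =>
    rw [Function.iterate_succ_apply', iUnion_carrier_subst, ih, image_image]
    refine image_congr fun z _ => ?_
    simp only [homothety_apply]
    ring

/-- The subset of the plane that the `k`-th order supertile of `T` occupies. -/
def support (k : ℕ) (T : Tile m) : Set ℂ := σ.homothety k '' T.carrier σ.proto

lemma iUnion_carrier_inflate (k : ℕ) (S : Tile m) :
    ⋃ T ∈ σ.inflate k S, T.carrier σ.proto = σ.support k S := by
  rw [inflate, iUnion_carrier_iterate, biUnion_singleton, support]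

lemma carrier_subset_support {k : ℕ} {S T : Tile m} (h : T ∈ σ.inflate k S) :
    T.carrier σ.proto ⊆ σ.support k S := by
  rw [← iUnion_carrier_inflate]
  exact subset_biUnion_of_mem (u := fun T : Tile m => T.carrier σ.proto) h

lemma interior_support (k : ℕ) (T : Tile m) :
    interior (σ.support k T) = σ.homothety k '' interior (T.carrier σ.proto) :=
  ((σ.homothety k).image_interior _).symm

lemma disjoint_interior_support {A : Set (Tile m)} (h : NonOverlapping σ.proto A) (k : ℕ)
    {S T : Tile m} (hS : S ∈ A) (hT : T ∈ A) (hne : S ≠ T) :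
    Disjoint (interior (σ.support k S)) (interior (σ.support k T)) := by
  rw [interior_support, interior_support]
  exact (disjoint_image_iff (σ.homothety k).injective).2 (h hS hT hne)

lemma nonOverlapping_subst {A : Set (Tile m)} (h : NonOverlapping σ.proto A) :
    NonOverlapping σ.proto (σ.subst A) := by
  intro S hS T hT hne
  simp only [subst, mem_iUnion] at hS hT
  obtain ⟨S₀, hS₀, hS⟩ := hS
  obtain ⟨T₀, hT₀, hT⟩ := hT
  by_cases heq : S₀ = T₀
  · subst heq
    exact (σ.nonOverlapping_rule S₀.type).move _ _ hS hT hne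
  · have h1 : ∀ U : Tile m, σ.substTile U = σ.inflate 1 U := fun U => by simp [inflate, subst]
    rw [h1] at hS hT
    exact (σ.disjoint_interior_support h 1 hS₀ hT₀ heq).mono
      (interior_mono (σ.carrier_subset_support hS)) (interior_mono (σ.carrier_subset_support hT))

lemma nonOverlapping_iterate {A : Set (Tile m)} (h : NonOverlapping σ.proto A) (k : ℕ) :
    NonOverlapping σ.proto (σ.subst^[k] A) := by
  induction k with
  | zero => exact h
  | succ k ih =>
    rw [Function.iterate_succ_apply']
    exact σ.nonOverlapping_subst ih

lemma nonOverlapping_inflate (k : ℕ) (T : Tile m) : NonOverlapping σ.proto (σ.inflate k T) :=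
  σ.nonOverlapping_iterate (pairwise_singleton _ _) k

lemma nonOverlapping_supertile (k : ℕ) (i : Fin m) : NonOverlapping σ.proto (σ.supertile k i) :=
  σ.nonOverlapping_inflate k _

/-- A common tile would have its nonempty interior inside two disjoint open supports; an empty
prototile would give no such contradiction. -/
lemma pairwiseDisjoint_inflate (hne : ∀ i, (σ.proto i).Nonempty) {A : Set (Tile m)}
    (h : NonOverlapping σ.proto A) (k : ℕ) : A.PairwiseDisjoint (σ.inflate k) := by
  intro S hS T hT hST
  rw [Function.onFun, Set.disjoint_left]
  intro U hU hU'
  obtain ⟨z, hz⟩ := σ.interior_carrier_nonempty hne U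
  exact Set.disjoint_left.1 (σ.disjoint_interior_support h k hS hT hST)
    (interior_mono (σ.carrier_subset_support hU) hz)
    (interior_mono (σ.carrier_subset_support hU') hz)

/-- The tiles of the supertile `σ^k(P_i)` as a finite set. -/
def tiles (k : ℕ) (i : Fin m) : Finset (Tile m) := (σ.finite_supertile k i).toFinset

@[simp]
lemma coe_tiles (k : ℕ) (i : Fin m) : (σ.tiles k i : Set (Tile m)) = σ.supertile k i := by
  simp [tiles]

lemma mem_tiles {k : ℕ} {i : Fin m} {T : Tile m} : T ∈ σ.tiles k i ↔ T ∈ σ.supertile k i := by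
  simp [tiles]

lemma tiles_zero (i : Fin m) : σ.tiles 0 i = {⟨i, 1, 0⟩} := by
  ext T
  simp [mem_tiles, supertile]

lemma tiles_one (i : Fin m) : σ.tiles 1 i = σ.rule i := by
  ext T
  rw [mem_tiles, supertile, Function.iterate_one, subst, biUnion_singleton, substTile]
  have : ∀ S : Tile m, S.move 1 0 = S := fun S => by simp [Tile.move]
  simp [this]

/-- The motion that carries `σ^k(P_i)` to the `k`-th order supertile of the tile `S` of type `i`. -/
def inflateMove (k : ℕ) (S : Tile m) : Tile m → Tile m :=
  Tile.move S.rot ((σ.scale : ℂ) ^ k * S.trans)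

open Classical in
-- The renormalisation identity: a supertile of order `k + p` splits without repetition into moved
-- copies of order-`k` supertiles, indexed by the tiles of the order-`p` supertile.
lemma sum_tiles_add {E : Type*} [AddCommMonoid E] (hne : ∀ i, (σ.proto i).Nonempty)
    (k p : ℕ) (j : Fin m) (F : Tile m → E) :
    ∑ T ∈ σ.tiles (k + p) j, F T =
      ∑ S ∈ σ.tiles p j, ∑ T ∈ σ.tiles k S.type, F (σ.inflateMove k S T) := by
  have h1 : σ.tiles (k + p) j =
      (σ.tiles p j).biUnion fun S => (σ.tiles k S.type).image (σ.inflateMove k S) := by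
    ext T
    simp only [mem_tiles, supertile_add, mem_iUnion, Finset.mem_biUnion, Finset.mem_image,
      inflate_eq, mem_image, exists_prop, inflateMove]
  rw [h1, Finset.sum_biUnion]
  · refine Finset.sum_congr rfl fun S _ => ?_
    exact Finset.sum_image fun T _ T' _ h => Tile.move_injective _ _ h
  · intro S hS T hT hST
    rw [Function.onFun, ← Finset.disjoint_coe, Finset.coe_image, Finset.coe_image, coe_tiles,
      coe_tiles]
    have := σ.pairwiseDisjoint_inflate hne (σ.nonOverlapping_supertile p j) k
      (σ.mem_tiles.1 hS) (σ.mem_tiles.1 hT) hST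
    rwa [Function.onFun, inflate_eq, inflate_eq] at this

end Substitution

/-! ### Areas -/

namespace Substitution

variable {m : ℕ} (σ : Substitution m)

/-- The area of the interior of the prototile `P_i`. -/
def area (i : Fin m) : ℝ := volume.real (interior (σ.proto i))

lemma volume_interior_carrier (T : Tile m) :
    volume (interior (T.carrier σ.proto)) = volume (interior (σ.proto T.type)) := by
  rw [Tile.carrier_eq, interior_motion_image, volume_motion_image]

lemma volume_carrier (T : Tile m) : volume (T.carrier σ.proto) = volume (σ.proto T.type) := by
  rw [Tile.carrier_eq, volume_motion_image]

lemma volume_interior_proto_ne_top (i : Fin m) : volume (interior (σ.proto i)) ≠ ∞ :=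
  measure_ne_top_of_subset interior_subset (σ.isCompact_proto i).measure_lt_top.ne

lemma area_pos (hne : ∀ i, (σ.proto i).Nonempty) (i : Fin m) : 0 < σ.area i := by
  refine ENNReal.toReal_pos ?_ (σ.volume_interior_proto_ne_top i)
  refine (isOpen_interior.measure_pos volume ?_).ne'
  rw [← closure_nonempty_iff, σ.closure_interior_proto]
  exact hne i

lemma volumeReal_biUnion_interior {A : Finset (Tile m)} (hA : NonOverlapping σ.proto (A : Set (Tile m))) :
    volume.real (⋃ T ∈ A, interior (T.carrier σ.proto)) = ∑ T ∈ A, σ.area T.type := by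
  rw [measureReal_biUnion_finset hA (fun T _ => isOpen_interior.measurableSet) fun T _ => by
    rw [volume_interior_carrier]
    exact σ.volume_interior_proto_ne_top _]
  refine Finset.sum_congr rfl fun T _ => ?_
  rw [measureReal_def, volume_interior_carrier, area, measureReal_def]

/-- The total area of the tiles of a non-overlapping collection in a set is at most the area of the
set. -/
lemma sum_area_le {A : Finset (Tile m)} (hA : NonOverlapping σ.proto (A : Set (Tile m))) {U : Set ℂ}
    (hU : volume U ≠ ∞) (hAU : ∀ T ∈ A, interior (T.carrier σ.proto) ⊆ U) :
    ∑ T ∈ A, σ.area T.type ≤ volume.real U := by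
  rw [← σ.volumeReal_biUnion_interior hA]
  exact measureReal_mono (iUnion₂_subset hAU) hU

open scoped Pointwise in
lemma volume_homothety_image (k : ℕ) (A : Set ℂ) :
    volume (σ.homothety k '' A) = ENNReal.ofReal (σ.scale ^ (2 * k)) * volume A := by
  have h : σ.homothety k '' A = (σ.scale ^ k) • A := by
    ext z
    simp [mem_smul_set]
  rw [h, Measure.addHaar_smul, Complex.finrank_real_complex, ← pow_mul, mul_comm k 2,
    abs_of_pos (pow_pos σ.scale_pos _)]

lemma volumeReal_homothety_image (k : ℕ) (A : Set ℂ) :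
    volume.real (σ.homothety k '' A) = σ.scale ^ (2 * k) * volume.real A := by
  rw [measureReal_def, volume_homothety_image, ENNReal.toReal_mul,
    ENNReal.toReal_ofReal (pow_pos σ.scale_pos _).le, measureReal_def]

/-- The placement of a prototile by the identity. -/
def base (i : Fin m) : Tile m := ⟨i, 1, 0⟩

lemma carrier_base (i : Fin m) : (base i).carrier σ.proto = σ.proto i := by
  rw [Tile.carrier_eq]
  have : ⇑(motion (base i).rot (base i).trans) = id := by
    ext z
    simp [base]
  rw [this, image_id]
  rfl

lemma supertile_eq_inflate (k : ℕ) (i : Fin m) : σ.supertile k i = σ.inflate k (base i) := rfl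

lemma support_base (k : ℕ) (i : Fin m) : σ.support k (base i) = σ.homothety k '' σ.proto i := by
  rw [support, carrier_base]

lemma nonOverlapping_tiles (k : ℕ) (i : Fin m) :
    NonOverlapping σ.proto (σ.tiles k i : Set (Tile m)) := by
  rw [coe_tiles]
  exact σ.nonOverlapping_supertile k i

lemma carrier_subset_of_mem_tiles {k : ℕ} {i : Fin m} {T : Tile m} (h : T ∈ σ.tiles k i) :
    T.carrier σ.proto ⊆ σ.support k (base i) :=
  σ.carrier_subset_support (σ.mem_tiles.1 h)

lemma volumeReal_interior_support (k : ℕ) (i : Fin m) :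
    volume.real (interior (σ.support k (base i))) = σ.scale ^ (2 * k) * σ.area i := by
  rw [interior_support, volumeReal_homothety_image, carrier_base, area]

lemma volume_interior_support_ne_top (k : ℕ) (i : Fin m) :
    volume (interior (σ.support k (base i))) ≠ ∞ := by
  rw [interior_support, volume_homothety_image, carrier_base]
  exact ENNReal.mul_ne_top ENNReal.ofReal_ne_top (σ.volume_interior_proto_ne_top i)

/-- Disjoint interiors give this bound for open tiles, while covering gives the opposite bound for
closed tiles in `le_sum_volume_tiles`. The two match only once open and closed areas are known to be
proportional. -/
lemma sum_area_tiles_le (k : ℕ) (i : Fin m) :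
    ∑ T ∈ σ.tiles k i, σ.area T.type ≤ σ.scale ^ (2 * k) * σ.area i := by
  rw [← volumeReal_interior_support]
  exact σ.sum_area_le (σ.nonOverlapping_tiles k i) (σ.volume_interior_support_ne_top k i)
    fun T hT => interior_mono (σ.carrier_subset_of_mem_tiles hT)

lemma le_sum_volume_tiles (k : ℕ) (i : Fin m) :
    σ.scale ^ (2 * k) * volume.real (σ.proto i) ≤
      ∑ T ∈ σ.tiles k i, volume.real (σ.proto T.type) := by
  rw [← volumeReal_homothety_image, ← support_base, ← iUnion_carrier_inflate, ← supertile_eq_inflate,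
    ← coe_tiles]
  refine (measureReal_biUnion_finset_le _ _).trans_eq (Finset.sum_congr rfl fun T _ => ?_)
  rw [measureReal_def, volume_carrier, measureReal_def]

/-- Of the matrix power only positivity is needed: a nonzero term of `M ^ k * M` gives a tile of
type `l` in `σ(P_j)` and a tile of type `i` in `σ^k(P_l)`. -/
lemma exists_mem_tiles_of_matrix_pow_pos (k : ℕ) (i j : Fin m)
    (h : 0 < (σ.matrix ^ k) i j) : ∃ T ∈ σ.tiles k j, T.type = i := by
  induction k generalizing j with
  | zero =>
    rw [pow_zero] at h
    have hij : i = j := by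
      by_contra hij
      rw [Matrix.one_apply_ne hij] at h
      exact absurd h (lt_irrefl 0)
    exact ⟨⟨j, 1, 0⟩, by simp [tiles_zero], hij.symm⟩
  | succ k ih =>
    rw [pow_succ, Matrix.mul_apply] at h
    obtain ⟨l, -, hl⟩ := Finset.exists_ne_zero_of_sum_ne_zero h.ne'
    obtain ⟨T, hT, hTi⟩ := ih l (Nat.pos_of_ne_zero (left_ne_zero_of_mul hl))
    have h2 : 0 < σ.matrix l j := Nat.pos_of_ne_zero (right_ne_zero_of_mul hl)
    rw [matrix, Matrix.of_apply, Finset.card_pos] at h2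
    obtain ⟨S, hS⟩ := h2
    rw [Finset.mem_filter] at hS
    refine ⟨σ.inflateMove k S T, ?_, hTi⟩
    rw [mem_tiles, supertile_add, mem_iUnion₂]
    refine ⟨S, ?_, ?_⟩
    · rw [← mem_tiles, tiles_one]
      exact hS.1
    · rw [inflate_eq, hS.2]
      exact mem_image_of_mem _ (σ.mem_tiles.1 hT)

lemma IsPrimitive.exists_mem_tiles {σ : Substitution m} (hσ : σ.IsPrimitive) :
    ∃ k, 1 ≤ k ∧ ∀ i j, ∃ T ∈ σ.tiles k j, T.type = i := by
  obtain ⟨k, hk, h⟩ := hσ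
  exact ⟨k, hk, fun i j => σ.exists_mem_tiles_of_matrix_pow_pos k i j (h i j)⟩

lemma area_le_volume (i : Fin m) : σ.area i ≤ volume.real (σ.proto i) :=
  measureReal_mono interior_subset (σ.isCompact_proto i).measure_lt_top.ne

/-- A maximum principle. At a type `j` with the largest ratio of closed to open area, the two
opposite inequalities for `σ^k(P_j)` force equality in every tile, and by primitivity every type
occurs there. -/
lemma exists_volume_eq_mul_area (hσ : σ.IsPrimitive) (hne : ∀ i, (σ.proto i).Nonempty) :
    ∃ c : ℝ, 0 < c ∧ ∀ i, volume.real (σ.proto i) = c * σ.area i := by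
  rcases isEmpty_or_nonempty (Fin m) with hm | hm
  · exact ⟨1, one_pos, fun i => hm.elim i⟩
  obtain ⟨j, hj⟩ := Finite.exists_max fun i => volume.real (σ.proto i) / σ.area i
  have hpos := σ.area_pos hne
  set c := volume.real (σ.proto j) / σ.area j with hc
  have hcj : volume.real (σ.proto j) = c * σ.area j := by
    rw [hc, div_mul_cancel₀ _ (hpos j).ne']
  have hle : ∀ i, volume.real (σ.proto i) ≤ c * σ.area i := fun i =>
    (div_le_iff₀ (hpos i)).1 (hj i)
  refine ⟨c, div_pos ((hpos j).trans_le (σ.area_le_volume j)) (hpos j), fun i => ?_⟩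
  obtain ⟨k, -, hk⟩ := hσ.exists_mem_tiles
  obtain ⟨T, hT, rfl⟩ := hk i j
  have hc0 : 0 ≤ c := (div_pos ((hpos j).trans_le (σ.area_le_volume j)) (hpos j)).le
  have heq : ∑ T ∈ σ.tiles k j, volume.real (σ.proto T.type) = ∑ T ∈ σ.tiles k j, c * σ.area T.type := by
    refine le_antisymm (Finset.sum_le_sum fun T _ => hle _) ?_
    rw [← Finset.mul_sum]
    calc c * ∑ T ∈ σ.tiles k j, σ.area T.type ≤ c * (σ.scale ^ (2 * k) * σ.area j) :=
          mul_le_mul_of_nonneg_left (σ.sum_area_tiles_le k j) hc0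
      _ = σ.scale ^ (2 * k) * volume.real (σ.proto j) := by rw [hcj]; ring
      _ ≤ _ := σ.le_sum_volume_tiles k j
  exact (Finset.sum_eq_sum_iff_of_le fun T _ => hle _).1 heq T hT

/-- The interiors of the tiles of a supertile exhaust its area. -/
lemma sum_area_tiles (hσ : σ.IsPrimitive) (hne : ∀ i, (σ.proto i).Nonempty) (k : ℕ) (j : Fin m) :
    ∑ T ∈ σ.tiles k j, σ.area T.type = σ.scale ^ (2 * k) * σ.area j := by
  refine le_antisymm (σ.sum_area_tiles_le k j) ?_
  obtain ⟨c, hc, h⟩ := σ.exists_volume_eq_mul_area hσ hne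
  have h1 := σ.le_sum_volume_tiles k j
  simp only [h] at h1
  rw [← Finset.mul_sum] at h1
  refine le_of_mul_le_mul_left ?_ hc
  linarith

/-- A bound for the diameters of the tiles. -/
lemma exists_diam_bound : ∃ D : ℝ, 0 ≤ D ∧ ∀ (T : Tile m), ∀ z ∈ T.carrier σ.proto,
    ∀ w ∈ T.carrier σ.proto, dist z w ≤ D := by
  have h : ∀ i, 0 ≤ Metric.diam (σ.proto i) := fun i => Metric.diam_nonneg
  refine ⟨∑ i, Metric.diam (σ.proto i), Finset.sum_nonneg fun i _ => h i, ?_⟩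
  rintro T _ ⟨z, hz, rfl⟩ _ ⟨w, hw, rfl⟩
  change dist (motion T.rot T.trans z) (motion T.rot T.trans w) ≤ _
  rw [(motion T.rot T.trans).dist_eq]
  exact (Metric.dist_le_diam_of_mem (σ.isCompact_proto _).isBounded hz hw).trans
    (Finset.single_le_sum (f := fun i => Metric.diam (σ.proto i)) (fun i _ => h i)
      (Finset.mem_univ _))

/-- Each tile is the closure of its interior, and a closure cannot meet an open set that the
interior misses. -/
lemma disjoint_carrier_interior {A : Set (Tile m)} (h : NonOverlapping σ.proto A) {S T : Tile m}
    (hS : S ∈ A) (hT : T ∈ A) (hne : S ≠ T) :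
    Disjoint (S.carrier σ.proto) (interior (T.carrier σ.proto)) := by
  rw [← σ.closure_interior_carrier S]
  exact (h hS hT hne).closure_left isOpen_interior

/-- The boundary of a prototile is a null set. -/
lemma volume_frontier_proto (hσ : σ.IsPrimitive) (hne : ∀ i, (σ.proto i).Nonempty) (i : Fin m) :
    volume (frontier (σ.proto i)) = 0 := by
  obtain ⟨c, hc, h⟩ := σ.exists_volume_eq_mul_area hσ hne
  obtain ⟨D, hD, hdiam⟩ := σ.exists_diam_bound
  have hpos := σ.area_pos hne
  have key : ∃ T : Tile m, volume (frontier (T.carrier σ.proto)) = 0 := by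
    obtain ⟨z, hz⟩ := σ.interior_carrier_nonempty hne (base i)
    obtain ⟨ε, hε, hball⟩ := Metric.isOpen_iff.1 isOpen_interior z hz
    -- Inflated until the ball around `z` has radius greater than `D`: the tile that contains the
    -- image of `z` then lies wholly inside the supertile.
    obtain ⟨k, hk⟩ := pow_unbounded_of_one_lt (D / ε) σ.one_lt_scale
    rw [div_lt_iff₀ hε] at hk
    have hzk : σ.homothety k z ∈ ⋃ T ∈ σ.inflate k (base i), T.carrier σ.proto := by
      rw [iUnion_carrier_inflate]
      exact mem_image_of_mem _ (interior_subset hz)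
    rw [mem_iUnion₂] at hzk
    obtain ⟨T, hT, hzT⟩ := hzk
    have hsub : T.carrier σ.proto ⊆ interior (σ.support k (base i)) := by
      intro w hw
      rw [interior_support]
      obtain ⟨v, rfl⟩ := (σ.homothety k).surjective w
      refine mem_image_of_mem _ (hball ?_)
      have h1 := hdiam T _ hw _ hzT
      rw [dist_eq_norm, homothety_apply, homothety_apply, ← mul_sub, norm_mul, norm_pow,
        Complex.norm_real, Real.norm_eq_abs, abs_of_pos σ.scale_pos] at h1
      rw [Metric.mem_ball, dist_eq_norm]
      exact lt_of_mul_lt_mul_left (h1.trans_lt hk) (pow_nonneg σ.scale_pos.le k)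
    set V := ⋃ S ∈ σ.tiles k i, interior (S.carrier σ.proto) with hV
    have hVU : V ⊆ interior (σ.support k (base i)) :=
      iUnion₂_subset fun S hS => interior_mono (σ.carrier_subset_of_mem_tiles hS)
    have hVm : MeasurableSet V := (isOpen_biUnion fun S _ => isOpen_interior).measurableSet
    have hdiff : volume (interior (σ.support k (base i)) \ V) = 0 := by
      have h1 := measureReal_sdiff (μ := volume) hVU hVm
        ((σ.volume_interior_support_ne_top k i))
      rw [hV, σ.volumeReal_biUnion_interior (σ.nonOverlapping_tiles k i),
        σ.sum_area_tiles hσ hne, volumeReal_interior_support, sub_self] at h1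
      exact (measureReal_eq_zero_iff (measure_ne_top_of_subset sdiff_subset
        (σ.volume_interior_support_ne_top k i))).1 h1
    -- A boundary point of `T` is interior neither to `T` nor to any other tile, so it lies in the
    -- null set that the open tiles leave uncovered.
    refine ⟨T, measure_mono_null (t := interior (σ.support k (base i)) \ V) (fun w hw => ⟨hsub ?_, fun hwV => ?_⟩) hdiff⟩
    · exact (σ.isCompact_carrier T).isClosed.frontier_subset hw
    · rw [hV, mem_iUnion₂] at hwV
      obtain ⟨S, hS, hwS⟩ := hwV
      by_cases hST : T = S
      · subst hST
        exact hw.2 hwS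
      · exact Set.disjoint_left.1 (σ.disjoint_carrier_interior (σ.nonOverlapping_supertile k i)
          hT (σ.mem_tiles.1 hS) hST) ((σ.isCompact_carrier T).isClosed.frontier_subset hw) hwS
  have hfr : ∀ j, volume (frontier (σ.proto j)) = 0 ↔ volume.real (σ.proto j) = σ.area j := by
    intro j
    have hfin := (σ.isCompact_proto j).measure_lt_top (μ := volume) |>.ne
    have h1 := measureReal_sdiff (μ := volume) (interior_subset (s := σ.proto j))
      isOpen_interior.measurableSet hfin
    rw [(σ.isCompact_proto j).isClosed.frontier_eq, ← measureReal_eq_zero_iff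
      (measure_ne_top_of_subset sdiff_subset hfin), h1, sub_eq_zero]
    rfl
  obtain ⟨T, hT⟩ := key
  have h2 : volume (frontier (σ.proto T.type)) = 0 := by
    rw [← hT, Tile.carrier_eq, ← volume_motion_image T.rot T.trans (frontier _)]
    congr 1
    exact (motion T.rot T.trans).toHomeomorph.image_frontier _
  rw [hfr, h] at h2
  -- One null boundary fixes the common ratio at `1`, which makes every prototile boundary null.
  have hc1 : c = 1 := mul_right_cancel₀ (hpos T.type).ne' (h2.trans (one_mul _).symm)
  rw [hfr, h, hc1, one_mul]

end Substitution

/-! ### Sums over pairs of points -/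

open Classical in
lemma abs_sum_le_of_locallySparse {L : Finset ℂ} {N : ℝ → ℕ} (hL : LocallySparse (L : Set ℂ) N)
    {f : ℂ → ℝ} {R C : ℝ} (hC : ∀ z, |f z| ≤ C) (z : ℂ) {g : ℂ → ℂ}
    (hg : ∀ y, f (g y) ≠ 0 → y ∈ Metric.closedBall z R) :
    |∑ y ∈ L, f (g y)| ≤ C * N R := by
  have hC0 : 0 ≤ C := (abs_nonneg _).trans (hC 0)
  calc |∑ y ∈ L, f (g y)| ≤ ∑ y ∈ L, |f (g y)| := Finset.abs_sum_le_sum_abs _ _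
    _ = ∑ y ∈ L.filter fun y => y ∈ Metric.closedBall z R, |f (g y)| := by
        rw [Finset.sum_filter_of_ne]
        exact fun y _ hy => hg y fun h => hy (by rw [h, abs_zero])
    _ ≤ ∑ y ∈ L.filter fun y => y ∈ Metric.closedBall z R, C := Finset.sum_le_sum fun y _ => hC _
    _ = (L.filter fun y => y ∈ Metric.closedBall z R).card * C := by
        rw [Finset.sum_const, nsmul_eq_mul]
    _ ≤ N R * C := by
        gcongr
        exact hL.card_filter_le R z
    _ = C * N R := mul_comm _ _

section PairSums

variable {N : ℝ → ℕ} {f : ℂ → ℝ} {R C : ℝ}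

lemma abs_sum_right_le {L : Finset ℂ} (hL : LocallySparse (L : Set ℂ) N) (hC : ∀ z, |f z| ≤ C)
    (hf : ∀ z, f z ≠ 0 → ‖z‖ ≤ R) (x : ℂ) : |∑ y ∈ L, f (x - y)| ≤ C * N R :=
  abs_sum_le_of_locallySparse hL hC x fun y hy => by
    rw [Metric.mem_closedBall, dist_comm, dist_eq_norm]
    exact hf _ hy

lemma abs_sum_left_le {L : Finset ℂ} (hL : LocallySparse (L : Set ℂ) N) (hC : ∀ z, |f z| ≤ C)
    (hf : ∀ z, f z ≠ 0 → ‖z‖ ≤ R) (y : ℂ) : |∑ x ∈ L, f (x - y)| ≤ C * N R :=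
  abs_sum_le_of_locallySparse hL hC y fun x hx => by
    rw [Metric.mem_closedBall, dist_eq_norm]
    exact hf _ hx

lemma abs_sum_le_card_mul {s : Finset ℂ} {h : ℂ → ℝ} {B : ℝ} (hh : ∀ x, |h x| ≤ B) :
    |∑ x ∈ s, h x| ≤ s.card * B := by
  refine (Finset.abs_sum_le_sum_abs _ _).trans ?_
  rw [← nsmul_eq_mul]
  exact Finset.sum_le_card_nsmul _ _ _ fun x _ => hh x

open Classical in
-- Every additional pair has its first or its second point in `L' \ L`, and a point has at most `N
-- R` partners within the range of `f`; hence the factor `2`.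
lemma abs_pairSum_sub_le {L L' : Finset ℂ} (hLL : L ⊆ L') (hL : LocallySparse (L' : Set ℂ) N)
    (hC : ∀ z, |f z| ≤ C) (hf : ∀ z, f z ≠ 0 → ‖z‖ ≤ R) :
    |pairSum L' f - pairSum L f| ≤ 2 * (C * N R) * (L' \ L).card := by
  have h1 : pairSum L' f - pairSum L f =
      ∑ x ∈ L' \ L, ∑ y ∈ L', f (x - y) + ∑ y ∈ L' \ L, ∑ x ∈ L, f (x - y) := by
    rw [Finset.sum_comm (s := L' \ L) (t := L)]
    unfold pairSum
    rw [← Finset.sum_sdiff hLL (f := fun x => ∑ y ∈ L', f (x - y))]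
    have : ∀ x, ∑ y ∈ L', f (x - y) = ∑ y ∈ L' \ L, f (x - y) + ∑ y ∈ L, f (x - y) := fun x =>
      (Finset.sum_sdiff hLL).symm
    rw [Finset.sum_congr rfl (s₁ := L) fun x _ => this x, Finset.sum_add_distrib]
    ring
  have h2 := abs_sum_le_card_mul (s := L' \ L) fun x => abs_sum_right_le hL hC hf x
  have h3 := abs_sum_le_card_mul (s := L' \ L)
    fun y => abs_sum_left_le (hL.mono (Finset.coe_subset.2 hLL)) hC hf y
  rw [h1]
  refine (abs_add_le _ _).trans ?_
  linarith

open Classical in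
/-- If the points of `La a` outside a small set `bad a` are at distance more than `R` from all
points of the other `La b`, then the pair sum over the union is almost the sum of the pair sums. -/
lemma abs_pairSum_biUnion_sub_le {ι : Type*} {I : Finset ι} {La bad : ι → Finset ℂ}
    (hL : LocallySparse ((I.biUnion La : Finset ℂ) : Set ℂ) N) (hR : 0 ≤ R)
    (hC : ∀ z, |f z| ≤ C) (hf : ∀ z, f z ≠ 0 → ‖z‖ ≤ R) (hbad : ∀ a ∈ I, bad a ⊆ La a)
    (hgood : ∀ a ∈ I, ∀ x ∈ La a \ bad a, ∀ b ∈ I, b ≠ a → ∀ y ∈ La b, R < dist x y) :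
    |pairSum (I.biUnion La) f - ∑ a ∈ I, pairSum (La a) f| ≤
      2 * (C * N R) * ∑ a ∈ I, ((bad a).card : ℝ) := by
  have hsub : ∀ a ∈ I, La a ⊆ I.biUnion La := fun a ha => Finset.subset_biUnion_of_mem La ha
  set good := I.biUnion fun a => La a \ bad a with hgd
  -- The sets `La a` may overlap, since control points of different tiles can coincide; a shared
  -- point is at distance zero from another block, hence bad.
  have hdisj : (I : Set ι).PairwiseDisjoint fun a => La a \ bad a := by
    intro a ha b hb hab
    rw [Function.onFun, Finset.disjoint_left]
    intro x hx hx'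
    have := hgood a ha x hx b hb hab.symm x (Finset.sdiff_subset hx')
    rw [dist_self] at this
    exact absurd this (not_lt.2 hR)
  have hgL : good ⊆ I.biUnion La := Finset.biUnion_subset.2 fun a ha =>
    Finset.sdiff_subset.trans (hsub a ha)
  have h1 : ∀ a ∈ I, ∀ x ∈ La a \ bad a, ∑ y ∈ I.biUnion La, f (x - y) = ∑ y ∈ La a, f (x - y) := by
    intro a ha x hx
    refine (Finset.sum_subset (hsub a ha) fun y hy hya => ?_).symm
    obtain ⟨b, hb, hyb⟩ := Finset.mem_biUnion.1 hy
    by_contra h0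
    have hba : b ≠ a := fun h => hya (h ▸ hyb)
    have h2 := hgood a ha x hx b hb hba y hyb
    rw [dist_eq_norm] at h2
    exact absurd (hf _ h0) (not_le.2 h2)
  -- A good first point sees only its own block, so both sides share the good part; each leaves a
  -- remainder indexed by bad first points.
  have h2 : pairSum (I.biUnion La) f = ∑ x ∈ I.biUnion La \ good, ∑ y ∈ I.biUnion La, f (x - y) +
      ∑ a ∈ I, ∑ x ∈ La a \ bad a, ∑ y ∈ La a, f (x - y) := by
    unfold pairSum
    rw [← Finset.sum_sdiff hgL]
    congr 1
    rw [hgd, Finset.sum_biUnion hdisj]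
    exact Finset.sum_congr rfl fun a ha => Finset.sum_congr rfl fun x hx => h1 a ha x hx
  have h3 : ∑ a ∈ I, pairSum (La a) f = ∑ a ∈ I, ∑ x ∈ bad a, ∑ y ∈ La a, f (x - y) +
      ∑ a ∈ I, ∑ x ∈ La a \ bad a, ∑ y ∈ La a, f (x - y) := by
    rw [← Finset.sum_add_distrib]
    refine Finset.sum_congr rfl fun a ha => ?_
    rw [pairSum, add_comm, Finset.sum_sdiff (hbad a ha)]
  have hcard : ((I.biUnion La \ good).card : ℝ) ≤ ∑ a ∈ I, ((bad a).card : ℝ) := by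
    have h4 : I.biUnion La \ good ⊆ I.biUnion bad := by
      intro x hx
      rw [Finset.mem_sdiff, Finset.mem_biUnion] at hx
      obtain ⟨⟨a, ha, hxa⟩, hxg⟩ := hx
      refine Finset.mem_biUnion.2 ⟨a, ha, ?_⟩
      by_contra hb
      exact hxg (Finset.mem_biUnion.2 ⟨a, ha, Finset.mem_sdiff.2 ⟨hxa, hb⟩⟩)
    exact_mod_cast (Finset.card_le_card h4).trans Finset.card_biUnion_le
  have hCN : 0 ≤ C * N R := mul_nonneg ((abs_nonneg _).trans (hC 0)) (Nat.cast_nonneg _)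
  have h5 := abs_sum_le_card_mul (s := I.biUnion La \ good) fun x => abs_sum_right_le hL hC hf x
  have h6 : |∑ a ∈ I, ∑ x ∈ bad a, ∑ y ∈ La a, f (x - y)| ≤
      (∑ a ∈ I, ((bad a).card : ℝ)) * (C * N R) := by
    rw [Finset.sum_mul]
    refine (Finset.abs_sum_le_sum_abs _ _).trans (Finset.sum_le_sum fun a ha => ?_)
    exact abs_sum_le_card_mul fun x =>
      abs_sum_right_le (hL.mono (Finset.coe_subset.2 (hsub a ha))) hC hf x
  rw [h2, h3, add_sub_add_right_eq_sub]
  refine (abs_sub _ _).trans ?_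
  have h7 := mul_le_mul_of_nonneg_right hcard hCN
  linarith

end PairSums

open Classical in
-- Differences cancel the translation, and the rotation passes to the test function.
lemma pairSum_motion_image {E : Type*} [AddCommMonoid E] (L : Finset ℂ) (ρ : Circle) (s : ℂ)
    (f : ℂ → E) : pairSum (L.image (motion ρ s)) f = pairSum L fun z => f (ρ * z) := by
  unfold pairSum
  have hinj := (motion ρ s).injective
  rw [Finset.sum_image fun x _ y _ h => hinj h]
  refine Finset.sum_congr rfl fun x _ => ?_
  rw [Finset.sum_image fun x _ y _ h => hinj h]
  refine Finset.sum_congr rfl fun y _ => ?_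
  congr 1
  simp only [motion_apply]
  ring

/-! ### Control points -/

section ControlPoints

variable {m : ℕ}

/-- The control point of a tile. -/
def controlPoint (x : Fin m → ℂ) (T : Tile m) : ℂ := T.place (x T.type)

lemma controlPoints_eq (x : Fin m → ℂ) (A : Set (Tile m)) :
    controlPoints x A = controlPoint x '' A := rfl

lemma controlPoint_move (x : Fin m → ℂ) (ρ : Circle) (s : ℂ) (T : Tile m) :
    controlPoint x (T.move ρ s) = motion ρ s (controlPoint x T) := T.place_move ρ s _

end ControlPoints

namespace Substitution

variable {m : ℕ} (σ : Substitution m)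

lemma exists_area_lower_bound (hne : ∀ i, (σ.proto i).Nonempty) : ∃ g, 0 < g ∧ ∀ i, g ≤ σ.area i := by
  rcases isEmpty_or_nonempty (Fin m) with hm | hm
  · exact ⟨1, one_pos, fun i => hm.elim i⟩
  obtain ⟨j, hj⟩ := Finite.exists_min σ.area
  exact ⟨σ.area j, σ.area_pos hne j, hj⟩

lemma card_mul_le {g : ℝ} (hg : ∀ i, g ≤ σ.area i) {A : Finset (Tile m)}
    (hA : NonOverlapping σ.proto (A : Set (Tile m))) {U : Set ℂ}
    (hU : volume U ≠ ∞) (hAU : ∀ T ∈ A, interior (T.carrier σ.proto) ⊆ U) :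
    A.card * g ≤ volume.real U := by
  refine le_trans ?_ (σ.sum_area_le hA hU hAU)
  rw [← nsmul_eq_mul]
  exact Finset.card_nsmul_le_sum _ _ _ fun T _ => hg T.type

variable {σ} {x : Fin m → ℂ}

lemma controlPoint_mem (hx : ∀ i, x i ∈ σ.proto i) (T : Tile m) :
    controlPoint x T ∈ T.carrier σ.proto := mem_image_of_mem _ (hx _)

lemma carrier_subset_closedBall (hx : ∀ i, x i ∈ σ.proto i) {D : ℝ}
    (hD : ∀ (T : Tile m), ∀ z ∈ T.carrier σ.proto, ∀ w ∈ T.carrier σ.proto, dist z w ≤ D)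
    {T : Tile m} {z : ℂ} {R : ℝ} (hT : controlPoint x T ∈ Metric.closedBall z R) :
    T.carrier σ.proto ⊆ Metric.closedBall z (R + D) := by
  intro w hw
  rw [Metric.mem_closedBall] at hT ⊢
  have := hD T w hw _ (controlPoint_mem hx T)
  have := dist_triangle w (controlPoint x T) z
  linarith

/-- Such tiles lie in the ball of radius `R + D` and have disjoint interiors of area at least `g`.
Tiles are counted rather than points, so coinciding control points do no harm. -/
lemma tiles_card_bound (hx : ∀ i, x i ∈ σ.proto i) {D g : ℝ}
    (hD : ∀ (T : Tile m), ∀ z ∈ T.carrier σ.proto, ∀ w ∈ T.carrier σ.proto, dist z w ≤ D)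
    (hg0 : 0 < g) (hg : ∀ i, g ≤ σ.area i) {A : Set (Tile m)} (hA : NonOverlapping σ.proto A)
    (R : ℝ) (z : ℂ) :
    {T ∈ A | controlPoint x T ∈ Metric.closedBall z R}.Finite ∧
      ({T ∈ A | controlPoint x T ∈ Metric.closedBall z R}.ncard : ℝ) * g ≤
        volume.real (Metric.closedBall (0 : ℂ) (R + D)) := by
  have hvol : volume.real (Metric.closedBall z (R + D)) =
      volume.real (Metric.closedBall (0 : ℂ) (R + D)) := by
    simp only [measureReal_def, Complex.volume_closedBall]
  have key : ∀ B : Finset (Tile m), (B : Set (Tile m)) ⊆ {T ∈ A | controlPoint x T ∈ Metric.closedBall z R} →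
      B.card * g ≤ volume.real (Metric.closedBall (0 : ℂ) (R + D)) := by
    intro B hB
    rw [← hvol]
    refine σ.card_mul_le hg (hA.mono fun T hT => (hB hT).1) measure_closedBall_lt_top.ne
      fun T hT => interior_subset.trans (carrier_subset_closedBall hx hD (hB hT).2)
  have hfin : {T ∈ A | controlPoint x T ∈ Metric.closedBall z R}.Finite := by
    by_contra hinf
    obtain ⟨B, hB, hcard⟩ := Set.Infinite.exists_subset_card_eq hinf
      (⌈volume.real (Metric.closedBall (0 : ℂ) (R + D)) / g⌉₊ + 1)
    have h1 := key B hB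
    rw [hcard, ← le_div_iff₀ hg0] at h1
    have h2 := Nat.le_ceil (volume.real (Metric.closedBall (0 : ℂ) (R + D)) / g)
    push_cast at h1
    linarith
  refine ⟨hfin, ?_⟩
  rw [ncard_eq_toFinset_card _ hfin]
  exact key _ (by simp)

lemma controlPoints_inter (A : Set (Tile m)) (B : Set ℂ) :
    controlPoints x A ∩ B = controlPoint x '' {T ∈ A | controlPoint x T ∈ B} := by
  rw [controlPoints_eq]
  ext z
  constructor
  · rintro ⟨⟨T, hT, rfl⟩, hz⟩
    exact ⟨T, ⟨hT, hz⟩, rfl⟩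
  · rintro ⟨T, ⟨hT, hz⟩, rfl⟩
    exact ⟨⟨T, hT, rfl⟩, hz⟩

/-- Control points of non-overlapping collections are locally sparse, uniformly in the
collection. -/
lemma exists_locallySparse (hx : ∀ i, x i ∈ σ.proto i) :
    ∃ N : ℝ → ℕ, ∀ A, NonOverlapping σ.proto A → LocallySparse (controlPoints x A) N := by
  obtain ⟨D, -, hD⟩ := σ.exists_diam_bound
  obtain ⟨g, hg0, hg⟩ := σ.exists_area_lower_bound fun i => ⟨x i, hx i⟩
  refine ⟨fun R => ⌊volume.real (Metric.closedBall (0 : ℂ) (R + D)) / g⌋₊, fun A hA R z => ?_⟩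
  obtain ⟨h1, h2⟩ := tiles_card_bound hx hD hg0 hg hA R z
  rw [controlPoints_inter]
  refine ⟨h1.image _, (ncard_image_le h1).trans ?_⟩
  exact Nat.le_floor ((le_div_iff₀ hg0).2 h2)

lemma volume_closedBall_mul (r : ℝ) (c : ℝ≥0) :
    volume (Metric.closedBall (0 : ℂ) (c * r)) = c ^ 2 * volume (Metric.closedBall (0 : ℂ) r) := by
  rw [Complex.volume_closedBall, Complex.volume_closedBall, ENNReal.ofReal_mul c.coe_nonneg, mul_pow]
  simp [mul_assoc]

lemma exists_quadraticGrowth (hx : ∀ i, x i ∈ σ.proto i) {A : Set (Tile m)}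
    (hA : NonOverlapping σ.proto A) :
    ∃ (r₀ : ℝ) (c : ℝ≥0), QuadraticGrowth (controlPoints x A) r₀ c := by
  obtain ⟨D, -, hD⟩ := σ.exists_diam_bound
  obtain ⟨g, hg0, hg⟩ := σ.exists_area_lower_bound fun i => ⟨x i, hx i⟩
  -- For `r ≥ D` the enlarged ball has radius `r + D ≤ 2 * r`, whence the factor `4` in area.
  refine ⟨D, (g⁻¹).toNNReal * 4, fun r hr => ?_⟩
  obtain ⟨h1, h2⟩ := tiles_card_bound hx hD hg0 hg hA r 0
  rw [controlPoints_inter]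
  have h3 : ((controlPoint x '' {T ∈ A | controlPoint x T ∈ Metric.closedBall 0 r}).ncard : ℝ) ≤
      g⁻¹ * volume.real (Metric.closedBall (0 : ℂ) (r + D)) := by
    rw [← div_eq_inv_mul, le_div_iff₀ hg0]
    refine le_trans ?_ h2
    gcongr
    exact ncard_image_le h1
  calc ((controlPoint x '' {T ∈ A | controlPoint x T ∈ Metric.closedBall 0 r}).ncard : ℝ≥0∞)
      = ENNReal.ofReal
        (controlPoint x '' {T ∈ A | controlPoint x T ∈ Metric.closedBall 0 r}).ncard := by simp
    _ ≤ ENNReal.ofReal (g⁻¹ * volume.real (Metric.closedBall (0 : ℂ) (r + D))) :=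
        ENNReal.ofReal_le_ofReal h3
    _ = ENNReal.ofReal g⁻¹ * volume (Metric.closedBall (0 : ℂ) (r + D)) := by
        rw [ENNReal.ofReal_mul (by positivity), measureReal_def,
          ENNReal.ofReal_toReal measure_closedBall_lt_top.ne]
    _ ≤ ENNReal.ofReal g⁻¹ * volume (Metric.closedBall (0 : ℂ) ((2 : ℝ≥0) * r)) := by
        gcongr
        push_cast
        linarith
    _ = _ := by
        rw [volume_closedBall_mul]
        norm_num [ENNReal.ofReal, mul_assoc]

end Substitution

/-! ### Pair sums over unions of supertiles -/

namespace Substitution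

variable {m : ℕ} (σ : Substitution m) (x : Fin m → ℂ)

open Classical in
/-- The control points of the supertile `σ^k(P_i)`. -/
def points (k : ℕ) (i : Fin m) : Finset ℂ := (σ.tiles k i).image (controlPoint x)

open Classical in
/-- The control points of the `k`-th order supertile of `S`. -/
def pointsOf (k : ℕ) (S : Tile m) : Finset ℂ :=
  (σ.points x k S.type).image (motion S.rot ((σ.scale : ℂ) ^ k * S.trans))

open Classical in
/-- The control points of a supertile that are within distance `R` of its boundary. -/
def boundaryPoints (R : ℝ) (k : ℕ) (i : Fin m) : Finset ℂ :=
  (σ.points x k i).filter fun z => ¬ Metric.closedBall z R ⊆ interior (σ.support k (base i))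

lemma coe_pointsOf (k : ℕ) (S : Tile m) :
    (σ.pointsOf x k S : Set ℂ) = controlPoints x (σ.inflate k S) := by
  classical
  rw [pointsOf, points, Finset.coe_image, Finset.coe_image, coe_tiles, inflate_eq,
    controlPoints_eq, image_image, image_image]
  exact image_congr fun T _ => (controlPoint_move x _ _ T).symm

open Classical in
lemma coe_biUnion_pointsOf (k : ℕ) (I : Finset (Tile m)) :
    ((I.biUnion (σ.pointsOf x k) : Finset ℂ) : Set ℂ) =
      controlPoints x (σ.subst^[k] (I : Set (Tile m))) := by
  rw [Finset.coe_biUnion, iterate_subst_eq, controlPoints_eq, image_iUnion₂]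
  exact iUnion₂_congr fun S _ => σ.coe_pointsOf x k S

open Classical in
lemma biUnion_pointsOf_tiles (k p : ℕ) (j : Fin m) :
    (σ.tiles p j).biUnion (σ.pointsOf x k) = σ.points x (k + p) j := by
  rw [← Finset.coe_inj, coe_biUnion_pointsOf, points, Finset.coe_image, coe_tiles, coe_tiles]
  rw [supertile, supertile, ← Function.iterate_add_apply]
  rfl

lemma support_eq (k : ℕ) (S : Tile m) :
    σ.support k S = motion S.rot ((σ.scale : ℂ) ^ k * S.trans) '' σ.support k (base S.type) := by
  rw [support_base, support, Tile.carrier_eq, image_image, image_image]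
  exact image_congr fun z _ => σ.homothety_motion k _ _ _

lemma closure_interior_support (k : ℕ) (S : Tile m) :
    closure (interior (σ.support k S)) = σ.support k S := by
  rw [interior_support, ← (σ.homothety k).image_closure, closure_interior_carrier, support]

variable {σ x}

open Classical in
/-- The pair sum over a union of supertiles of order `k` is the sum of the pair sums over these
supertiles, up to an error from their boundaries. -/
lemma abs_pairSum_iterate_sub_le (hx : ∀ i, x i ∈ σ.proto i) {N : ℝ → ℕ}
    (hN : ∀ A, NonOverlapping σ.proto A → LocallySparse (controlPoints x A) N)
    {f : ℂ → ℝ} {R C : ℝ} (hR : 0 ≤ R) (hC : ∀ z, |f z| ≤ C) (hf : ∀ z, f z ≠ 0 → ‖z‖ ≤ R)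
    {I : Finset (Tile m)} (hI : NonOverlapping σ.proto (I : Set (Tile m))) (k : ℕ) :
    |pairSum (I.biUnion (σ.pointsOf x k)) f -
      ∑ S ∈ I, pairSum (σ.points x k S.type) fun z => f (S.rot * z)| ≤
      2 * (C * N R) * ∑ S ∈ I, ((σ.boundaryPoints x R k S.type).card : ℝ) := by
  have hL : LocallySparse ((I.biUnion (σ.pointsOf x k) : Finset ℂ) : Set ℂ) N := by
    rw [coe_biUnion_pointsOf]
    exact hN _ (σ.nonOverlapping_iterate hI k)
  have key := abs_pairSum_biUnion_sub_le (bad := fun S : Tile m =>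
    (σ.boundaryPoints x R k S.type).image (motion S.rot ((σ.scale : ℂ) ^ k * S.trans)))
    hL hR hC hf (fun S _ => Finset.image_subset_image (Finset.filter_subset _ _)) ?_
  · have h1 : ∀ S : Tile m, pairSum (σ.pointsOf x k S) f =
        pairSum (σ.points x k S.type) fun z => f (S.rot * z) := fun S =>
      pairSum_motion_image _ _ _ _
    simp only [h1, Finset.card_image_of_injective _ (motion _ _).injective] at key
    exact key
  · intro S hS z hz S' hS' hne y hy
    rw [Finset.mem_sdiff, pointsOf, Finset.mem_image, Finset.mem_image] at hz
    obtain ⟨⟨w, hw, rfl⟩, hz⟩ := hz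
    have hw' : Metric.closedBall w R ⊆ interior (σ.support k (base S.type)) := by
      by_contra h
      exact hz ⟨w, Finset.mem_filter.2 ⟨hw, h⟩, rfl⟩
    have hy' : y ∈ σ.support k S' := by
      have : y ∈ (σ.pointsOf x k S' : Set ℂ) := hy
      rw [coe_pointsOf] at this
      obtain ⟨T, hT, rfl⟩ := this
      exact σ.carrier_subset_support hT (controlPoint_mem hx T)
    by_contra hdist
    push Not at hdist
    have h1 : y ∈ interior (σ.support k S) := by
      rw [support_eq, interior_motion_image]
      obtain ⟨v, rfl⟩ := (motion S.rot ((σ.scale : ℂ) ^ k * S.trans)).surjective y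
      rw [(motion S.rot _).dist_eq, dist_comm] at hdist
      exact mem_image_of_mem _ (hw' hdist)
    -- The point `y` may lie on the boundary of `support k S'`; closing up one side still keeps it
    -- out of the open interior of `support k S`.
    have h2 := (σ.disjoint_interior_support hI k hS' hS hne).closure_left isOpen_interior
    rw [closure_interior_support] at h2
    exact Set.disjoint_left.1 h2 hy' h1

lemma exists_mem_frontier_of_not_subset {A : Set ℂ} {z : ℂ} {R : ℝ} (hz : z ∈ A)
    (h : ¬ Metric.closedBall z R ⊆ interior A) : ∃ v ∈ frontier A, dist z v ≤ R := by
  obtain ⟨w, hw, hwA⟩ := not_subset.1 h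
  rw [Metric.mem_closedBall, dist_comm] at hw
  by_cases hwA' : w ∈ A
  · exact ⟨w, ⟨subset_closure hwA', hwA⟩, hw⟩
  · obtain ⟨v, hv, hdist⟩ := exists_mem_frontier_infDist_compl_eq_dist hz fun h' => by
      rw [h'] at hwA'
      exact hwA' (mem_univ w)
    exact ⟨v, hv, hdist ▸ (Metric.infDist_le_dist_of_mem hwA').trans hw⟩

/-- Tiles carrying boundary points stay within `R + D` of the boundary of the supertile. Scaled back
by `λ ^ k`, this is a thickening of the prototile boundary whose width tends to zero; its area tends
to that of the boundary, which is null. -/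
lemma card_boundaryPoints_mul_le (hx : ∀ i, x i ∈ σ.proto i) {D g : ℝ}
    (hD : ∀ (T : Tile m), ∀ z ∈ T.carrier σ.proto, ∀ w ∈ T.carrier σ.proto, dist z w ≤ D)
    (hg0 : 0 ≤ g) (hg : ∀ i, g ≤ σ.area i) (R : ℝ) (k : ℕ) (i : Fin m) :
    (σ.boundaryPoints x R k i).card * g ≤ σ.scale ^ (2 * k) *
      volume.real (Metric.cthickening ((R + D) / σ.scale ^ k) (frontier (σ.proto i))) := by
  classical
  let A : Finset (Tile m) := (σ.tiles k i).filter fun T =>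
    ¬ Metric.closedBall (controlPoint x T) R ⊆ interior (σ.support k (base i))
  have h1 : σ.boundaryPoints x R k i ⊆ A.image (controlPoint x) := by
    intro z hz
    rw [boundaryPoints, Finset.mem_filter, points, Finset.mem_image] at hz
    obtain ⟨⟨T, hT, rfl⟩, hz⟩ := hz
    exact Finset.mem_image_of_mem _ (Finset.mem_filter.2 ⟨hT, hz⟩)
  have h2 : ((σ.boundaryPoints x R k i).card : ℝ) ≤ A.card := by
    exact_mod_cast (Finset.card_le_card h1).trans Finset.card_image_le
  rw [← volumeReal_homothety_image]
  refine (mul_le_mul_of_nonneg_right h2 hg0).trans (σ.card_mul_le hg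
    ((σ.nonOverlapping_tiles k i).mono (Finset.coe_subset.2 (Finset.filter_subset _ _))) ?_ ?_)
  · have hc : IsCompact (frontier (σ.proto i)) :=
      (σ.isCompact_proto i).of_isClosed_subset isClosed_frontier
        (σ.isCompact_proto i).isClosed.frontier_subset
    exact (hc.cthickening.image (σ.homothety k).continuous).measure_lt_top.ne
  · intro T hT
    rw [Finset.mem_filter] at hT
    refine interior_subset.trans fun w hw => ?_
    obtain ⟨v, hv, hdist⟩ := exists_mem_frontier_of_not_subset
      (σ.carrier_subset_of_mem_tiles hT.1 (controlPoint_mem hx T)) hT.2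
    rw [support_base, ← (σ.homothety k).image_frontier] at hv
    obtain ⟨v, hv, rfl⟩ := hv
    obtain ⟨w, rfl⟩ := (σ.homothety k).surjective w
    refine mem_image_of_mem _ (Metric.mem_cthickening_of_dist_le w v _ _ hv ?_)
    have h3 : dist (σ.homothety k w) (σ.homothety k v) ≤ R + D := by
      have h4 := hD T _ hw _ (controlPoint_mem hx T)
      have h5 := dist_triangle (σ.homothety k w) (controlPoint x T) (σ.homothety k v)
      linarith
    rw [dist_eq_norm, homothety_apply, homothety_apply, ← mul_sub, norm_mul, norm_pow,
      Complex.norm_real, Real.norm_eq_abs, abs_of_pos σ.scale_pos] at h3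
    rw [le_div_iff₀ (pow_pos σ.scale_pos k), dist_eq_norm, mul_comm]
    exact h3

lemma tendsto_card_boundaryPoints (hσ : σ.IsPrimitive) (hx : ∀ i, x i ∈ σ.proto i) (R : ℝ)
    (i : Fin m) :
    Tendsto (fun k => ((σ.boundaryPoints x R k i).card : ℝ) / σ.scale ^ (2 * k)) atTop (𝓝 0) := by
  have hne : ∀ i, (σ.proto i).Nonempty := fun i => ⟨x i, hx i⟩
  obtain ⟨D, -, hD⟩ := σ.exists_diam_bound
  obtain ⟨g, hg0, hg⟩ := σ.exists_area_lower_bound hne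
  have hc : IsCompact (frontier (σ.proto i)) :=
    (σ.isCompact_proto i).of_isClosed_subset isClosed_frontier
      (σ.isCompact_proto i).isClosed.frontier_subset
  have h1 : Tendsto (fun k : ℕ => (R + D) / σ.scale ^ k) atTop (𝓝 0) :=
    tendsto_const_nhds.div_atTop (tendsto_pow_atTop_atTop_of_one_lt σ.one_lt_scale)
  have h2 := (tendsto_measure_cthickening_of_isCompact (μ := volume) hc).comp h1
  rw [σ.volume_frontier_proto hσ hne] at h2
  have h3 := ((ENNReal.tendsto_toReal ENNReal.zero_ne_top).comp h2).div_const g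
  rw [ENNReal.toReal_zero, zero_div] at h3
  refine squeeze_zero (fun k => div_nonneg (Nat.cast_nonneg _) (pow_pos σ.scale_pos _).le)
    (fun k => ?_) h3
  have h4 := card_boundaryPoints_mul_le hx hD hg0.le hg R k i
  rw [div_le_iff₀ (pow_pos σ.scale_pos _), Function.comp_apply, Function.comp_apply,
    div_mul_eq_mul_div, le_div_iff₀ hg0, mul_comm (ENNReal.toReal _)]
  exact h4

/-! ### Patches of a substitution tiling -/

/-- A finite part of an infinite substitution tiling is contained in a finite union of supertiles
of given order, all of which meet it. -/
lemma IsSubstitutionTiling.exists_supertile_cover {𝒯 : Set (Tile m)}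
    (h𝒯 : σ.IsSubstitutionTiling 𝒯) (hinf : 𝒯.Infinite) (n : ℕ) {F : Set (Tile m)}
    (hF : F.Finite) (hF𝒯 : F ⊆ 𝒯) :
    ∃ J : Finset (Tile m), NonOverlapping σ.proto (J : Set (Tile m)) ∧
      F ⊆ σ.subst^[n] (J : Set (Tile m)) ∧ ∀ S ∈ J, ∃ T ∈ F, T ∈ σ.inflate n S := by
  classical
  -- No supertile of order below `n` has more than `c` tiles, so adjoining `c + 1` tiles of the
  -- infinite tiling to `F` forces the order `K ≥ n`.
  let c : ℕ := ∑ K ∈ Finset.range n, ∑ i, (σ.tiles K i).card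
  obtain ⟨E, hE𝒯, hEc⟩ := hinf.exists_subset_card_eq (c + 1)
  obtain ⟨i, K, F', ⟨ρ, s, hF'⟩, hF'K⟩ := h𝒯.2 (F ∪ E) (hF.union E.finite_toSet)
    (union_subset hF𝒯 hE𝒯)
  have hnK : n ≤ K := by
    by_contra hlt
    push Not at hlt
    have h1 : c + 1 ≤ (σ.tiles K i).card := by
      rw [← hEc, ← Finset.card_image_of_injective E (Tile.move_injective ρ s)]
      refine Finset.card_le_card fun T hT => ?_
      rw [mem_tiles]
      refine hF'K (hF' ▸ ?_)
      rw [Finset.mem_image] at hT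
      obtain ⟨U, hU, rfl⟩ := hT
      exact mem_image_of_mem _ (Or.inr hU)
    have h2 : (σ.tiles K i).card ≤ c :=
      (Finset.single_le_sum (f := fun i => (σ.tiles K i).card) (fun _ _ => Nat.zero_le _)
        (Finset.mem_univ i)).trans
      (Finset.single_le_sum (f := fun K => ∑ i, (σ.tiles K i).card) (fun _ _ => Nat.zero_le _)
        (Finset.mem_range.2 hlt))
    omega
  obtain ⟨p, rfl⟩ := Nat.exists_eq_add_of_le hnK
  have hscale : (σ.scale : ℂ) ^ n ≠ 0 := pow_ne_zero _ (Complex.ofReal_ne_zero.2 σ.scale_pos.ne')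
  -- The inverse of the congruence, with translation divided by `λ ^ n`, so that after `n`
  -- inflations it carries the copy back onto the original tiles.
  let b : Tile m → Tile m := Tile.move ρ⁻¹ (-(((ρ⁻¹ : Circle) : ℂ) * s) / (σ.scale : ℂ) ^ n)
  have hb : ∀ S, σ.inflate n (b S) =
      Tile.move ρ⁻¹ (-(((ρ⁻¹ : Circle) : ℂ) * s)) '' σ.inflate n S := by
    intro S
    have := σ.iterate_subst_move n ρ⁻¹ (-(((ρ⁻¹ : Circle) : ℂ) * s) / (σ.scale : ℂ) ^ n) {S}
    rw [image_singleton, mul_div_cancel₀ _ hscale] at this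
    exact this
  have hinv : ∀ T : Tile m, (T.move ρ s).move ρ⁻¹ (-(((ρ⁻¹ : Circle) : ℂ) * s)) = T := by
    intro T
    rw [Tile.move_move, inv_mul_cancel, add_neg_cancel]
    simp [Tile.move]
  let J₀ : Finset (Tile m) := (σ.tiles p i).image b
  have hJ₀ : NonOverlapping σ.proto (J₀ : Set (Tile m)) := by
    rw [Finset.coe_image]
    exact (σ.nonOverlapping_tiles p i).move _ _
  have hcover : ∀ T ∈ F, ∃ S ∈ J₀, T ∈ σ.inflate n S := by
    intro T hT
    have h1 : T.move ρ s ∈ σ.supertile (n + p) i := by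
      refine hF'K (hF' ▸ mem_image_of_mem _ (Or.inl hT))
    rw [supertile_add, mem_iUnion₂] at h1
    obtain ⟨S, hS, hTS⟩ := h1
    refine ⟨b S, Finset.mem_image_of_mem _ (σ.mem_tiles.2 hS), ?_⟩
    rw [hb, ← hinv T]
    exact mem_image_of_mem _ hTS
  refine ⟨J₀.filter fun S => ∃ T ∈ F, T ∈ σ.inflate n S,
    hJ₀.mono (Finset.coe_subset.2 (Finset.filter_subset _ _)), fun T hT => ?_,
    fun S hS => (Finset.mem_filter.1 hS).2⟩
  obtain ⟨S, hS, hTS⟩ := hcover T hT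
  rw [iterate_subst_eq, mem_iUnion₂]
  exact ⟨S, Finset.mem_filter.2 ⟨hS, T, hT, hTS⟩, hTS⟩

end Substitution

/-! ### Pair sums over balls -/

lemma volumeReal_closedBall {r : ℝ} (hr : 0 ≤ r) :
    volume.real (Metric.closedBall (0 : ℂ) r) = Real.pi * r ^ 2 := by
  rw [measureReal_def, Complex.volume_closedBall, ENNReal.toReal_mul, ENNReal.toReal_pow,
    ENNReal.toReal_ofReal hr, mul_comm]
  rfl

namespace Substitution

variable {m : ℕ} {σ : Substitution m} {x : Fin m → ℂ}

lemma support_subset_closedBall {D : ℝ}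
    (hD : ∀ (T : Tile m), ∀ z ∈ T.carrier σ.proto, ∀ w ∈ T.carrier σ.proto, dist z w ≤ D)
    {n : ℕ} {S : Tile m} {z : ℂ} (hz : z ∈ σ.support n S) {r : ℝ} (hzr : ‖z‖ ≤ r) :
    σ.support n S ⊆ Metric.closedBall 0 (r + σ.scale ^ n * D) := by
  rintro _ ⟨w, hw, rfl⟩
  obtain ⟨v, hv, rfl⟩ := hz
  have h1 := mul_le_mul_of_nonneg_left (hD S w hw v hv) (pow_nonneg σ.scale_pos.le n)
  rw [mem_closedBall_zero_iff]
  have h2 : ‖σ.homothety n w - σ.homothety n v‖ = σ.scale ^ n * dist w v := by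
    rw [homothety_apply, homothety_apply, ← mul_sub, norm_mul, norm_pow, Complex.norm_real,
      Real.norm_eq_abs, abs_of_pos σ.scale_pos, dist_eq_norm]
  have h3 := norm_sub_norm_le (σ.homothety n w) (σ.homothety n v)
  linarith

/-- The pair sum over the control points of a substitution tiling in a ball is approximated by pair
sums over supertiles. -/
lemma IsSubstitutionTiling.exists_pairSum_ball {𝒯 : Set (Tile m)}
    (h𝒯 : σ.IsSubstitutionTiling 𝒯) (hinf : 𝒯.Infinite) (hx : ∀ i, x i ∈ σ.proto i) {N : ℝ → ℕ}
    (hN : ∀ A, NonOverlapping σ.proto A → LocallySparse (controlPoints x A) N) {D g : ℝ}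
    (hD : ∀ (T : Tile m), ∀ z ∈ T.carrier σ.proto, ∀ w ∈ T.carrier σ.proto, dist z w ≤ D)
    (hD0 : 0 ≤ D) (hg0 : 0 < g) (hg : ∀ i, g ≤ σ.area i) (n : ℕ) {r : ℝ} (hr : D ≤ r) :
    ∃ J : Finset (Tile m),
      J.card * (σ.scale ^ (2 * n) * g) ≤ Real.pi * (r + σ.scale ^ n * D) ^ 2 ∧
      ∀ (f : ℂ → ℝ) (R C : ℝ), 0 ≤ R → (∀ z, |f z| ≤ C) → (∀ z, f z ≠ 0 → ‖z‖ ≤ R) →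
        |pairSum ((hN 𝒯 h𝒯.1.2).finite r).toFinset f -
          ∑ S ∈ J, pairSum (σ.points x n S.type) fun z => f (S.rot * z)| ≤
        2 * (C * N R) * (∑ S ∈ J, ((σ.boundaryPoints x R n S.type).card : ℝ) +
          (Real.pi * (r + σ.scale ^ n * D) ^ 2 - Real.pi * (r - D) ^ 2) / g) := by
  classical
  have hs := σ.scale_pos
  have hsD : 0 ≤ σ.scale ^ n * D := by positivity
  set F : Set (Tile m) := {T ∈ 𝒯 | controlPoint x T ∈ Metric.closedBall 0 r} with hFdef
  have hF : F.Finite := (tiles_card_bound hx hD hg0 hg h𝒯.1.2 r 0).1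
  obtain ⟨J, hJ, hFJ, hmeet⟩ := h𝒯.exists_supertile_cover hinf n hF (sep_subset _ _)
  have hsupp : ∀ S ∈ J, σ.support n S ⊆ Metric.closedBall 0 (r + σ.scale ^ n * D) := by
    intro S hS
    obtain ⟨T, hT, hTS⟩ := hmeet S hS
    exact support_subset_closedBall hD
      (σ.carrier_subset_support hTS (controlPoint_mem hx T)) (mem_closedBall_zero_iff.1 hT.2)
  refine ⟨J, ?_, ?_⟩
  -- The tiles of `J` are packed at their uninflated size into the shrunken ball.
  · let U := σ.homothety n ⁻¹' Metric.closedBall 0 (r + σ.scale ^ n * D)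
    have hU : σ.homothety n '' U = Metric.closedBall 0 (r + σ.scale ^ n * D) :=
      image_preimage_eq _ (σ.homothety n).surjective
    have hUc : IsCompact U := (σ.homothety n).isCompact_preimage.2 (isCompact_closedBall _ _)
    have h1 := σ.card_mul_le hg hJ hUc.measure_lt_top.ne fun S hS => interior_subset.trans
      (image_subset_iff.1 (hsupp S hS))
    have h2 := σ.volumeReal_homothety_image n U
    rw [hU, volumeReal_closedBall (by linarith)] at h2
    rw [h2]
    calc _ = σ.scale ^ (2 * n) * (J.card * g) := by ring
      _ ≤ _ := by gcongr
  · intro f R C hR hC hf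
    have hG := σ.nonOverlapping_iterate hJ n
    set L := ((hN 𝒯 h𝒯.1.2).finite r).toFinset with hLdef
    set L' := J.biUnion (σ.pointsOf x n) with hL'def
    have hcoeL : (L : Set ℂ) = controlPoint x '' F := by
      rw [hLdef, Finite.coe_toFinset, controlPoints_inter]
    have hL' : (L' : Set ℂ) = controlPoint x '' (σ.subst^[n] (J : Set (Tile m))) :=
      σ.coe_biUnion_pointsOf x n J
    have hLL : L ⊆ L' := by
      rw [← Finset.coe_subset, hcoeL, hL']
      exact image_mono hFJ
    have hGfin : (σ.subst^[n] (J : Set (Tile m)) \ F).Finite :=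
      (Finite.iterate_subst σ J.finite_toSet n).subset sdiff_subset
    -- The supertiles over `J` may contain tiles foreign to `𝒯`. The tiles of `F` already cover the
    -- ball of radius `r - D`, so the interiors of all surplus tiles lie in the annulus.
    have hcard : ((L' \ L).card : ℝ) ≤
        (Real.pi * (r + σ.scale ^ n * D) ^ 2 - Real.pi * (r - D) ^ 2) / g := by
      have h1 : L' \ L ⊆ hGfin.toFinset.image (controlPoint x) := by
        intro z hz
        rw [Finset.mem_sdiff, ← Finset.mem_coe, ← Finset.mem_coe, hL', hcoeL] at hz
        obtain ⟨⟨T, hT, rfl⟩, hz⟩ := hz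
        refine Finset.mem_image_of_mem _ (hGfin.mem_toFinset.2 ⟨hT, fun h => hz ?_⟩)
        exact mem_image_of_mem _ h
      have h2 : ((L' \ L).card : ℝ) ≤ hGfin.toFinset.card := by
        exact_mod_cast (Finset.card_le_card h1).trans Finset.card_image_le
      have hsub : Metric.closedBall (0 : ℂ) (r - D) ⊆
          Metric.closedBall 0 (r + σ.scale ^ n * D) :=
        Metric.closedBall_subset_closedBall (by linarith)
      rw [le_div_iff₀ hg0]
      have h3 := σ.card_mul_le hg (A := hGfin.toFinset)
        (U := Metric.closedBall 0 (r + σ.scale ^ n * D) \ Metric.closedBall (0 : ℂ) (r - D))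
        (hG.mono (by simp))
        (measure_ne_top_of_subset sdiff_subset measure_closedBall_lt_top.ne) ?_
      · rw [measureReal_sdiff hsub Metric.isClosed_closedBall.measurableSet
          measure_closedBall_lt_top.ne, volumeReal_closedBall (by linarith),
          volumeReal_closedBall (by linarith)] at h3
        exact (mul_le_mul_of_nonneg_right h2 hg0.le).trans h3
      · intro T hT w hw
        rw [hGfin.mem_toFinset] at hT
        refine ⟨?_, fun hw' => ?_⟩
        · have h4 := hT.1
          rw [iterate_subst_eq, mem_iUnion₂] at h4
          obtain ⟨S, hS, hTS⟩ := h4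
          exact hsupp S hS (σ.carrier_subset_support hTS (interior_subset hw))
        · have h5 : w ∈ ⋃ T ∈ 𝒯, T.carrier σ.proto := by rw [h𝒯.1.1]; exact mem_univ w
          rw [mem_iUnion₂] at h5
          obtain ⟨T', hT', hwT'⟩ := h5
          have h6 : T' ∈ F := by
            refine ⟨hT', ?_⟩
            rw [mem_closedBall_zero_iff] at hw' ⊢
            have h7 := hD T' _ (controlPoint_mem hx T') _ hwT'
            rw [dist_eq_norm] at h7
            have h8 := norm_sub_norm_le (controlPoint x T') w
            linarith
          exact Set.disjoint_left.1 (σ.disjoint_carrier_interior hG (hFJ h6) hT.1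
            fun h => hT.2 (h ▸ h6)) hwT' hw
    have h1 := abs_pairSum_sub_le hLL (by rw [hL']; exact hN _ hG) hC hf
    have h2 := abs_pairSum_iterate_sub_le hx hN hR hC hf hJ n
    have hCN : 0 ≤ 2 * (C * N R) :=
      mul_nonneg (by norm_num) (mul_nonneg ((abs_nonneg _).trans (hC 0)) (Nat.cast_nonneg _))
    have h3 := mul_le_mul_of_nonneg_left hcard hCN
    rw [abs_sub_comm] at h1
    have h4 := abs_sub_le (pairSum L f) (pairSum L' f)
      (∑ S ∈ J, pairSum (σ.points x n S.type) fun z => f (S.rot * z))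
    rw [mul_add]
    linarith

end Substitution

/-! ### Equidistribution of orientations -/

/-- The averages of the first `n` terms of a sequence. -/
def average (a : ℕ → ℂ) (n : ℕ) : ℂ := (1 / (n : ℂ)) * ∑ j ∈ Finset.range n, a j

lemma norm_average_sub_le {a b : ℕ → ℂ} {δ : ℝ} (hδ : 0 ≤ δ) (h : ∀ j, ‖a j - b j‖ ≤ δ) (n : ℕ) :
    ‖average a n - average b n‖ ≤ δ := by
  unfold average
  rw [← mul_sub, ← Finset.sum_sub_distrib, norm_mul]
  rcases Nat.eq_zero_or_pos n with rfl | hn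
  · simpa using hδ
  · have hn' : (0 : ℝ) < n := Nat.cast_pos.2 hn
    have h1 : ‖∑ j ∈ Finset.range n, (a j - b j)‖ ≤ n * δ :=
      (norm_sum_le_of_le _ fun j _ => h j).trans_eq (by simp)
    calc _ ≤ ‖(1 / (n : ℂ))‖ * (n * δ) := by gcongr
      _ = δ := by
        rw [norm_div, norm_one, Complex.norm_natCast]
        field_simp

/-- Abel summation, used to evaluate the limiting average of a step function. -/
lemma sum_range_mul_sub (e : ℕ → ℂ) (N : ℕ) :
    ∑ s ∈ Finset.range N, (s : ℂ) * (e s - e (s + 1)) =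
      ∑ s ∈ Finset.range N, e (s + 1) - N * e N := by
  induction N with
  | zero => simp
  | succ N ih =>
    rw [Finset.sum_range_succ, Finset.sum_range_succ, ih]
    push_cast
    ring

lemma sum_range_exp_eq_zero {q : ℤ} {N : ℕ} (hq : q ≠ 0) (hN : q.natAbs < N) :
    ∑ s ∈ Finset.range N,
      Complex.exp (q * (2 * Real.pi * ((s + 1 : ℕ) : ℂ) / N) * Complex.I) = 0 := by
  have hN0 : (N : ℂ) ≠ 0 := Nat.cast_ne_zero.2 (by omega)
  set ζ := Complex.exp (2 * Real.pi * Complex.I * (q / N)) with hζ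
  have h1 : ∀ s : ℕ, Complex.exp (q * (2 * Real.pi * ((s + 1 : ℕ) : ℂ) / N) * Complex.I) =
      ζ ^ s * ζ := by
    intro s
    rw [← pow_succ, hζ, ← Complex.exp_nat_mul]
    congr 1
    field_simp
  have h2 : ζ ^ N = 1 := by
    rw [hζ, ← Complex.exp_nat_mul, Complex.exp_eq_one_iff]
    exact ⟨q, by field_simp⟩
  have h3 : ζ ≠ 1 := by
    rw [hζ, Ne, Complex.exp_eq_one_iff]
    rintro ⟨k, hk⟩
    have hpi : (2 * Real.pi * Complex.I : ℂ) ≠ 0 := Complex.two_pi_I_ne_zero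
    rw [mul_comm (k : ℂ)] at hk
    have h4 := mul_left_cancel₀ hpi hk
    rw [div_eq_iff hN0] at h4
    have h5 : q = k * N := by exact_mod_cast h4
    have h6 : k ≠ 0 := fun h => hq (by rw [h5, h, zero_mul])
    have h7 : q.natAbs = k.natAbs * N := by rw [h5, Int.natAbs_mul, Int.natAbs_natCast]
    have h8 : 1 ≤ k.natAbs := Int.natAbs_pos.2 h6
    nlinarith
  simp_rw [h1, ← Finset.sum_mul]
  have h4 := geom_sum_mul ζ N
  rw [h2, sub_self] at h4
  rw [(mul_eq_zero.1 h4).resolve_right (sub_ne_zero.2 h3), zero_mul]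

lemma norm_exp_mul_I_sub_le (q : ℤ) (a b : ℝ) :
    ‖Complex.exp (q * a * Complex.I) - Complex.exp (q * b * Complex.I)‖ ≤ |(q : ℝ)| * |a - b| := by
  have h1 : Complex.exp (q * a * Complex.I) - Complex.exp (q * b * Complex.I) =
      Complex.exp (((q * b : ℝ) : ℂ) * Complex.I) *
        (Complex.exp (Complex.I * ((q * (a - b) : ℝ) : ℂ)) - 1) := by
    rw [mul_sub, ← Complex.exp_add, mul_one]
    push_cast
    ring_nf
  rw [h1, norm_mul, Complex.norm_exp_ofReal_mul_I, one_mul, ← abs_mul]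
  exact Real.norm_exp_I_mul_ofReal_sub_one_le

lemma Equidistributed.tendsto_average_indicator {a : ℕ → ℝ} (h : Equidistributed a)
    (ha : ∀ j, 0 ≤ a j) {y : ℝ} (hy : 0 < y) (hy' : y < 2 * Real.pi) :
    Tendsto (average fun j => if a j ≤ y then 1 else 0) atTop (𝓝 ((y / (2 * Real.pi) : ℝ) : ℂ)) := by
  have h1 := (Complex.continuous_ofReal.tendsto _).comp (h 0 y le_rfl hy hy')
  rw [sub_zero] at h1
  refine h1.congr fun n => ?_
  simp only [average, Function.comp_apply]
  push_cast
  congr 1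
  refine Finset.sum_congr rfl fun j _ => ?_
  by_cases hj : a j ≤ y
  · rw [indicator_of_mem (s := Icc 0 y) (a := a j) ⟨ha j, hj⟩, if_pos hj]
    simp
  · rw [indicator_of_notMem (s := Icc 0 y) (a := a j) fun h' => hj h'.2, if_neg hj]
    simp

/-- The empty average is `0` by convention and would not reproduce the constant. -/
lemma average_const_add_sum (c : ℂ) (N : ℕ) (d : ℕ → ℂ) (b : ℕ → ℕ → ℂ) {n : ℕ} (hn : n ≠ 0) :
    average (fun j => c + ∑ s ∈ Finset.range N, d s * b s j) n =
      c + ∑ s ∈ Finset.range N, d s * average (b s) n := by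
  have hn' : (n : ℂ) ≠ 0 := Nat.cast_ne_zero.2 hn
  simp only [average]
  rw [Finset.sum_add_distrib, Finset.sum_comm, mul_add, Finset.sum_const, Finset.card_range,
    nsmul_eq_mul, one_div, inv_mul_cancel_left₀ hn', Finset.mul_sum]
  congr 1
  refine Finset.sum_congr rfl fun s _ => ?_
  rw [← Finset.mul_sum]
  ring

/-- Weyl's criterion: the exponential averages of an equidistributed sequence tend to zero. -/
theorem Equidistributed.tendsto_average_exp {a : ℕ → ℝ} (h : Equidistributed a)
    (ha : ∀ j, a j ∈ Ico 0 (2 * Real.pi)) {q : ℤ} (hq : q ≠ 0) :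
    Tendsto (average fun j => Complex.exp (q * a j * Complex.I)) atTop (𝓝 0) := by
  have hpi := Real.pi_pos
  rw [Metric.tendsto_atTop]
  intro ε hε
  -- `N > |q|` makes the sum over the equally spaced nodes vanish; the other bound makes the mesh
  -- fine enough for the exponential.
  obtain ⟨N, hN⟩ := exists_nat_gt (max (q.natAbs : ℝ) (|(q : ℝ)| * (2 * Real.pi) / (ε / 2)))
  have hN1 : q.natAbs < N := by exact_mod_cast (le_max_left _ _).trans_lt hN
  have hN0 : (0 : ℝ) < N := by exact_mod_cast (Nat.zero_le _).trans_lt hN1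
  have hN2 : |(q : ℝ)| * (2 * Real.pi / N) < ε / 2 := by
    have := (le_max_right _ _).trans_lt hN
    rw [div_lt_iff₀ (by positivity)] at this
    rw [← mul_div_assoc, div_lt_iff₀ hN0]
    linarith
  let t : ℕ → ℝ := fun s => 2 * Real.pi * s / N
  let e : ℕ → ℂ := fun s => Complex.exp (q * t s * Complex.I)
  -- Threshold indicators, from which `E` rebuilds a step function by telescoping. The threshold at
  -- `s = 0` is suppressed because equidistribution is assumed only for intervals with `x < y`.
  let b : ℕ → ℕ → ℂ := fun s j => if 1 ≤ s ∧ a j ≤ t s then 1 else 0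
  let E : ℕ → ℂ := fun j => e N + ∑ s ∈ Finset.range N, (e s - e (s + 1)) * b s j
  have happrox : ∀ j, ‖Complex.exp (q * a j * Complex.I) - E j‖ ≤ |(q : ℝ)| * (2 * Real.pi / N) := by
    intro j
    obtain ⟨ha0, ha1⟩ := ha j
    -- The first node with positive index at or above `a j`; even for `a j = 0` it is at most one
    -- mesh away.
    let s₀ := max 1 ⌈a j * N / (2 * Real.pi)⌉₊
    have hs₀N : s₀ ≤ N := by
      refine max_le (by exact_mod_cast hN0) (Nat.ceil_le.2 ?_)
      rw [div_le_iff₀ (by positivity), mul_comm (N : ℝ)]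
      gcongr
    have hb : ∀ s, b s j = if s₀ ≤ s then 1 else 0 := by
      intro s
      refine if_congr ?_ rfl rfl
      rw [max_le_iff, Nat.ceil_le, div_le_iff₀ (by positivity), and_congr_right_iff]
      intro _
      simp only [t]
      rw [le_div_iff₀ hN0, mul_comm (s : ℝ)]
    have hE : E j = e s₀ := by
      simp only [E, hb, mul_ite, mul_one, mul_zero]
      rw [← Finset.sum_filter]
      have h1 : (Finset.range N).filter (fun s => s₀ ≤ s) = Finset.Ico s₀ N := by
        ext s
        simp [and_comm]
      rw [h1]
      have h2 := Finset.sum_Ico_sub e hs₀N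
      have h3 : ∑ s ∈ Finset.Ico s₀ N, (e s - e (s + 1)) = -(e N - e s₀) := by
        rw [← h2, ← Finset.sum_neg_distrib]
        exact Finset.sum_congr rfl fun s _ => by ring
      rw [h3]
      ring
    rw [hE]
    refine (norm_exp_mul_I_sub_le q (a j) (t s₀)).trans ?_
    gcongr
    have h1 : (s₀ : ℝ) ≤ a j * N / (2 * Real.pi) + 1 := by
      simp only [s₀]
      rw [Nat.cast_max]
      refine max_le ?_ (Nat.ceil_lt_add_one (by positivity)).le
      push_cast
      linarith [show 0 ≤ a j * N / (2 * Real.pi) by positivity]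
    have h2 : a j ≤ t s₀ := by
      simp only [t]
      have h3 : a j * N / (2 * Real.pi) ≤ s₀ :=
        (Nat.le_ceil _).trans (by exact_mod_cast le_max_right _ _)
      rw [div_le_iff₀ (by positivity)] at h3
      rw [le_div_iff₀ hN0]
      linarith
    rw [abs_sub_comm, abs_of_nonneg (sub_nonneg.2 h2), sub_le_iff_le_add]
    simp only [t]
    calc 2 * Real.pi * s₀ / N ≤ 2 * Real.pi * (a j * N / (2 * Real.pi) + 1) / N := by gcongr
      _ = _ := by field_simp; ring
  have hlim : Tendsto (average E) atTop (𝓝 0) := by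
    have h1 : ∀ s ∈ Finset.range N, Tendsto (average (b s)) atTop (𝓝 ((s : ℂ) / N)) := by
      intro s hs
      rw [Finset.mem_range] at hs
      rcases Nat.eq_zero_or_pos s with rfl | hs0
      · have : b 0 = fun _ => 0 := by ext j; simp [b]
        have h0 : average (fun _ => 0) = fun _ => 0 := by ext n; simp [average]
        rw [this, h0]
        simp
      · have hs' : (0 : ℝ) < s := Nat.cast_pos.2 hs0
        have h2 := h.tendsto_average_indicator (fun j => (ha j).1) (y := t s)
          (by simp only [t]; positivity) (by
            simp only [t]
            rw [div_lt_iff₀ hN0]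
            gcongr)
        have h3 : b s = fun j => if a j ≤ t s then 1 else 0 := by
          ext j
          exact if_congr (and_iff_right hs0) rfl rfl
        rw [h3]
        convert h2 using 2
        simp only [t]
        push_cast
        field_simp
    have h2 : Tendsto (fun n => e N + ∑ s ∈ Finset.range N, (e s - e (s + 1)) * average (b s) n) atTop
        (𝓝 (e N + ∑ s ∈ Finset.range N, (e s - e (s + 1)) * ((s : ℂ) / N))) :=
      tendsto_const_nhds.add (tendsto_finsetSum _ fun s hs => (h1 s hs).const_mul _)
    have hNC : (N : ℂ) ≠ 0 := by exact_mod_cast hN0.ne'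
    -- By Abel summation this is the mean of `e` over the `N` nodes, a vanishing geometric sum of
    -- powers of a nontrivial `N`-th root of unity.
    have h3 : e N + ∑ s ∈ Finset.range N, (e s - e (s + 1)) * ((s : ℂ) / N) = 0 := by
      have h4 : ∑ s ∈ Finset.range N, (e s - e (s + 1)) * ((s : ℂ) / N) =
          (∑ s ∈ Finset.range N, (s : ℂ) * (e s - e (s + 1))) / N := by
        rw [Finset.sum_div]
        exact Finset.sum_congr rfl fun s _ => by ring
      have h5 : ∑ s ∈ Finset.range N, e (s + 1) = 0 := by
        rw [← sum_range_exp_eq_zero hq hN1]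
        refine Finset.sum_congr rfl fun s _ => ?_
        simp only [e, t]
        push_cast
        rfl
      rw [h4, sum_range_mul_sub, h5]
      field_simp
      ring
    rw [h3] at h2
    refine h2.congr' ?_
    filter_upwards [eventually_ne_atTop 0] with n hn
    exact (average_const_add_sum _ _ _ _ hn).symm
  obtain ⟨n₀, hn₀⟩ := Metric.tendsto_atTop.1 hlim (ε / 2) (by positivity)
  refine ⟨n₀, fun n hn => ?_⟩
  have h1 := hn₀ n hn
  have h2 := norm_average_sub_le (by positivity) happrox n
  rw [dist_zero_right] at h1 ⊢
  calc _ = ‖(average (fun j => Complex.exp (q * a j * Complex.I)) n - average E n) + average E n‖ := by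
        rw [sub_add_cancel]
    _ ≤ _ := norm_add_le _ _
    _ < ε := by linarith

lemma Tile.orientation_mem {m : ℕ} (T : Tile m) : T.orientation ∈ Ico 0 (2 * Real.pi) := by
  have := toIcoMod_mem_Ico Real.two_pi_pos 0 (Complex.arg (T.rot : ℂ))
  rwa [zero_add] at this

lemma Tile.exp_orientation {m : ℕ} (T : Tile m) (q : ℤ) :
    Complex.exp (q * T.orientation * Complex.I) = (T.rot : ℂ) ^ q := by
  have h1 : Complex.exp (T.orientation * Complex.I) = T.rot := by
    have h2 := self_sub_toIcoDiv_zsmul Real.two_pi_pos 0 (Complex.arg (T.rot : ℂ))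
    have h3 := Complex.norm_mul_exp_arg_mul_I (T.rot : ℂ)
    rw [Circle.norm_coe T.rot, Complex.ofReal_one, one_mul] at h3
    rw [Tile.orientation, ← h2, zsmul_eq_mul]
    push_cast
    rw [sub_mul, mul_assoc, Complex.exp_sub, Complex.exp_int_mul_two_pi_mul_I, div_one]
    exact h3
  rw [mul_assoc, Complex.exp_int_mul, h1]

/-! ### Orientations of the tiles of large supertiles -/

/-- If a convex combination of points of a disc lies on the boundary circle, the points coincide. -/
lemma eq_of_norm_weighted_sum_eq {ι : Type*} {s : Finset ι} {c : ι → ℝ} {z : ι → ℂ} {l : ℝ}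
    (hc : ∀ i ∈ s, 0 < c i) (hsum : ∑ i ∈ s, c i = 1) (hz : ∀ i ∈ s, ‖z i‖ ≤ l)
    (hl : ‖∑ i ∈ s, (c i : ℂ) * z i‖ = l) : ∀ i ∈ s, z i = ∑ i ∈ s, (c i : ℂ) * z i := by
  set Z := ∑ i ∈ s, (c i : ℂ) * z i with hZ
  have hl0 : 0 ≤ l := hl ▸ norm_nonneg Z
  -- Pairing with `Z` itself: Cauchy–Schwarz bounds each term, so equality of the sums forces
  -- equality in every term.
  have h1 : ∑ i ∈ s, c i * inner ℝ Z (z i) = ∑ i ∈ s, c i * l ^ 2 := by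
    rw [← Finset.sum_mul, hsum, one_mul, ← hl, ← real_inner_self_eq_norm_sq]
    conv_rhs => rw [hZ, inner_sum]
    refine Finset.sum_congr rfl fun i _ => ?_
    rw [← Complex.real_smul, real_inner_smul_right]
  have h2 : ∀ i ∈ s, c i * inner ℝ Z (z i) ≤ c i * l ^ 2 := by
    intro i hi
    refine mul_le_mul_of_nonneg_left ?_ (hc i hi).le
    refine (real_inner_le_norm _ _).trans ?_
    rw [hl, sq]
    exact mul_le_mul_of_nonneg_left (hz i hi) hl0
  intro i hi
  have h3 := (Finset.sum_eq_sum_iff_of_le h2).1 h1 i hi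
  have h4 : inner ℝ Z (z i) = l ^ 2 := mul_left_cancel₀ (hc i hi).ne' h3
  have h5 := norm_sub_sq_real Z (z i)
  rw [h4, hl] at h5
  have h6 : ‖z i‖ ^ 2 ≤ l ^ 2 := pow_le_pow_left₀ (norm_nonneg _) (hz i hi) 2
  have h7 : ‖Z - z i‖ ^ 2 = 0 := le_antisymm (by linarith) (sq_nonneg _)
  rw [sq_eq_zero_iff, norm_eq_zero, sub_eq_zero] at h7
  exact h7.symm

/-- Simultaneous approximation: some power of finitely many points of the circle has positive real
parts. -/
lemma exists_pow_re_ge {ι : Type*} [Finite ι] (α : ι → Circle) :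
    ∃ n : ℕ, 1 ≤ n ∧ ∀ i, 1 / 2 ≤ (((α i) ^ n : Circle) : ℂ).re := by
  -- In a compact group the powers of an element return arbitrarily close to `1`; here the group is
  -- the torus indexed by `ι`.
  have h1 := mapClusterPt_one_atTop_pow α
  have h2 : {β : ι → Circle | ∀ i, 1 / 2 < ((β i : Circle) : ℂ).re} ∈ 𝓝 (1 : ι → Circle) := by
    have : {β : ι → Circle | ∀ i, 1 / 2 < ((β i : Circle) : ℂ).re} =
        ⋂ i, {β : ι → Circle | 1 / 2 < ((β i : Circle) : ℂ).re} := by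
      ext β
      simp
    rw [this]
    refine (isOpen_iInter_of_finite fun i => ?_).mem_nhds (mem_iInter.2 fun i => ?_)
    · exact isOpen_lt continuous_const
        (Complex.continuous_re.comp (continuous_subtype_val.comp (continuous_apply i)))
    · change (1 / 2 : ℝ) < ((1 : Circle) : ℂ).re
      rw [Circle.coe_one, Complex.one_re]
      norm_num
  obtain ⟨n, hn, hn1⟩ := ((mapClusterPt_iff_frequently.1 h1 _ h2).and_eventually
    (eventually_ge_atTop 1)).exists
  exact ⟨n, hn1, fun i => (hn i).le⟩

namespace Substitution

variable {m : ℕ} (σ : Substitution m)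

/-- The averages, weighted by area, of `u (type T) φ(T)^q` over the tiles `T` of a supertile. -/
def twistedAverage (q : ℤ) (k : ℕ) (u : Fin m → ℂ) (j : Fin m) : ℂ :=
  ∑ T ∈ σ.tiles k j, ((σ.area T.type / (σ.scale ^ (2 * k) * σ.area j) : ℝ) : ℂ) *
    (((T.rot ^ q : Circle) : ℂ) * u T.type)

variable {σ}

lemma continuous_twistedAverage (q : ℤ) (k : ℕ) : Continuous (σ.twistedAverage q k) :=
  continuous_pi fun j => continuous_finsetSum _ fun T _ => by fun_prop

lemma sum_weights (hσ : σ.IsPrimitive) (hne : ∀ i, (σ.proto i).Nonempty) (k : ℕ) (j : Fin m) :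
    ∑ T ∈ σ.tiles k j, σ.area T.type / (σ.scale ^ (2 * k) * σ.area j) = 1 := by
  rw [← Finset.sum_div, σ.sum_area_tiles hσ hne]
  exact div_self (mul_pos (pow_pos σ.scale_pos _) (σ.area_pos hne j)).ne'

lemma weight_pos (hne : ∀ i, (σ.proto i).Nonempty) (k : ℕ) (i j : Fin m) :
    0 < σ.area i / (σ.scale ^ (2 * k) * σ.area j) :=
  div_pos (σ.area_pos hne i) (mul_pos (pow_pos σ.scale_pos _) (σ.area_pos hne j))

/-- The area weights of a supertile sum to `1` and the twists are unimodular, so each entry is a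
convex combination of points of a disc. -/
lemma norm_twistedAverage_le (hσ : σ.IsPrimitive) (hne : ∀ i, (σ.proto i).Nonempty) (q : ℤ) (k : ℕ)
    (u : Fin m → ℂ) : ‖σ.twistedAverage q k u‖ ≤ ‖u‖ := by
  refine (pi_norm_le_iff_of_nonneg (norm_nonneg u)).2 fun j => ?_
  calc ‖σ.twistedAverage q k u j‖
      ≤ ∑ T ∈ σ.tiles k j, σ.area T.type / (σ.scale ^ (2 * k) * σ.area j) * ‖u‖ := by
        refine norm_sum_le_of_le _ fun T _ => ?_
        have := σ.weight_pos hne k T.type j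
        rw [norm_mul, norm_mul, Circle.norm_coe (T.rot ^ q), one_mul, Complex.norm_real,
          Real.norm_eq_abs, abs_of_pos this]
        gcongr
        exact norm_le_pi_norm u _
    _ = ‖u‖ := by rw [← Finset.sum_mul, sum_weights hσ hne, one_mul]

/-- Orientations multiply and area weights telescope when supertiles are nested, which gives the
semigroup law. -/
lemma twistedAverage_add (hne : ∀ i, (σ.proto i).Nonempty) (q : ℤ) (k p : ℕ)
    (u : Fin m → ℂ) :
    σ.twistedAverage q (k + p) u = σ.twistedAverage q p (σ.twistedAverage q k u) := by
  ext j
  unfold twistedAverage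
  rw [σ.sum_tiles_add hne]
  refine Finset.sum_congr rfl fun S _ => ?_
  rw [Finset.mul_sum, Finset.mul_sum]
  refine Finset.sum_congr rfl fun T _ => ?_
  have h1 : σ.inflateMove k S T = ⟨T.type, S.rot * T.rot,
    (S.rot : ℂ) * T.trans + (σ.scale : ℂ) ^ k * S.trans⟩ := rfl
  rw [h1]
  simp only [mul_zpow, Circle.coe_mul]
  have h2 : σ.area T.type / (σ.scale ^ (2 * (k + p)) * σ.area j) =
      σ.area S.type / (σ.scale ^ (2 * p) * σ.area j) *
        (σ.area T.type / (σ.scale ^ (2 * k) * σ.area S.type)) := by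
    have := (σ.area_pos hne S.type).ne'
    have := (σ.area_pos hne j).ne'
    have := σ.scale_pos.ne'
    rw [mul_add, pow_add]
    field_simp
  rw [h2]
  push_cast
  ring

/-- The orientations of some supertile of each twist are not concentrated. -/
def HasCancellation (σ : Substitution m) : Prop :=
  ∀ q : ℤ, q ≠ 0 → ∃ (k : ℕ) (i : Fin m),
    ‖∑ T ∈ σ.tiles k i, ((T.rot ^ q : Circle) : ℂ)‖ < (σ.tiles k i).card / 2

/-- A vector on whose orbit the twisted averages preserve the norm forces the orientations to be
determined by the types. -/
lemma rot_zpow_mul_eq (hσ : σ.IsPrimitive) (hne : ∀ i, (σ.proto i).Nonempty) {q : ℤ}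
    {v : Fin m → ℂ} {l : ℝ} (hv : ∀ k, ‖σ.twistedAverage q k v‖ = l) :
    (∀ k i, ‖σ.twistedAverage q k v i‖ = l) ∧
      ∀ k j, ∀ T ∈ σ.tiles k j,
        ((T.rot ^ q : Circle) : ℂ) * v T.type = σ.twistedAverage q k v j := by
  have hzero : σ.twistedAverage q 0 v = v := by
    ext j
    have := (σ.area_pos hne j).ne'
    simp [twistedAverage, tiles_zero, this]
  have key : ∀ (u : Fin m → ℂ) (k : ℕ) (j : Fin m), (∀ i, ‖u i‖ ≤ l) →
      ‖σ.twistedAverage q k u j‖ = l → ∀ T ∈ σ.tiles k j,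
        ((T.rot ^ q : Circle) : ℂ) * u T.type = σ.twistedAverage q k u j := by
    intro u k j hu h T hT
    exact eq_of_norm_weighted_sum_eq
      (z := fun T : Tile m => ((T.rot ^ q : Circle) : ℂ) * u T.type)
      (fun T _ => σ.weight_pos hne k T.type j) (sum_weights hσ hne k j)
      (fun T _ => by rw [norm_mul, Circle.norm_coe (T.rot ^ q), one_mul]; exact hu _) h T hT
  have hle : ∀ k i, ‖σ.twistedAverage q k v i‖ ≤ l := fun k i => hv k ▸ norm_le_pi_norm _ i
  have h1 : ∀ k i, ‖σ.twistedAverage q k v i‖ = l := by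
    intro p i
    -- The maximal modulus is attained somewhere at order `p + k`. Strict convexity passes it down
    -- to all tiles of that order-`k` supertile, and these show every type.
    obtain ⟨k, -, hk⟩ := hσ.exists_mem_tiles
    have hne' : Nonempty (Fin m) := ⟨i⟩
    obtain ⟨j, hj⟩ : ∃ j, ‖σ.twistedAverage q (p + k) v j‖ = l := by
      obtain ⟨j, hj⟩ := Finite.exists_max fun j => ‖σ.twistedAverage q (p + k) v j‖
      refine ⟨j, le_antisymm (hle _ _) ?_⟩
      rw [← hv (p + k)]
      exact (pi_norm_le_iff_of_nonneg (norm_nonneg _)).2 hj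
    obtain ⟨T, hT, rfl⟩ := hk i j
    rw [twistedAverage_add hne] at hj
    have h2 := congrArg norm (key _ k j (hle p) hj T hT)
    rwa [norm_mul, Circle.norm_coe (T.rot ^ q), one_mul, hj] at h2
  refine ⟨h1, fun k j => key v k j (fun i => ?_) (h1 k j)⟩
  have := hle 0 i
  rwa [hzero] at this

/-- The `q`-th powers of the orientations form a coboundary: a factor of the supertile times the
inverse of a factor of the tile type. This alone does not contradict cancellation at `q`, because
the type factors may cancel; at a suitable multiple of `q` they cannot. -/
lemma false_of_norm_twistedAverage_eq (hσ : σ.IsPrimitive) (hne : ∀ i, (σ.proto i).Nonempty)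
    (hcan : σ.HasCancellation) {q : ℤ} (hq : q ≠ 0)
    {v : Fin m → ℂ} {l : ℝ} (hl : 0 < l) (hv : ∀ k, ‖σ.twistedAverage q k v‖ = l) : False := by
  obtain ⟨h1, h2⟩ := rot_zpow_mul_eq hσ hne hv
  have hzero : σ.twistedAverage q 0 v = v := by
    ext j
    have := (σ.area_pos hne j).ne'
    simp [twistedAverage, tiles_zero, this]
  have hunit : ∀ k i, σ.twistedAverage q k v i / l ∈ Submonoid.unitSphere ℂ := fun k i => by
    rw [← SetLike.mem_coe, Submonoid.coe_unitSphere, mem_sphere_zero_iff_norm, norm_div, h1,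
      Complex.norm_real, Real.norm_eq_abs, abs_of_pos hl, div_self hl.ne']
  let β : ℕ → Fin m → Circle := fun k i => ⟨_, hunit k i⟩
  have hβ : ∀ k i, ((β k i : Circle) : ℂ) = σ.twistedAverage q k v i / l := fun _ _ => rfl
  have hrot : ∀ k j, ∀ T ∈ σ.tiles k j, T.rot ^ q = β k j * (β 0 T.type)⁻¹ := by
    intro k j T hT
    rw [eq_mul_inv_iff_mul_eq]
    apply Circle.ext
    rw [Circle.coe_mul, hβ, hβ, hzero, ← mul_div_assoc, h2 k j T hT]
  -- `n ≥ 1` keeps the twist `q * n` nonzero, and real parts at least `1 / 2` keep the sum at least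
  -- half the number of tiles.
  obtain ⟨n, hn1, hn⟩ := exists_pow_re_ge (β 0)
  obtain ⟨k, i, hki⟩ := hcan (q * n) (mul_ne_zero hq (by exact_mod_cast (by omega : n ≠ 0)))
  refine absurd hki (not_lt.2 ?_)
  have h3 : ∑ T ∈ σ.tiles k i, ((T.rot ^ (q * n) : Circle) : ℂ) =
      ((β k i ^ n : Circle) : ℂ) * ∑ T ∈ σ.tiles k i, (((β 0 T.type ^ n)⁻¹ : Circle) : ℂ) := by
    rw [Finset.mul_sum]
    refine Finset.sum_congr rfl fun T hT => ?_
    rw [zpow_mul, hrot k i T hT, zpow_natCast, mul_pow, inv_pow, Circle.coe_mul]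
  rw [h3, norm_mul, Circle.norm_coe (β k i ^ n), one_mul]
  refine le_trans ?_ ((le_abs_self _).trans (Complex.abs_re_le_norm _))
  rw [Complex.re_sum, div_eq_mul_one_div, ← nsmul_eq_mul]
  refine Finset.card_nsmul_le_sum _ _ _ fun T _ => ?_
  rw [Circle.coe_inv_eq_conj, Complex.conj_re]
  exact hn T.type

/-- The twisted averages over large supertiles tend to zero. -/
theorem tendsto_twistedAverage (hσ : σ.IsPrimitive) (hne : ∀ i, (σ.proto i).Nonempty)
    (hcan : σ.HasCancellation) {q : ℤ} (hq : q ≠ 0) (u : Fin m → ℂ) :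
    Tendsto (fun k => σ.twistedAverage q k u) atTop (𝓝 0) := by
  have hanti : Antitone fun k => ‖σ.twistedAverage q k u‖ := antitone_nat_of_succ_le fun k => by
    rw [twistedAverage_add hne]
    exact norm_twistedAverage_le hσ hne _ _ _
  obtain ⟨l, hl⟩ : ∃ l, Tendsto (fun k => ‖σ.twistedAverage q k u‖) atTop (𝓝 l) :=
    ⟨_, tendsto_atTop_ciInf hanti ⟨0, by rintro _ ⟨k, rfl⟩; exact norm_nonneg _⟩⟩
  have hl0 : 0 ≤ l := ge_of_tendsto' hl fun k => norm_nonneg _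
  rcases hl0.eq_or_lt with rfl | hlpos
  · exact tendsto_zero_iff_norm_tendsto_zero.2 hl
  exfalso
  -- At a limit point `v` of the orbit, each further average has norm `l`: it is a limit of norms
  -- along shifted times of the same decreasing sequence.
  obtain ⟨v, -, φ, hφ, hv⟩ := (isCompact_closedBall (0 : Fin m → ℂ) ‖u‖).tendsto_subseq
    (x := fun k => σ.twistedAverage q k u) fun k => by
      rw [mem_closedBall_zero_iff]
      exact norm_twistedAverage_le hσ hne q k u
  refine false_of_norm_twistedAverage_eq hσ hne hcan hq hlpos (v := v) fun p => ?_
  have h1 := (((continuous_twistedAverage (σ := σ) q p).tendsto v).comp hv).norm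
  refine tendsto_nhds_unique h1 ?_
  have h2 := hl.comp ((tendsto_add_atTop_iff_nat p).2 tendsto_id |>.comp hφ.tendsto_atTop)
  refine h2.congr fun n => ?_
  simp only [Function.comp_apply, id]
  rw [twistedAverage_add hne]

lemma HasStatisticalCircularSymmetry.infinite {𝒯 : Set (Tile m)}
    (h : σ.HasStatisticalCircularSymmetry 𝒯) : 𝒯.Infinite := by
  obtain ⟨T, ⟨hinj, hrange, -⟩, -⟩ := h
  rw [← hrange]
  exact infinite_range_of_injective hinj

/-- Weyl's criterion on one long initial segment that is congruent to a supertile; the congruence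
multiplies the sum by a phase only. -/
lemma HasStatisticalCircularSymmetry.hasCancellation {𝒯 : Set (Tile m)}
    (h : σ.HasStatisticalCircularSymmetry 𝒯) : σ.HasCancellation := by
  classical
  obtain ⟨T, ⟨hinj, -, hsuper⟩, hequi⟩ := h
  intro q hq
  have h1 := hequi.tendsto_average_exp (fun j => (T j).orientation_mem) hq
  obtain ⟨n₀, hn₀⟩ := Metric.tendsto_atTop.1 h1 (1 / 2) (by norm_num)
  obtain ⟨l, hl, i, k, -, ρ, s, hcong⟩ := hsuper (n₀ + 1)
  refine ⟨k, i, ?_⟩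
  have htiles : σ.tiles k i = (Finset.range l).image fun j => (T j).move ρ s := by
    rw [← Finset.coe_inj, coe_tiles, ← hcong, Finset.coe_image, image_image, Finset.coe_range]
  have hinj' : Function.Injective fun j => (T j).move ρ s :=
    (Tile.move_injective ρ s).comp hinj
  have hl0 : (0 : ℝ) < l := Nat.cast_pos.2 (by omega)
  have h2 := hn₀ l (by omega)
  rw [htiles, Finset.card_image_of_injective _ hinj', Finset.card_range,
    Finset.sum_image fun a _ b _ hab => hinj' hab]
  have h3 : ∑ j ∈ Finset.range l, ((((T j).move ρ s).rot ^ q : Circle) : ℂ) =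
      ((ρ ^ q : Circle) : ℂ) * ∑ j ∈ Finset.range l,
        Complex.exp (q * (T j).orientation * Complex.I) := by
    rw [Finset.mul_sum]
    refine Finset.sum_congr rfl fun j _ => ?_
    rw [Tile.exp_orientation]
    change (((ρ * (T j).rot) ^ q : Circle) : ℂ) = _
    rw [mul_zpow, Circle.coe_mul, Circle.coe_zpow (T j).rot]
  rw [h3, norm_mul, Circle.norm_coe (ρ ^ q), one_mul]
  rw [dist_zero_right, average, norm_mul, norm_div, norm_one, Complex.norm_natCast,
    div_mul_eq_mul_div, one_mul, div_lt_iff₀ hl0] at h2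
  linarith

end Substitution

/-! ### Asymptotic rotation invariance -/

lemma exists_trigPolynomial_approx (F : C(Circle, ℂ)) {ε : ℝ} (hε : 0 < ε) :
    ∃ c : ℤ →₀ ℂ, ∀ z : Circle, ‖F z - c.sum fun q a => a * ((z ^ q : Circle) : ℂ)‖ ≤ ε := by
  have : Fact (0 < 2 * Real.pi) := ⟨Real.two_pi_pos⟩
  let G : C(AddCircle (2 * Real.pi), ℂ) := F.comp ⟨AddCircle.toCircle, AddCircle.continuous_toCircle⟩
  have hG : G ∈ (Submodule.span ℂ (range (@fourier (2 * Real.pi)))).topologicalClosure := by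
    rw [span_fourier_closure_eq_top]
    trivial
  rw [← SetLike.mem_coe, Submodule.topologicalClosure_coe, Metric.mem_closure_iff] at hG
  obtain ⟨p, hp, hdist⟩ := hG ε hε
  obtain ⟨c, rfl⟩ := Finsupp.mem_span_range_iff_exists_finsupp.1 hp
  refine ⟨c, fun z => ?_⟩
  obtain ⟨t, rfl⟩ := (AddCircle.homeomorphCircle Real.two_pi_pos.ne').surjective z
  rw [AddCircle.homeomorphCircle_apply]
  have h1 := (ContinuousMap.dist_apply_le_dist (f := G) (g := c.sum fun i a => a • fourier i) t).trans
    hdist.le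
  rw [dist_eq_norm] at h1
  have h2 : (c.sum fun i a => a • fourier (T := 2 * Real.pi) i) t =
      c.sum fun q a => a * ((t.toCircle ^ q : Circle) : ℂ) := by
    simp only [Finsupp.sum]
    rw [ContinuousMap.coe_sum, Finset.sum_apply]
    refine Finset.sum_congr rfl fun q _ => ?_
    rw [ContinuousMap.smul_apply, smul_eq_mul, fourier_apply, AddCircle.toCircle_zsmul]
  rw [← h2]
  exact h1

namespace Substitution

variable {m : ℕ} {σ : Substitution m} {x : Fin m → ℂ}

lemma card_tiles_mul_le {g : ℝ} (hg : ∀ i, g ≤ σ.area i) (p : ℕ) (j : Fin m) :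
    (σ.tiles p j).card * g ≤ σ.scale ^ (2 * p) * σ.area j := by
  rw [← nsmul_eq_mul]
  exact (Finset.card_nsmul_le_sum _ _ _ fun T _ => hg T.type).trans (σ.sum_area_tiles_le p j)

/-- Dividing the coefficients by the tile areas converts counting sums into area-weighted averages.
-/
lemma sum_tiles_zpow_eq (hne : ∀ i, (σ.proto i).Nonempty) (q : ℤ) (p : ℕ) (j : Fin m)
    (c : Fin m → ℂ) :
    ∑ T ∈ σ.tiles p j, c T.type * ((T.rot ^ q : Circle) : ℂ) =
      ((σ.scale ^ (2 * p) * σ.area j : ℝ) : ℂ) *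
        σ.twistedAverage q p (fun i => c i / σ.area i) j := by
  rw [twistedAverage, Finset.mul_sum]
  refine Finset.sum_congr rfl fun T _ => ?_
  have h1 : (σ.area T.type : ℂ) ≠ 0 := Complex.ofReal_ne_zero.2 (σ.area_pos hne _).ne'
  have h2 : (σ.area j : ℂ) ≠ 0 := Complex.ofReal_ne_zero.2 (σ.area_pos hne _).ne'
  have h3 : (σ.scale : ℂ) ≠ 0 := Complex.ofReal_ne_zero.2 σ.scale_pos.ne'
  push_cast
  field_simp

/-- Sums of continuous functions of the orientations of the tiles of large supertiles are
asymptotically rotation invariant. -/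
lemma eventually_norm_sum_tiles_sub_le (hσ : σ.IsPrimitive) (hne : ∀ i, (σ.proto i).Nonempty)
    (hcan : σ.HasCancellation) (F : Fin m → C(Circle, ℂ)) (j : Fin m) {ε : ℝ} (hε : 0 < ε) :
    ∀ᶠ p in atTop, ∀ ρ ρ' : Circle,
      ‖∑ T ∈ σ.tiles p j, F T.type (ρ * T.rot) - ∑ T ∈ σ.tiles p j, F T.type (ρ' * T.rot)‖ ≤
        ε * σ.scale ^ (2 * p) := by
  obtain ⟨g, hg0, hg⟩ := σ.exists_area_lower_bound hne
  have haj := σ.area_pos hne j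
  -- There are at most `λ ^ (2 * p) * area j / g` tiles, so the approximation errors total at most
  -- `ε / 4` per unit of `λ ^ (2 * p)`.
  set δ := ε * g / (4 * σ.area j) with hδ
  have hδ0 : 0 < δ := by positivity
  choose c hc using fun i => exists_trigPolynomial_approx (F i) hδ0
  let Q : Finset ℤ := Finset.univ.biUnion fun i => (c i).support
  have hc' : ∀ i (z : Circle), ‖F i z - ∑ q ∈ Q, c i q * ((z ^ q : Circle) : ℂ)‖ ≤ δ := by
    intro i z
    convert hc i z using 3
    refine (Finset.sum_subset (Finset.subset_biUnion_of_mem (fun i => (c i).support)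
      (Finset.mem_univ i)) fun q _ hq => ?_).symm
    rw [Finsupp.notMem_support_iff.1 hq, zero_mul]
  let w : ℤ → ℕ → ℂ := fun q p => σ.twistedAverage q p (fun i => c i q / σ.area i) j
  have hw : Tendsto (fun p => ∑ q ∈ Q.erase 0, 2 * (σ.area j * ‖w q p‖)) atTop (𝓝 0) := by
    have h1 : ∀ q ∈ Q.erase 0, Tendsto (fun p => 2 * (σ.area j * ‖w q p‖)) atTop (𝓝 0) := by
      intro q hq
      have h2 := (tendsto_pi_nhds.1 (tendsto_twistedAverage hσ hne hcan (Finset.ne_of_mem_erase hq)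
        fun i => c i q / σ.area i) j).norm
      simpa using (h2.const_mul (σ.area j)).const_mul 2
    simpa using tendsto_finsetSum _ h1
  filter_upwards [hw.eventually_le_const (show 0 < ε / 2 by positivity)] with p hp ρ ρ'
  have hsc : 0 < σ.scale ^ (2 * p) := pow_pos σ.scale_pos _
  let P : Circle → ℂ := fun ρ => ∑ T ∈ σ.tiles p j, ∑ q ∈ Q,
    c T.type q * (((ρ * T.rot) ^ q : Circle) : ℂ)
  have happrox : ∀ ρ : Circle, ‖∑ T ∈ σ.tiles p j, F T.type (ρ * T.rot) - P ρ‖ ≤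
      ε / 4 * σ.scale ^ (2 * p) := by
    intro ρ
    rw [← Finset.sum_sub_distrib]
    refine (norm_sum_le_of_le _ fun T _ => hc' _ _).trans ?_
    rw [Finset.sum_const, nsmul_eq_mul, hδ, ← mul_div_assoc, div_le_iff₀ (by positivity)]
    have h1 := mul_le_mul_of_nonneg_left (card_tiles_mul_le hg p j) hε.le
    calc _ = ε * ((σ.tiles p j).card * g) := by ring
      _ ≤ _ := h1
      _ = _ := by ring
  have hP : ∀ ρ : Circle, P ρ = ∑ q ∈ Q, ((ρ ^ q : Circle) : ℂ) *
      (((σ.scale ^ (2 * p) * σ.area j : ℝ) : ℂ) * w q p) := by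
    intro ρ
    simp only [P]
    rw [Finset.sum_comm]
    refine Finset.sum_congr rfl fun q _ => ?_
    rw [← sum_tiles_zpow_eq hne q p j fun i => c i q, Finset.mul_sum]
    refine Finset.sum_congr rfl fun T _ => ?_
    rw [mul_zpow, Circle.coe_mul]
    ring
  have hPdiff : ‖P ρ - P ρ'‖ ≤ ε / 2 * σ.scale ^ (2 * p) := by
    rw [hP, hP, ← Finset.sum_sub_distrib]
    have h1 : ∑ q ∈ Q, (((ρ ^ q : Circle) : ℂ) * (((σ.scale ^ (2 * p) * σ.area j : ℝ) : ℂ) * w q p) -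
        ((ρ' ^ q : Circle) : ℂ) * (((σ.scale ^ (2 * p) * σ.area j : ℝ) : ℂ) * w q p)) =
        ∑ q ∈ Q.erase 0, (((ρ ^ q : Circle) : ℂ) * (((σ.scale ^ (2 * p) * σ.area j : ℝ) : ℂ) * w q p) -
        ((ρ' ^ q : Circle) : ℂ) * (((σ.scale ^ (2 * p) * σ.area j : ℝ) : ℂ) * w q p)) := by
      -- The frequency `q = 0` does not feel the rotation and drops out of the difference; it is the
      -- one frequency whose averages need not decay.
      refine (Finset.sum_subset (Finset.erase_subset _ _) fun q hq hq' => ?_).symm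
      have : q = 0 := by
        by_contra h
        exact hq' (Finset.mem_erase.2 ⟨h, hq⟩)
      rw [this, zpow_zero, zpow_zero, sub_self]
    rw [h1]
    have h2 : ∀ q ∈ Q.erase 0,
        ‖((ρ ^ q : Circle) : ℂ) * (((σ.scale ^ (2 * p) * σ.area j : ℝ) : ℂ) * w q p) -
          ((ρ' ^ q : Circle) : ℂ) * (((σ.scale ^ (2 * p) * σ.area j : ℝ) : ℂ) * w q p)‖ ≤
        2 * (σ.area j * ‖w q p‖) * σ.scale ^ (2 * p) := by
      intro q _
      have h3 : ∀ ρ : Circle, ‖(ρ : ℂ) * (((σ.scale ^ (2 * p) * σ.area j : ℝ) : ℂ) * w q p)‖ =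
          σ.scale ^ (2 * p) * σ.area j * ‖w q p‖ := fun ρ => by
        rw [norm_mul, Circle.norm_coe ρ, one_mul, norm_mul, Complex.norm_real, Real.norm_eq_abs,
          abs_of_pos (by positivity)]
      refine (norm_sub_le _ _).trans ?_
      rw [h3 (ρ ^ q), h3 (ρ' ^ q)]
      exact le_of_eq (by ring)
    refine (norm_sum_le_of_le _ h2).trans ?_
    rw [← Finset.sum_mul]
    gcongr
  have h1 := happrox ρ
  have h2 := happrox ρ'
  rw [norm_sub_rev] at h2
  have h3 : ∑ T ∈ σ.tiles p j, F T.type (ρ * T.rot) - ∑ T ∈ σ.tiles p j, F T.type (ρ' * T.rot) =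
      (∑ T ∈ σ.tiles p j, F T.type (ρ * T.rot) - P ρ) + (P ρ - P ρ') +
        (P ρ' - ∑ T ∈ σ.tiles p j, F T.type (ρ' * T.rot)) := by ring
  rw [h3]
  refine (norm_add₃_le).trans ?_
  linarith

/-- The pair sum of a rotated test function over the supertile `σ^k(P_i)`. -/
def rotatedPairSum (σ : Substitution m) (x : Fin m → ℂ) (f : ℂ → ℝ) (k : ℕ) (i : Fin m)
    (ρ : Circle) : ℝ :=
  pairSum (σ.points x k i) fun z => f (ρ * z)

lemma continuous_rotatedPairSum {f : ℂ → ℝ} (hf : Continuous f) (k : ℕ) (i : Fin m) :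
    Continuous (rotatedPairSum σ x f k i) := by
  unfold rotatedPairSum pairSum
  refine continuous_finsetSum _ fun y _ => continuous_finsetSum _ fun z _ => ?_
  exact hf.comp (continuous_subtype_val.mul continuous_const)

lemma tendsto_sum_card_boundaryPoints (hσ : σ.IsPrimitive) (hx : ∀ i, x i ∈ σ.proto i) (R : ℝ) :
    Tendsto (fun k => (∑ i, ((σ.boundaryPoints x R k i).card : ℝ)) / σ.scale ^ (2 * k))
      atTop (𝓝 0) := by
  simp_rw [Finset.sum_div]
  simpa using tendsto_finsetSum Finset.univ fun i _ => tendsto_card_boundaryPoints hσ hx R i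

lemma sum_boundaryPoints_le (R : ℝ) (k : ℕ) (I : Finset (Tile m)) :
    ∑ S ∈ I, ((σ.boundaryPoints x R k S.type).card : ℝ) ≤
      I.card * ∑ i, ((σ.boundaryPoints x R k i).card : ℝ) := by
  rw [← nsmul_eq_mul]
  refine Finset.sum_le_card_nsmul _ _ _ fun S _ => ?_
  exact Finset.single_le_sum (f := fun i => ((σ.boundaryPoints x R k i).card : ℝ))
    (fun i _ => Nat.cast_nonneg _) (Finset.mem_univ S.type)

/-- The pair sums over large supertiles are asymptotically rotation invariant. -/
lemma eventually_abs_rotatedPairSum_sub_le (hσ : σ.IsPrimitive) (hx : ∀ i, x i ∈ σ.proto i)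
    (hcan : σ.HasCancellation) {N : ℝ → ℕ}
    (hN : ∀ A, NonOverlapping σ.proto A → LocallySparse (controlPoints x A) N)
    {f : ℂ → ℝ} (hfc : Continuous f) {R C : ℝ} (hR : 0 ≤ R) (hC : ∀ z, |f z| ≤ C)
    (hf : ∀ z, f z ≠ 0 → ‖z‖ ≤ R) {ε : ℝ} (hε : 0 < ε) :
    ∀ᶠ n in atTop, ∀ j, ∀ ρ ρ' : Circle,
      |rotatedPairSum σ x f n j ρ - rotatedPairSum σ x f n j ρ'| ≤ ε * σ.scale ^ (2 * n) := by
  classical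
  have hne : ∀ i, (σ.proto i).Nonempty := fun i => ⟨x i, hx i⟩
  obtain ⟨g, hg0, hg⟩ := σ.exists_area_lower_bound hne
  rw [eventually_all]
  intro j
  have haj := σ.area_pos hne j
  have hCN : 0 ≤ C * N R := mul_nonneg ((abs_nonneg _).trans (hC 0)) (Nat.cast_nonneg _)
  -- The inner order `k` is fixed first, to make boundary losses small; only then does the outer
  -- order `p` grow, for a now fixed family of functions on the circle.
  obtain ⟨k, hk⟩ : ∃ k, 4 * (C * N R) * (σ.area j / g) *
      ((∑ i, ((σ.boundaryPoints x R k i).card : ℝ)) / σ.scale ^ (2 * k)) ≤ ε / 2 := by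
    have h1 := (tendsto_sum_card_boundaryPoints (σ := σ) hσ hx R).const_mul
      (4 * (C * N R) * (σ.area j / g))
    rw [mul_zero] at h1
    exact (h1.eventually_le_const (by positivity)).exists
  have hsk : 0 < σ.scale ^ (2 * k) := pow_pos σ.scale_pos _
  let F : Fin m → C(Circle, ℂ) := fun i => ⟨fun ρ => (rotatedPairSum σ x f k i ρ : ℂ),
    Complex.continuous_ofReal.comp (continuous_rotatedPairSum hfc k i)⟩
  have hev := eventually_norm_sum_tiles_sub_le hσ hne hcan F j
    (show 0 < ε / 2 * σ.scale ^ (2 * k) by positivity)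
  obtain ⟨p₀, hp₀⟩ := eventually_atTop.1 hev
  filter_upwards [eventually_ge_atTop (k + p₀)] with n hn ρ ρ'
  obtain ⟨p, rfl⟩ := Nat.exists_eq_add_of_le (show k ≤ n by omega)
  have h1 := hp₀ p (by omega) ρ ρ'
  have hsp : 0 < σ.scale ^ (2 * p) := pow_pos σ.scale_pos _
  set B := ∑ i, ((σ.boundaryPoints x R k i).card : ℝ) with hB
  have hdec : ∀ ρ : Circle, |rotatedPairSum σ x f (k + p) j ρ -
      ∑ T ∈ σ.tiles p j, rotatedPairSum σ x f k T.type (ρ * T.rot)| ≤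
      ε / 4 * σ.scale ^ (2 * (k + p)) := by
    intro ρ
    have h2 := abs_pairSum_iterate_sub_le (f := fun z => f (ρ * z)) hx hN hR (fun z => hC _)
      (fun z hz => by
        have := hf _ hz
        rwa [norm_mul, Circle.norm_coe ρ, one_mul] at this) (σ.nonOverlapping_tiles p j) k
    rw [biUnion_pointsOf_tiles] at h2
    have h3 : ∀ S : Tile m, (pairSum (σ.points x k S.type) fun z => f (ρ * (S.rot * z))) =
        rotatedPairSum σ x f k S.type (ρ * S.rot) := by
      intro S
      unfold rotatedPairSum
      congr 1
      ext z
      rw [Circle.coe_mul, mul_assoc]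
    simp only [h3] at h2
    refine h2.trans ?_
    have hBk : 4 * (C * N R) * (σ.area j / g) * B ≤ ε / 2 * σ.scale ^ (2 * k) := by
      rwa [← mul_div_assoc, div_le_iff₀ hsk] at hk
    have hcard : ((σ.tiles p j).card : ℝ) ≤ σ.scale ^ (2 * p) * (σ.area j / g) := by
      rw [← mul_div_assoc, le_div_iff₀ hg0]
      exact card_tiles_mul_le hg p j
    have hB0 : 0 ≤ B := Finset.sum_nonneg fun i _ => Nat.cast_nonneg _
    have hsum := (sum_boundaryPoints_le (σ := σ) (x := x) R k (σ.tiles p j)).trans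
      (mul_le_mul_of_nonneg_right hcard hB0)
    have h2CN : 0 ≤ 2 * (C * N R) := by positivity
    calc 2 * (C * N R) * ∑ S ∈ σ.tiles p j, ((σ.boundaryPoints x R k S.type).card : ℝ)
        ≤ 2 * (C * N R) * ((σ.scale ^ (2 * p) * (σ.area j / g)) * B) :=
          mul_le_mul_of_nonneg_left hsum h2CN
      _ = 1 / 2 * (4 * (C * N R) * (σ.area j / g) * B) * σ.scale ^ (2 * p) := by ring
      _ ≤ 1 / 2 * (ε / 2 * σ.scale ^ (2 * k)) * σ.scale ^ (2 * p) := by gcongr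
      _ = _ := by rw [mul_add, pow_add]; ring
  have h4 : |∑ T ∈ σ.tiles p j, rotatedPairSum σ x f k T.type (ρ * T.rot) -
      ∑ T ∈ σ.tiles p j, rotatedPairSum σ x f k T.type (ρ' * T.rot)| ≤
      ε / 2 * σ.scale ^ (2 * (k + p)) := by
    have h5 : ∀ ρ : Circle, ∑ T ∈ σ.tiles p j, F T.type (ρ * T.rot) =
        ((∑ T ∈ σ.tiles p j, rotatedPairSum σ x f k T.type (ρ * T.rot) : ℝ) : ℂ) := fun ρ => by
      rw [Complex.ofReal_sum]
      rfl
    rw [h5, h5, ← Complex.ofReal_sub, Complex.norm_real, Real.norm_eq_abs] at h1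
    rw [mul_add, pow_add]
    linarith
  have h5 := hdec ρ
  have h6 := hdec ρ'
  rw [abs_sub_comm] at h6
  have h7 := abs_sub_le (rotatedPairSum σ x f (k + p) j ρ)
    (∑ T ∈ σ.tiles p j, rotatedPairSum σ x f k T.type (ρ * T.rot))
    (rotatedPairSum σ x f (k + p) j ρ')
  have h8 := abs_sub_le (∑ T ∈ σ.tiles p j, rotatedPairSum σ x f k T.type (ρ * T.rot))
    (∑ T ∈ σ.tiles p j, rotatedPairSum σ x f k T.type (ρ' * T.rot))
    (rotatedPairSum σ x f (k + p) j ρ')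
  linarith

lemma tendsto_add_sq_div_sq (a : ℝ) : Tendsto (fun r : ℝ => (r + a) ^ 2 / r ^ 2) atTop (𝓝 1) := by
  have h1 : Tendsto (fun r : ℝ => (1 + a / r) ^ 2) atTop (𝓝 ((1 + 0) ^ 2)) :=
    ((tendsto_const_nhds.div_atTop tendsto_id).const_add 1).pow 2
  rw [add_zero, one_pow] at h1
  refine h1.congr' ?_
  filter_upwards [eventually_ne_atTop 0] with r hr
  field_simp

/-- Rotating the test function does not change the finite autocorrelations asymptotically. -/
theorem IsSubstitutionTiling.tendsto_integral_rotate_sub (hσ : σ.IsPrimitive)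
    {𝒯 : Set (Tile m)} (h𝒯 : σ.IsSubstitutionTiling 𝒯)
    (hcirc : σ.HasStatisticalCircularSymmetry 𝒯) (hx : ∀ i, x i ∈ σ.proto i)
    (f : C_c(ℂ, ℝ)) (ρ : Circle) :
    Tendsto (fun r : ℝ => ∫ z, f (ρ * z) ∂(finiteAutocorrelation (controlPoints x 𝒯) r) -
      ∫ z, f z ∂(finiteAutocorrelation (controlPoints x 𝒯) r)) atTop (𝓝 0) := by
  have hne : ∀ i, (σ.proto i).Nonempty := fun i => ⟨x i, hx i⟩
  have hinf := hcirc.infinite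
  have hcan := hcirc.hasCancellation
  obtain ⟨N, hN⟩ := exists_locallySparse (σ := σ) hx
  obtain ⟨g, hg0, hg⟩ := σ.exists_area_lower_bound hne
  obtain ⟨D, hD0, hD⟩ := σ.exists_diam_bound
  obtain ⟨R, hR⟩ := exists_closedBall_support f
  have hf : ∀ z, f z ≠ 0 → ‖z‖ ≤ (R : ℝ) := fun z hz => by
    by_contra h
    exact hz (hR z fun h' => h (mem_closedBall_zero_iff.1 h'))
  obtain ⟨C, hC⟩ : ∃ C, ∀ z, |f z| ≤ C :=
    f.hasCompactSupport.exists_bound_of_continuous f.continuous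
  have hCN : 0 ≤ C * N R := mul_nonneg ((abs_nonneg _).trans (hC 0)) (Nat.cast_nonneg _)
  have hpi := Real.pi_pos
  rw [Metric.tendsto_nhds]
  intro ε hε
  -- The limiting error is `2 * δ / g = ε / 4`: one `δ` from rotating the supertiles, and `δ / 2`
  -- from the supertile boundaries for each of the two test functions.
  set δ := ε * g / 8 with hδ
  have hδ0 : 0 < δ := by positivity
  obtain ⟨n, hnA, hnB⟩ := ((eventually_abs_rotatedPairSum_sub_le hσ hx hcan hN f.continuous
    (Nat.cast_nonneg R) hC hf hδ0).and
    (((tendsto_sum_card_boundaryPoints (σ := σ) hσ hx R).const_mul (4 * (C * N R))).eventually_le_const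
      (u := δ) (by rwa [mul_zero]))).exists
  set B := ∑ i, ((σ.boundaryPoints x R n i).card : ℝ) with hB
  have hsn : 0 < σ.scale ^ (2 * n) := pow_pos σ.scale_pos _
  rw [← mul_div_assoc, div_le_iff₀ hsn] at hnB
  set a := σ.scale ^ n * D with ha
  -- The final bound divided by the area of the ball: the first term counts supertiles, the second
  -- is the annulus near the boundary of the ball, whose relative area vanishes since `n` is fixed.
  have hlim : Tendsto (fun r : ℝ => (r + a) ^ 2 / r ^ 2 * (2 * δ / g) +
      4 * (C * N R) / g * ((r + a) ^ 2 / r ^ 2 - (r + -D) ^ 2 / r ^ 2)) atTop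
      (𝓝 (1 * (2 * δ / g) + 4 * (C * N R) / g * (1 - 1))) :=
    ((tendsto_add_sq_div_sq a).mul_const _).add
      (((tendsto_add_sq_div_sq a).sub (tendsto_add_sq_div_sq (-D))).const_mul _)
  have hlt : 1 * (2 * δ / g) + 4 * (C * N R) / g * (1 - 1) < ε := by
    rw [sub_self, mul_zero, add_zero, one_mul, hδ, div_lt_iff₀ hg0]
    nlinarith
  clear_value δ
  filter_upwards [hlim.eventually_lt_const hlt, eventually_ge_atTop D, eventually_gt_atTop 0]
    with r hr hrD hr0
  rw [dist_zero_right, Real.norm_eq_abs]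
  refine lt_of_le_of_lt ?_ hr
  obtain ⟨J, hJcard, hJ⟩ := h𝒯.exists_pairSum_ball hinf hx hN hD hD0 hg0 hg n hrD
  have hfin := (hN 𝒯 h𝒯.1.2).finite r
  rw [integral_finiteAutocorrelation hfin, integral_finiteAutocorrelation hfin, ← smul_sub,
    smul_eq_mul, abs_mul, abs_of_nonneg (by positivity), volumeReal_closedBall hr0.le]
  have h1 := hJ f R C (Nat.cast_nonneg R) hC hf
  have h2 := hJ (fun z => f (ρ * z)) R C (Nat.cast_nonneg R) (fun z => hC _) fun z hz => by
    have := hf _ hz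
    rwa [norm_mul, Circle.norm_coe ρ, one_mul] at this
  have h3 : ∀ S : Tile m, (pairSum (σ.points x n S.type) fun z => f (ρ * (S.rot * z))) =
      rotatedPairSum σ x f n S.type (ρ * S.rot) := by
    intro S
    unfold rotatedPairSum
    congr 1
    ext z
    rw [Circle.coe_mul, mul_assoc]
  have h4 : ∀ S : Tile m, (pairSum (σ.points x n S.type) fun z => f (S.rot * z)) =
      rotatedPairSum σ x f n S.type S.rot := fun S => rfl
  simp only [h3] at h2
  simp only [h4] at h1
  have h5 : |∑ S ∈ J, rotatedPairSum σ x f n S.type (ρ * S.rot) -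
      ∑ S ∈ J, rotatedPairSum σ x f n S.type S.rot| ≤ J.card * (δ * σ.scale ^ (2 * n)) := by
    rw [← Finset.sum_sub_distrib, ← nsmul_eq_mul]
    exact (Finset.abs_sum_le_sum_abs _ _).trans
      (Finset.sum_le_card_nsmul _ _ _ fun S _ => hnA S.type _ _)
  set E := (Real.pi * (r + a) ^ 2 - Real.pi * (r - D) ^ 2) / g with hE
  have h6 : 2 * (C * N R) * (∑ S ∈ J, ((σ.boundaryPoints x R n S.type).card : ℝ) + E) ≤
      J.card * (δ * σ.scale ^ (2 * n) / 2) + 2 * (C * N R) * E := by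
    have h7 := mul_le_mul_of_nonneg_left (sum_boundaryPoints_le (σ := σ) (x := x) R n J) hCN
    have h8 := mul_le_mul_of_nonneg_left hnB (Nat.cast_nonneg (α := ℝ) J.card)
    rw [← hB] at h7
    linarith
  have h9 : |pairSum hfin.toFinset (fun z => f (ρ * z)) - pairSum hfin.toFinset f| ≤
      J.card * (2 * δ * σ.scale ^ (2 * n)) + 4 * (C * N R) * E := by
    rw [abs_sub_comm] at h1
    have h10 := abs_sub_le (pairSum hfin.toFinset fun z => f (ρ * z))
      (∑ S ∈ J, rotatedPairSum σ x f n S.type (ρ * S.rot)) (pairSum hfin.toFinset f)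
    have h11 := abs_sub_le (∑ S ∈ J, rotatedPairSum σ x f n S.type (ρ * S.rot))
      (∑ S ∈ J, rotatedPairSum σ x f n S.type S.rot) (pairSum hfin.toFinset f)
    linarith
  have h12 : J.card * (2 * δ * σ.scale ^ (2 * n)) ≤ Real.pi * (r + a) ^ 2 * (2 * δ / g) := by
    rw [← mul_div_assoc, le_div_iff₀ hg0]
    have := mul_le_mul_of_nonneg_right hJcard (show 0 ≤ 2 * δ by positivity)
    linarith
  calc (Real.pi * r ^ 2)⁻¹ * |pairSum hfin.toFinset (fun z => f (ρ * z)) - pairSum hfin.toFinset f|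
      ≤ (Real.pi * r ^ 2)⁻¹ * (Real.pi * (r + a) ^ 2 * (2 * δ / g) + 4 * (C * N R) * E) := by
        gcongr
        linarith
    _ = _ := by
        rw [hE]
        field_simp
        ring

end Substitution

end CircularTiling

end

open CircularTiling in
theorem mainTheorem4 {m : ℕ} (σ : Substitution m) (hσ : σ.IsPrimitive)
    (𝒯 : Set (Tile m)) (h𝒯 : σ.IsSubstitutionTiling 𝒯)
    (hcirc : σ.HasStatisticalCircularSymmetry 𝒯)
    (x : Fin m → ℂ) (hx : ∀ i, x i ∈ σ.proto i) :
    (∃ γ : MeasureTheory.Measure ℂ, IsAutocorrelation (controlPoints x 𝒯) γ) ∧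
      ∀ γ : MeasureTheory.Measure ℂ, IsAutocorrelation (controlPoints x 𝒯) γ →
        (∃ γhat : MeasureTheory.Measure ℂ, IsFourierTransform γ γhat) ∧
          ∀ γhat : MeasureTheory.Measure ℂ, IsFourierTransform γ γhat →
            IsCircularSymmetric γhat ∧
              ∃ c : NNReal, purePointPart γhat = c • MeasureTheory.Measure.dirac 0 := by
  have hnov := h𝒯.1.2
  obtain ⟨N, hN⟩ := Substitution.exists_locallySparse (σ := σ) hx
  obtain ⟨r₀, c, hc⟩ := Substitution.exists_quadraticGrowth (σ := σ) hx hnov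
  refine ⟨exists_isAutocorrelation (hN 𝒯 hnov) hc, fun γ hγ =>
    ⟨hγ.exists_isFourierTransform (hN 𝒯 hnov) hc, fun γhat hγhat => ?_⟩⟩
  have hsymm := hγ.isCircularSymmetric fun f ρ =>
    Substitution.IsSubstitutionTiling.tendsto_integral_rotate_sub hσ h𝒯 hcirc hx f ρ
  have h := hγhat.isCircularSymmetric hsymm
  exact ⟨h, h.purePointPart_eq hγhat.2.1⟩
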